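/- Let $A_0\in\mathbb R^{2\times 2}$ have eigenvalues $\mu_1,\mu_2\in\mathbb C$ (counted with algebraic multiplicity), let $B_0\in\mathbb R^2$, and consider on $H=L^2(0,\pi;\mathbb C)^2$ the boundary control system $$y_t-y_{xx}=A_0y\ \text{ in }(0,\pi)\times(0,\infty),\qquad y(0,t)=B_0u(t),\quad y(\pi,t)=0,\qquad y(\cdot,0)=y_0\in H,$$ with scalar controls $u\in L^2_{\rm loc}(0,\infty;\mathbb C)$. Its solution $y\in L^2_{\rm loc}(0,\infty;H)$ is understood by transposition: for every $T>0$ and every $\phi$ of class $C^2$ on $[0,\pi]\times[0,T]$ with values in $\mathbb C^2$ and $\phi(0,\cdot)=\phi(\pi,\cdot)=0$, $\phi(\cdot,T)=0$, $$\int_0^T\!\!\int_0^\pi y\cdot(-\phi_t-\phi_{xx}-A_0^*\phi)\,dx\,dt=\int_0^\pi y_0\cdot\phi(\cdot,0)\,dx+\int_0^T (B_0\cdot\phi_x(0,t))\,u(t)\,dt .$$ A control $u$ steers $y_0$ to rest in time at most $T$ if $u$ and the corresponding solution $y$ both vanish (almost everywhere) for $t>T$. The system is null controllable if every $y_0\in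 H$ can be steered to rest in some finite time (depending on $y_0$) by some control. It is null controllable with vanishing energy (NCVE) if for every $y_0\in H$ and every $\epsilon>0$ there are a time $T_\epsilon$ and a control $u$ steering $y_0$ to rest in time at most $T_\epsilon$ with $\int_0^\infty|u(t)|^2\,dt\le\epsilon^2$. Assume that the system is null controllable, or that $$\operatorname{rank}[B_0,\,A_0B_0]=2\quad\text{and}\quad \mu_1-\mu_2\neq j^2-k^2\ \text{ for all integers } j,k\ge 1,\ j\ne k$$ (this condition is known to be equivalent to null controllability, so either form of the hypothesis may be used). Then the system is NCVE if and only if $\operatorname{Re}\mu_i\le 1$ for $i=1,2$. -/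

import Mathlib

open MeasureTheory Set
open scoped Matrix

namespace CoupledHeat

/-- The real matrix `A₀`, read as a complex matrix. -/
noncomputable def complexify (A₀ : Matrix (Fin 2) (Fin 2) ℝ) : Matrix (Fin 2) (Fin 2) ℂ :=
  A₀.map (fun a => (a : ℂ))

/-- `y₀` represents an element of the state space `H = L²(0,π; ℂ)²`. -/
def IsState (y₀ : ℝ → Fin 2 → ℂ) : Prop :=
  MemLp y₀ 2 (volume.restrict (Ioo 0 Real.pi))

/-- `u` represents a control, i.e. an element of `L²_loc(0,+∞; ℂ)`
(square integrable on `(0,T)` for every `T > 0`). -/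
def IsControl (u : ℝ → ℂ) : Prop :=
  ∀ T : ℝ, 0 < T → MemLp u 2 (volume.restrict (Ioo 0 T))

/-- Test functions for the transposition method on `(0,T) × (0,π)`: functions `φ(t,x)` with values
in `ℂ²`, of class `C²` up to the boundary, which vanish at `x = 0`, at `x = π` and at `t = T`. -/
structure IsTest (T : ℝ) (φ : ℝ → ℝ → Fin 2 → ℂ) : Prop where
  contDiff : ContDiff ℝ 2 (fun p : ℝ × ℝ => φ p.1 p.2)
  left : ∀ t ∈ Icc 0 T, φ t 0 = 0
  right : ∀ t ∈ Icc 0 T, φ t Real.pi = 0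
  final : ∀ x ∈ Icc 0 Real.pi, φ T x = 0

/-- The source of the backward adjoint problem solved by `φ`:
`g = - φ_t - φ_xx - A₀* φ`. -/
noncomputable def adjointSource (A₀ : Matrix (Fin 2) (Fin 2) ℝ) (φ : ℝ → ℝ → Fin 2 → ℂ)
    (t x : ℝ) : Fin 2 → ℂ :=
  - deriv (fun s => φ s x) t - iteratedDeriv 2 (fun z => φ t z) x - (complexify A₀)ᵀ *ᵥ φ t x

/-- `y = y(t,x)` is the solution by transposition on `(0,T) × (0,π)` of
`y_t - y_xx = A₀ y`, `y(·,0) = B₀ u`, `y(·,π) = 0`, `y(0,·) = y₀`: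
`y ∈ L²((0,T) × (0,π))²`, and whenever `φ` solves the backward problem
`- φ_t - φ_xx = A₀* φ + g`, `φ(·,0) = φ(·,π) = 0`, `φ(T,·) = 0`, then
`∫∫ y · g dx dt = ∫ y₀ · φ(0,x) dx + ∫ (B₀ · φ_x(t,0)) u(t) dt`. -/
structure IsSolutionOn (A₀ : Matrix (Fin 2) (Fin 2) ℝ) (B₀ : Fin 2 → ℝ) (T : ℝ)
    (y₀ : ℝ → Fin 2 → ℂ) (u : ℝ → ℂ) (y : ℝ → ℝ → Fin 2 → ℂ) : Prop where
  memLp : MemLp (fun p : ℝ × ℝ => y p.1 p.2) 2 (volume.restrict (Ioo 0 T ×ˢ Ioo 0 Real.pi))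
  transposition : ∀ φ : ℝ → ℝ → Fin 2 → ℂ, IsTest T φ →
    ∫ p in Ioo 0 T ×ˢ Ioo 0 Real.pi, y p.1 p.2 ⬝ᵥ adjointSource A₀ φ p.1 p.2 =
      (∫ x in Ioo 0 Real.pi, y₀ x ⬝ᵥ φ 0 x) +
        ∫ t in Ioo 0 T, ((fun i => (B₀ i : ℂ)) ⬝ᵥ deriv (fun x => φ t x) 0) * u t

/-- `y` is the solution on `(0,+∞) × (0,π)`, an element of `L²_loc(0,+∞; H)`. -/
def IsSolution (A₀ : Matrix (Fin 2) (Fin 2) ℝ) (B₀ : Fin 2 → ℝ)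
    (y₀ : ℝ → Fin 2 → ℂ) (u : ℝ → ℂ) (y : ℝ → ℝ → Fin 2 → ℂ) : Prop :=
  ∀ T : ℝ, 0 < T → IsSolutionOn A₀ B₀ T y₀ u y

/-- The control `u` steers `y₀` to the rest in time at most `T`: the supports of `u` and of the
corresponding solution are contained in `[0,T]`. -/
def Steers (A₀ : Matrix (Fin 2) (Fin 2) ℝ) (B₀ : Fin 2 → ℝ)
    (y₀ : ℝ → Fin 2 → ℂ) (u : ℝ → ℂ) (T : ℝ) : Prop :=
  IsControl u ∧ (∀ᵐ t ∂(volume.restrict (Ioi T)), u t = 0) ∧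
    ∃ y : ℝ → ℝ → Fin 2 → ℂ, IsSolution A₀ B₀ y₀ u y ∧
      ∀ᵐ p ∂((volume : Measure (ℝ × ℝ)).restrict (Ioi T ×ˢ Ioo 0 Real.pi)), y p.1 p.2 = 0

/-- Null controllability: every initial state can be steered to the rest in a suitable time,
which may depend on the state. -/
def NullControllable (A₀ : Matrix (Fin 2) (Fin 2) ℝ) (B₀ : Fin 2 → ℝ) : Prop :=
  ∀ y₀ : ℝ → Fin 2 → ℂ, IsState y₀ → ∃ T : ℝ, 0 < T ∧ ∃ u : ℝ → ℂ, Steers A₀ B₀ y₀ u T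

/-- Null controllability with vanishing energy: every initial state can be steered to the rest
by controls of arbitrarily small `L²(0,+∞)` norm, in a time that may depend on the state and on
the required bound. -/
def NCVE (A₀ : Matrix (Fin 2) (Fin 2) ℝ) (B₀ : Fin 2 → ℝ) : Prop :=
  ∀ y₀ : ℝ → Fin 2 → ℂ, IsState y₀ → ∀ ε : ℝ, 0 < ε →
    ∃ T : ℝ, 0 < T ∧ ∃ u : ℝ → ℂ, Steers A₀ B₀ y₀ u T ∧ ∫ t in Ioi (0 : ℝ), ‖u t‖ ^ 2 ≤ ε ^ 2

end CoupledHeat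

/-!
Expanding the state in the functions `sin (k x)` turns the heat system into the ordinary
differential equations `z_k' = -k² z_k + A₀ z_k + (2k/π) u B₀`, and steering `y₀` to rest becomes
a moment problem: the vectors `moment (opA A₀) B₀ k u = ∫ u(t) e^{k²t} exp(-tA₀) B₀ dt` have to
take prescribed values for all `k ≥ 1`. A continuous control with compact support that solves it
does steer `y₀` to rest, since the modes add up to a solution by transposition
(`steers_of_moments`).

*Sufficiency.* The moments of index `k` are annihilated by a product of two delay operators
`u ↦ u - q u(· - a_k)`, one for each eigenvalue, because `exp(-tA₀)` satisfies a quadratic equation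
(`flow_cayley`). With `a_k = c / k^{3/2}` the delays are summable and the coefficients `q` are
`O(e^{-c√k})`, so that the infinite product over all `k ≠ j` converges and yields controls
supported in a common interval. On the moments of index `j` it acts by a product of factors that
are invertible, in the absence of resonances, with an inverse bounded by `e^{Cj²}`
(`exists_killFactor_inverse_bound`). Applied to a control with a prescribed `j`-th moment, which
the rank condition provides (`exists_baseControl`), this gives biorthogonal controls of cost
`O(e^{Dj²})` (`exists_biorthogonal`).

The energy is then made small in two ways. Waiting for a time `t₀` damps the modes with
`k² ≥ 2‖A₀‖` by `e^{-k²t₀/2}`, which beats the cost `e^{Dk²}` (`exists_small_energy_highModes`).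
Each of the remaining modes is treated by spreading its control over `2N` disjoint time windows with
weights of size `O(1/N)`: the energy is `O(1/N)`, and weights that keep the moment unchanged exist
because `Re μᵢ ≤ 1 ≤ j²` means that the uncontrolled mode does not grow exponentially
(`exists_small_coeff`, `exists_small_energy_singleMode`).

*Necessity.* A solution `e^{lt} ψ(x)` of the adjoint equation, cut off after the system has come
to rest, is a test function, and it expresses the pairing of `y₀` with `ψ` through the control
(`Steers.integral_state`). If `Re μ > 1` for an eigenvalue `μ`, take `l = 1 - μ` and
`ψ = sin x • w` with a left eigenvector `w`: the exponential decays, so that controls of small energy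
force a small pairing, which fails for `y₀` the conjugate of `ψ` (`NCVE.re_le_one`). The same identity
with functions `ψ` that the boundary observation does not see shows that null controllability
implies the rank condition and the absence of resonances
(`NullControllable.eq_zero_of_dotProduct`, `NullControllable.sub_ne`).
-/

namespace CoupledHeat
open Filter Topology

/-! ### The flow of the reaction matrix -/

/-- The group `t ↦ exp(-tA)` generated by `-A`. -/
noncomputable def flow {𝔸 : Type*} [NormedRing 𝔸] [NormedAlgebra ℂ 𝔸] (A : 𝔸) (t : ℝ) : 𝔸 :=
  NormedSpace.exp (t • (-A))

lemma flow_zero {𝔸 : Type*} [NormedRing 𝔸] [NormedAlgebra ℂ 𝔸] (A : 𝔸) : flow A 0 = 1 := by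
  simp [flow, NormedSpace.exp_zero]

section Flow

variable {𝔸 : Type*} [NormedRing 𝔸] [NormedAlgebra ℂ 𝔸] [CompleteSpace 𝔸] (A : 𝔸)

lemma hasDerivAt_flow (t : ℝ) : HasDerivAt (flow A) (-(A * flow A t)) t := by
  have := hasDerivAt_exp_smul_const' (𝕂 := ℝ) (-A) t
  rw [neg_mul] at this
  exact this

lemma hasDerivAt_flow' (t : ℝ) : HasDerivAt (flow A) (-(flow A t * A)) t := by
  have := hasDerivAt_exp_smul_const (𝕂 := ℝ) (-A) t
  rw [mul_neg] at this
  exact this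

lemma continuous_flow : Continuous (flow A) :=
  continuous_iff_continuousAt.2 fun t => (hasDerivAt_flow A t).continuousAt

lemma flow_add (s t : ℝ) : flow A (s + t) = flow A s * flow A t := by
  let _ : NormedAlgebra ℚ (𝔸) := NormedAlgebra.restrictScalars ℚ ℂ _
  unfold flow
  rw [add_smul]
  exact NormedSpace.exp_add_of_commute
    (((Commute.refl (-A)).smul_left s).smul_right t)

lemma flow_neg_mul (t : ℝ) : flow A (-t) * flow A t = 1 := by
  rw [← flow_add, neg_add_cancel, flow_zero]

lemma flow_mul_neg (t : ℝ) : flow A t * flow A (-t) = 1 := by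
  rw [← flow_add, add_neg_cancel, flow_zero]

lemma flow_nat_mul (t : ℝ) (n : ℕ) : flow A (n * t) = flow A t ^ n := by
  induction n with
  | zero => simp [flow_zero]
  | succ n ih => rw [pow_succ, ← ih, ← flow_add]; push_cast; ring_nf

lemma norm_flow_le [NormOneClass 𝔸] (t : ℝ) : ‖flow A t‖ ≤ Real.exp (|t| * ‖A‖) := by
  have hs := NormedSpace.exp_series_hasSum_exp' (𝕂 := ℂ) (t • (-A))
  refine hs.norm_le_of_bounded
    (by simpa [Real.exp_eq_exp_ℝ] using
      NormedSpace.exp_series_hasSum_exp' (𝕂 := ℝ) (|t| * ‖A‖)) fun n => ?_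
  rw [norm_smul, norm_inv, Complex.norm_natCast]
  gcongr
  refine (norm_pow_le _ _).trans (pow_le_pow_left₀ (norm_nonneg _) ?_ _)
  rw [norm_smul, norm_neg, Real.norm_eq_abs]

/-- `exp(-tA) - e^{-tμ}` is a multiple of `A - μ`, on either side. -/
lemma exists_flow_sub_eq (μ : ℂ) (t : ℝ) :
    ∃ h : 𝔸,
      flow A t - Complex.exp (-(t * μ)) • 1 = h * (A - μ • 1) ∧
      flow A t - Complex.exp (-(t * μ)) • 1 = (A - μ • 1) * h := by
  set G : ℝ → 𝔸 :=
    fun s => Complex.exp (s * μ) • flow A s with hG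
  have hc : Continuous G := by
    have := continuous_flow A
    fun_prop
  have he : ∀ s : ℝ, HasDerivAt (fun s : ℝ => Complex.exp (s * μ)) (Complex.exp (s * μ) * μ) s := by
    intro s
    have h1 : HasDerivAt (fun s : ℝ => (s : ℂ) * μ) μ s := by
      simpa using (Complex.ofRealCLM.hasDerivAt (x := s)).mul_const μ
    exact h1.cexp
  have h1 : ∀ s, HasDerivAt G (-(G s * (A - μ • 1))) s := by
    intro s
    refine ((he s).smul (hasDerivAt_flow' A s)).congr_deriv ?_
    simp only [hG, mul_sub, smul_mul_assoc, mul_smul_comm, mul_one, smul_smul]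
    module
  have h2 : ∀ s, HasDerivAt G (-((A - μ • 1) * G s)) s := by
    intro s
    refine ((he s).smul (hasDerivAt_flow A s)).congr_deriv ?_
    simp only [hG, sub_mul, smul_mul_assoc, mul_smul_comm, one_mul]
    module
  have hint : IntervalIntegrable G volume 0 t := hc.intervalIntegrable _ _
  have i1 : G t - G 0 = -((∫ s in (0 : ℝ)..t, G s) * (A - μ • 1)) := by
    rw [← intervalIntegral.integral_eq_sub_of_hasDerivAt (fun s _ => h1 s)
      (Continuous.intervalIntegrable (by fun_prop) _ _), intervalIntegral.integral_neg]
    congr 1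
    exact ((ContinuousLinearMap.mul ℂ _).flip (A - μ • 1)).intervalIntegral_comp_comm hint
  have i2 : G t - G 0 = -((A - μ • 1) * (∫ s in (0 : ℝ)..t, G s)) := by
    rw [← intervalIntegral.integral_eq_sub_of_hasDerivAt (fun s _ => h2 s)
      (Continuous.intervalIntegrable (by fun_prop) _ _), intervalIntegral.integral_neg]
    congr 1
    exact ((ContinuousLinearMap.mul ℂ _) (A - μ • 1)).intervalIntegral_comp_comm hint
  have h0 : flow A t - Complex.exp (-(t * μ)) • 1 = Complex.exp (-(t * μ)) • (G t - G 0) := by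
    simp only [hG, smul_sub, smul_smul, ← Complex.exp_add, flow_zero]
    simp
  refine ⟨-(Complex.exp (-(t * μ)) • ∫ s in (0 : ℝ)..t, G s), ?_, ?_⟩
  · rw [h0, i1, neg_mul, smul_mul_assoc, smul_neg]
  · rw [h0, i2, mul_neg, mul_smul_comm, smul_neg]

variable {A}

/-- The Cayley–Hamilton relation of `A` passes to the exponential: `e^{-tμ₁}`, `e^{-tμ₂}` are the
roots of a quadratic polynomial annihilating `exp(-tA)`. -/
lemma flow_cayley {μ₁ μ₂ : ℂ} (hA : (A - μ₁ • 1) * (A - μ₂ • 1) = 0) (t : ℝ) :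
    (flow A t - Complex.exp (-(t * μ₁)) • 1) * (flow A t - Complex.exp (-(t * μ₂)) • 1) = 0 := by
  obtain ⟨h, h1, -⟩ := exists_flow_sub_eq A μ₁ t
  obtain ⟨k, -, k2⟩ := exists_flow_sub_eq A μ₂ t
  rw [h1, k2, mul_assoc, ← mul_assoc (A - μ₁ • 1), hA, zero_mul, mul_zero]

end Flow

/-! ### Inverses of the annihilating factors -/

/-- The delays used to annihilate the moments of index `k`: they are summable, while
`k² * delay c k = c * √k` tends to infinity. -/
noncomputable def delay (c : ℝ) (k : ℕ) : ℝ := c / (k * √k)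

lemma delay_nonneg {c : ℝ} (hc : 0 ≤ c) (k : ℕ) : 0 ≤ delay c k := by
  unfold delay; positivity

lemma delay_le {c : ℝ} (hc : 0 ≤ c) (k : ℕ) : delay c k ≤ c := by
  unfold delay
  rcases Nat.eq_zero_or_pos k with rfl | hk
  · simpa using hc
  · have h1 : (1 : ℝ) ≤ k := by exact_mod_cast hk
    have h2 : 1 ≤ √(k : ℝ) := Real.one_le_sqrt.2 h1
    exact div_le_self hc (by nlinarith)

lemma le_delay {c : ℝ} (hc : 0 ≤ c) {k : ℕ} (hk : 1 ≤ k) : c / k ^ 2 ≤ delay c k := by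
  unfold delay
  have h1 : (1 : ℝ) ≤ k := by exact_mod_cast hk
  have h2 : √(k : ℝ) ≤ k := Real.sqrt_le_iff.2 ⟨by linarith, by nlinarith⟩
  have h3 : 1 ≤ √(k : ℝ) := Real.one_le_sqrt.2 h1
  rw [pow_two]
  gcongr

lemma sq_mul_delay (c : ℝ) {k : ℕ} (hk : 1 ≤ k) : (k : ℝ) ^ 2 * delay c k = c * √k := by
  unfold delay
  have h1 : (1 : ℝ) ≤ k := by exact_mod_cast hk
  have h3 : 1 ≤ √(k : ℝ) := Real.one_le_sqrt.2 h1
  have h4 : √(k : ℝ) * √(k : ℝ) = k := Real.mul_self_sqrt (by linarith)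
  field_simp
  rw [pow_two, h4, mul_comm]

lemma summable_delay (c : ℝ) : Summable (delay c) := by
  have h : Summable fun k : ℕ => 1 / (k : ℝ) ^ (3 / 2 : ℝ) :=
    Real.summable_one_div_nat_rpow.2 (by norm_num)
  refine (h.mul_left c).congr fun k => ?_
  unfold delay
  rw [mul_one_div]
  congr 1
  rw [show (3 / 2 : ℝ) = 1 + 1 / 2 by norm_num, Real.sqrt_eq_rpow]
  rcases Nat.eq_zero_or_pos k with rfl | hk
  · norm_num
  · rw [Real.rpow_add (by exact_mod_cast hk), Real.rpow_one]

lemma exp_neg_le_div_pow_four {y : ℝ} (hy : 0 < y) : Real.exp (-y) ≤ 24 / y ^ 4 := by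
  rw [Real.exp_neg, inv_le_comm₀ (Real.exp_pos _) (by positivity), inv_div]
  have := Real.pow_div_factorial_le_exp y hy.le 4
  simpa [Nat.factorial] using this

/-- The bound used for small `x`; `inv_one_sub_exp_neg_le'` is the one for large `x`. -/
lemma inv_one_sub_exp_neg_le {x : ℝ} (hx : 0 < x) :
    (1 - Real.exp (-x))⁻¹ ≤ Real.exp (1 / x) := by
  have h1 : x + 1 ≤ Real.exp x := Real.add_one_le_exp x
  have h2 : Real.exp (-x) < 1 := Real.exp_lt_one_iff.2 (by linarith)
  have h3 : Real.exp (-x) ≤ 1 / (x + 1) := by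
    rw [Real.exp_neg, ← one_div]; gcongr
  have h4 : x / (x + 1) ≤ 1 - Real.exp (-x) := by
    have : x / (x + 1) = 1 - 1 / (x + 1) := by field_simp; ring
    linarith
  calc (1 - Real.exp (-x))⁻¹ ≤ (x / (x + 1))⁻¹ := by gcongr
    _ = 1 / x + 1 := by field_simp; ring
    _ ≤ _ := Real.add_one_le_exp _

lemma inv_one_sub_exp_neg_le' {x : ℝ} (hx : 0 < x) :
    (1 - Real.exp (-x))⁻¹ ≤ Real.exp (24 / x ^ 4) := by
  have h1 : x ^ 4 / 24 + 1 ≤ Real.exp x := by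
    have h := Real.sum_le_exp_of_nonneg hx.le 5
    simp [Finset.sum_range_succ, Nat.factorial] at h
    have : 0 ≤ x ^ 2 / 2 := by positivity
    have : 0 ≤ x ^ 3 / 6 := by positivity
    linarith
  have hy : 0 < x ^ 4 / 24 := by positivity
  set y := x ^ 4 / 24
  have h3 : Real.exp (-x) ≤ 1 / (y + 1) := by
    rw [Real.exp_neg, ← one_div]; gcongr
  have h4 : y / (y + 1) ≤ 1 - Real.exp (-x) := by
    have : y / (y + 1) = 1 - 1 / (y + 1) := by field_simp; ring
    linarith
  calc (1 - Real.exp (-x))⁻¹ ≤ (y / (y + 1))⁻¹ := by gcongr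
    _ = 1 / y + 1 := by field_simp; ring
    _ ≤ Real.exp (1 / y) := Real.add_one_le_exp _
    _ = _ := by simp [y]

lemma exists_leftInverse_one_sub {𝔸 : Type*} [NormedRing 𝔸] [CompleteSpace 𝔸] [NormOneClass 𝔸]
    {y : 𝔸} {x : ℝ} (hx : 0 < x) (hy : ‖y‖ ≤ Real.exp (-x)) :
    ∃ w : 𝔸, w * (1 - y) = 1 ∧ ‖w‖ ≤ (1 - Real.exp (-x))⁻¹ := by
  have h2 : Real.exp (-x) < 1 := Real.exp_lt_one_iff.2 (by linarith)
  have h1 : ‖y‖ < 1 := hy.trans_lt h2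
  refine ⟨∑' n, y ^ n, geom_series_mul_neg y h1, ?_⟩
  have := tsum_geometric_le_of_norm_lt_one y h1
  rw [norm_one, sub_self, zero_add] at this
  refine this.trans ?_
  have : 0 < 1 - Real.exp (-x) := by linarith
  gcongr

section Inverse

variable {𝔸 : Type*} [NormedRing 𝔸] [NormedAlgebra ℂ 𝔸] [CompleteSpace 𝔸]

/-- The factor by which the operator annihilating the moments of index `k` acts on the moments of
index `l`; here `m = l² - k²` and `a` is the delay. It vanishes for `l = k` by `flow_cayley`. -/
noncomputable def killFactor (A : 𝔸) (μ₁ μ₂ : ℂ) (m a : ℝ) : 𝔸 :=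
  (1 - Complex.exp ((m + μ₁) * a) • flow A a) * (1 - Complex.exp ((m + μ₂) * a) • flow A a)

/-- Away from resonances the factors are invertible: by `flow_cayley` the inverse is a polynomial
of degree one in `flow A a`. -/
lemma exists_leftInverse_of_cayley {A : 𝔸} {μ₁ μ₂ : ℂ} (hA : (A - μ₁ • 1) * (A - μ₂ • 1) = 0)
    (a : ℝ) {z : ℂ} (h1 : Complex.exp (z - a * μ₁) ≠ 1) (h2 : Complex.exp (z - a * μ₂) ≠ 1) :
    ∃ w : 𝔸, w * (1 - Complex.exp z • flow A a) = 1 := by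
  have hC := flow_cayley hA a
  rw [sub_eq_add_neg, Complex.exp_add] at h1 h2
  set E := flow A a
  set c := Complex.exp z
  set p := Complex.exp (-(a * μ₁))
  set q := Complex.exp (-(a * μ₂))
  have hE : E * E = (p + q) • E - (p * q) • 1 := by
    simp only [sub_mul, mul_sub, smul_mul_assoc, mul_smul_comm, mul_one, one_mul] at hC
    rw [← sub_eq_zero, ← hC]
    module
  have hD : (1 - c * p) * (1 - c * q) ≠ 0 :=
    mul_ne_zero (sub_ne_zero.2 h1.symm) (sub_ne_zero.2 h2.symm)
  refine ⟨((1 - c * p) * (1 - c * q))⁻¹ • ((1 - c * (p + q)) • 1 + c • E), ?_⟩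
  rw [smul_mul_assoc, inv_smul_eq_iff₀ hD]
  simp only [add_mul, mul_sub, smul_mul_assoc, mul_smul_comm, mul_one, one_mul, hE]
  module

variable [NormOneClass 𝔸]

lemma norm_exp_smul_flow_le (A : 𝔸) (z : ℂ) (a : ℝ) :
    ‖Complex.exp z • flow A a‖ ≤ Real.exp (z.re + |a| * ‖A‖) := by
  rw [norm_smul, Complex.norm_exp, Real.exp_add]
  exact mul_le_mul_of_nonneg_left (norm_flow_le A a) (Real.exp_pos _).le

/-- For large `|m|` a Neumann series inverts the factor: in powers of the exponential if `m < 0`, in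
powers of its inverse if `m ≥ 0`. -/
lemma exists_leftInverse_of_large {A : 𝔸} {μ : ℂ} {m a R : ℝ} (hR : ‖A‖ + ‖μ‖ ≤ R) (ha : 0 < a)
    (hm : R < |m|) :
    ∃ w : 𝔸, w * (1 - Complex.exp ((m + μ) * a) • flow A a) = 1 ∧
      ‖w‖ ≤ (1 - Real.exp (-((|m| - R) * a)))⁻¹ := by
  have hx : 0 < (|m| - R) * a := mul_pos (by linarith) ha
  have hμ : |μ.re| ≤ ‖μ‖ := Complex.abs_re_le_norm μ
  have hμ' := abs_le.1 hμ
  have hR0 : 0 ≤ R := by have := norm_nonneg A; have := norm_nonneg μ; linarith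
  rcases le_or_gt 0 m with h0 | h0
  · set Y := Complex.exp ((m + μ) * a) • flow A a
    set Y' := Complex.exp (-((m + μ) * a)) • flow A (-a) with hY'
    have hYY : Y' * Y = 1 := by
      simp only [Y, Y', smul_mul_smul_comm, flow_neg_mul, ← Complex.exp_add]
      simp
    have hn : ‖Y'‖ ≤ Real.exp (-((|m| - R) * a)) := by
      refine (norm_exp_smul_flow_le A _ _).trans (Real.exp_le_exp.2 ?_)
      rw [abs_of_nonneg h0, abs_neg, abs_of_pos ha]
      simp
      nlinarith
    obtain ⟨w, hw, hwn⟩ := exists_leftInverse_one_sub hx hn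
    refine ⟨-(Y' * w), ?_, ?_⟩
    · have : 1 - Y = -((1 - Y') * Y) := by rw [sub_mul, hYY, one_mul, neg_sub]
      rw [this, neg_mul_neg, mul_assoc, ← mul_assoc w, hw, one_mul, hYY]
    · rw [norm_neg]
      refine (norm_mul_le _ _).trans ?_
      have : ‖Y'‖ ≤ 1 := hn.trans (Real.exp_le_one_iff.2 (by linarith))
      calc ‖Y'‖ * ‖w‖ ≤ 1 * ‖w‖ := by gcongr
        _ ≤ _ := by rwa [one_mul]
  · refine exists_leftInverse_one_sub hx ?_
    refine (norm_exp_smul_flow_le A _ _).trans (Real.exp_le_exp.2 ?_)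
    rw [abs_of_neg h0, abs_of_pos ha]
    simp
    nlinarith

/-- The weight controlling the inverses of the annihilating factors. Only the factors with `k ≤ 2j`
can be small, and each of them by `e^{-Cj}` at most, so that the sum over `k` is `O(j²)`. -/
noncomputable def killWeight (j k : ℕ) : ℝ := if k ≤ 2 * j then j else 1 / (k : ℝ) ^ 2

lemma killWeight_pos {j k : ℕ} (hj : 1 ≤ j) : 0 < killWeight j k := by
  unfold killWeight
  split_ifs with h
  · exact_mod_cast hj
  · have : 0 < k := by omega
    positivity

lemma add_le_abs_sq_sub_sq {j k : ℕ} (h : j ≠ k) :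
    (j : ℝ) + k ≤ |(j : ℝ) ^ 2 - (k : ℝ) ^ 2| := by
  have h1 : (1 : ℝ) ≤ |(j : ℝ) - k| := by
    have : (1 : ℤ) ≤ |(j : ℤ) - k| := Int.one_le_abs (by omega)
    exact_mod_cast this
  rw [sq_sub_sq, abs_mul, abs_of_nonneg (by positivity : (0 : ℝ) ≤ j + k)]
  nlinarith [(by positivity : (0 : ℝ) ≤ j + k)]

/-- Outside a finite set of pairs `(j, k)` a Neumann series inverts the factor; the remaining
factors are invertible because no resonance occurs. The hypothesis `hres` includes the
case `ν = ν'`. -/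
lemma exists_killFactor_inverse_bound {A : 𝔸} {μ₁ μ₂ : ℂ}
    (hA : (A - μ₁ • 1) * (A - μ₂ • 1) = 0) {c : ℝ} (hc : 0 < c)
    (hres : ∀ j k : ℕ, 1 ≤ j → 1 ≤ k → j ≠ k → ∀ ν ∈ ({μ₁, μ₂} : Set ℂ), ∀ ν' ∈ ({μ₁, μ₂} : Set ℂ),
      Complex.exp ((((j : ℝ) ^ 2 - (k : ℝ) ^ 2 : ℝ) + ν) * delay c k - delay c k * ν') ≠ 1) :
    ∃ C : ℝ, 0 ≤ C ∧ ∀ j k : ℕ, 1 ≤ j → 1 ≤ k → j ≠ k → ∃ w : 𝔸,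
      w * killFactor A μ₁ μ₂ ((j : ℝ) ^ 2 - (k : ℝ) ^ 2) (delay c k) = 1 ∧
      ‖w‖ ≤ Real.exp (C * killWeight j k) := by
  classical
  set R : ℝ := ‖A‖ + ‖μ₁‖ + ‖μ₂‖ with hR
  have hR0 : 0 ≤ R := by positivity
  obtain ⟨N, hN⟩ := exists_nat_ge (2 * R)
  have hdel : ∀ k : ℕ, 1 ≤ k → 0 < delay c k := fun k hk =>
    lt_of_lt_of_le (by have : 0 < k := hk; positivity) (le_delay hc.le hk)
  have hex : ∀ j k : ℕ, ∃ w : 𝔸, 1 ≤ j → 1 ≤ k → j ≠ k →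
      w * killFactor A μ₁ μ₂ ((j : ℝ) ^ 2 - (k : ℝ) ^ 2) (delay c k) = 1 := by
    intro j k
    by_cases h : 1 ≤ j ∧ 1 ≤ k ∧ j ≠ k
    · obtain ⟨h1, h2, h3⟩ := h
      obtain ⟨w₁, hw₁⟩ := exists_leftInverse_of_cayley hA (delay c k)
        (hres j k h1 h2 h3 μ₁ (by simp) μ₁ (by simp)) (hres j k h1 h2 h3 μ₁ (by simp) μ₂ (by simp))
      obtain ⟨w₂, hw₂⟩ := exists_leftInverse_of_cayley hA (delay c k)
        (hres j k h1 h2 h3 μ₂ (by simp) μ₁ (by simp)) (hres j k h1 h2 h3 μ₂ (by simp) μ₂ (by simp))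
      refine ⟨w₂ * w₁, fun _ _ _ => ?_⟩
      unfold killFactor
      rw [mul_assoc, ← mul_assoc w₁, hw₁, one_mul, hw₂]
    · exact ⟨0, fun h1 h2 h3 => absurd ⟨h1, h2, h3⟩ h⟩
  choose w hw using hex
  -- The finitely many pairs with `j, k ≤ N` are absorbed into the constant.
  set C₀ : ℝ := ∑ p ∈ Finset.range (N + 1) ×ˢ Finset.range (N + 1),
    ‖w p.1 p.2‖ / killWeight p.1 p.2 with hC₀
  have hβ0 : ∀ j k : ℕ, 0 ≤ killWeight j k := by
    intro j k; unfold killWeight; split_ifs <;> positivity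
  have hC₀0 : 0 ≤ C₀ := Finset.sum_nonneg fun p _ => div_nonneg (norm_nonneg _) (hβ0 _ _)
  refine ⟨C₀ + 16 / c + 48 / (3 * c / 8) ^ 4, by positivity, fun j k hj hk hjk => ?_⟩
  have hβ := killWeight_pos (k := k) hj
  by_cases hsmall : j ≤ N ∧ k ≤ N
  · refine ⟨w j k, hw j k hj hk hjk, ?_⟩
    have h1 : ‖w j k‖ / killWeight j k ≤ C₀ :=
      Finset.single_le_sum (f := fun p : ℕ × ℕ => ‖w p.1 p.2‖ / killWeight p.1 p.2)
        (fun p _ => div_nonneg (norm_nonneg _) (hβ0 _ _))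
        (Finset.mem_product.2 ⟨Finset.mem_range.2 (by simp; omega),
          Finset.mem_range.2 (by simp; omega)⟩ :
          (j, k) ∈ _)
    have h2 : ‖w j k‖ ≤ (C₀ + 16 / c + 48 / (3 * c / 8) ^ 4) * killWeight j k := by
      rw [div_le_iff₀ hβ] at h1
      refine h1.trans (mul_le_mul_of_nonneg_right ?_ hβ.le)
      have : 0 ≤ 16 / c := by positivity
      have : 0 ≤ 48 / (3 * c / 8) ^ 4 := by positivity
      linarith
    linarith [Real.add_one_le_exp ((C₀ + 16 / c + 48 / (3 * c / 8) ^ 4) * killWeight j k)]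
  · have hjk2 : 2 * R < (j : ℝ) + k := by
      have : N < j + k := by omega
      have : (N : ℝ) < j + k := by exact_mod_cast this
      linarith
    have hm := add_le_abs_sq_sub_sq hjk
    have hmR : R < |(j : ℝ) ^ 2 - (k : ℝ) ^ 2| := by linarith
    have ha := hdel k hk
    obtain ⟨w₁, hw₁, hn₁⟩ := exists_leftInverse_of_large (μ := μ₁)
      (by linarith [norm_nonneg μ₂] : ‖A‖ + ‖μ₁‖ ≤ R) ha hmR
    obtain ⟨w₂, hw₂, hn₂⟩ := exists_leftInverse_of_large (μ := μ₂)
      (by linarith [norm_nonneg μ₁] : ‖A‖ + ‖μ₂‖ ≤ R) ha hmR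
    refine ⟨w₂ * w₁, ?_, ?_⟩
    · unfold killFactor
      rw [mul_assoc, ← mul_assoc w₁, hw₁, one_mul, hw₂]
    set x := (|(j : ℝ) ^ 2 - (k : ℝ) ^ 2| - R) * delay c k
    have hx : |(j : ℝ) ^ 2 - (k : ℝ) ^ 2| / 2 * delay c k ≤ x :=
      mul_le_mul_of_nonneg_right (by linarith) ha.le
    have hx0 : 0 < x := mul_pos (by linarith) ha
    have hk1 : (1 : ℝ) ≤ k := by exact_mod_cast hk
    have hj1 : (1 : ℝ) ≤ j := by exact_mod_cast hj
    suffices h : (1 - Real.exp (-x))⁻¹ ≤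
        Real.exp ((8 / c + 24 / (3 * c / 8) ^ 4) * killWeight j k) by
      calc ‖w₂ * w₁‖ ≤ ‖w₂‖ * ‖w₁‖ := norm_mul_le _ _
        _ ≤ Real.exp ((8 / c + 24 / (3 * c / 8) ^ 4) * killWeight j k) *
            Real.exp ((8 / c + 24 / (3 * c / 8) ^ 4) * killWeight j k) :=
          mul_le_mul (hn₂.trans h) (hn₁.trans h) (norm_nonneg _) (Real.exp_pos _).le
        _ = Real.exp ((16 / c + 48 / (3 * c / 8) ^ 4) * killWeight j k) := by
          rw [← Real.exp_add]; ring_nf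
        _ ≤ _ := Real.exp_le_exp.2 (mul_le_mul_of_nonneg_right (by linarith) hβ.le)
    have e1 : 0 ≤ 8 / c := by positivity
    have e2 : 0 ≤ 24 / (3 * c / 8) ^ 4 := by positivity
    -- For `k ≤ 2j` the exponent `x` is at least `c / (8j)`; beyond, it grows like `√k`.
    by_cases hkj : k ≤ 2 * j
    · refine (inv_one_sub_exp_neg_le hx0).trans (Real.exp_le_exp.2 ?_)
      have hkj' : (k : ℝ) ≤ 2 * j := by exact_mod_cast hkj
      have h1 : c / (8 * j) ≤ x := by
        calc c / (8 * j) = j / 2 * (c / (2 * j) ^ 2) := by field_simp; ring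
          _ ≤ |(j : ℝ) ^ 2 - (k : ℝ) ^ 2| / 2 * (c / k ^ 2) := by gcongr; linarith
          _ ≤ |(j : ℝ) ^ 2 - (k : ℝ) ^ 2| / 2 * delay c k := by gcongr; exact le_delay hc.le hk
          _ ≤ x := hx
      have hw' : killWeight j k = j := by simp [killWeight, hkj]
      rw [hw']
      calc 1 / x ≤ 1 / (c / (8 * j)) := by gcongr
        _ = 8 / c * j := by field_simp
        _ ≤ _ := by gcongr; linarith
    · refine (inv_one_sub_exp_neg_le' hx0).trans (Real.exp_le_exp.2 ?_)
      have hkj' : 2 * (j : ℝ) ≤ k := by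
        have : 2 * j ≤ k := by omega
        exact_mod_cast this
      have h1 : 3 * c / 8 * √k ≤ x := by
        have h2 : 3 / 4 * (k : ℝ) ^ 2 ≤ |(j : ℝ) ^ 2 - (k : ℝ) ^ 2| := by
          rw [abs_sub_comm]
          refine le_trans ?_ (le_abs_self _)
          nlinarith
        calc 3 * c / 8 * √k = 3 / 8 * ((k : ℝ) ^ 2 * delay c k) := by rw [sq_mul_delay c hk]; ring
          _ = 3 / 4 * (k : ℝ) ^ 2 / 2 * delay c k := by ring
          _ ≤ |(j : ℝ) ^ 2 - (k : ℝ) ^ 2| / 2 * delay c k := by gcongr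
          _ ≤ x := hx
      have hw' : killWeight j k = 1 / (k : ℝ) ^ 2 := by simp [killWeight, hkj]
      have h3 : (3 * c / 8 * √k) ^ 4 = (3 * c / 8) ^ 4 * (k : ℝ) ^ 2 := by
        rw [mul_pow, show (√(k : ℝ)) ^ 4 = (√(k : ℝ) ^ 2) ^ 2 by ring, Real.sq_sqrt (by linarith)]
      rw [hw']
      calc 24 / x ^ 4 ≤ 24 / (3 * c / 8 * √k) ^ 4 := by gcongr
        _ = 24 / (3 * c / 8) ^ 4 * (1 / (k : ℝ) ^ 2) := by rw [h3]; field_simp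
        _ ≤ _ := by gcongr; linarith

end Inverse

/-! ### Continuous controls and their moments -/

/-- Continuous controls supported in `[0, T]`. -/
structure IsContinuousControl (T : ℝ) (u : ℝ → ℂ) : Prop where
  continuous : Continuous u
  support : ∀ t, t ∉ Icc 0 T → u t = 0

namespace IsContinuousControl

variable {T : ℝ} {u v : ℝ → ℂ}

lemma mono {T' : ℝ} (h : IsContinuousControl T u) (hT : T ≤ T') : IsContinuousControl T' u :=
  ⟨h.continuous, fun t ht => h.support t fun h' => ht ⟨h'.1, h'.2.trans hT⟩⟩

lemma zero (T : ℝ) : IsContinuousControl T (fun _ => 0) :=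
  ⟨continuous_const, fun _ _ => rfl⟩

lemma add (h : IsContinuousControl T u) (h' : IsContinuousControl T v) :
    IsContinuousControl T (fun t => u t + v t) :=
  ⟨h.continuous.add h'.continuous, fun t ht => by simp [h.support t ht, h'.support t ht]⟩

lemma const_mul (h : IsContinuousControl T u) (c : ℂ) :
    IsContinuousControl T (fun t => c * u t) :=
  ⟨continuous_const.mul h.continuous, fun t ht => by simp [h.support t ht]⟩

lemma sum {ι : Type*} (s : Finset ι) {f : ι → ℝ → ℂ}
    (h : ∀ i ∈ s, IsContinuousControl T (f i)) :
    IsContinuousControl T (fun t => ∑ i ∈ s, f i t) :=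
  ⟨continuous_finsetSum _ fun i hi => (h i hi).continuous,
    fun t ht => Finset.sum_eq_zero fun i hi => (h i hi).support t ht⟩

lemma shift (h : IsContinuousControl T u) {s : ℝ} (hs : 0 ≤ s) :
    IsContinuousControl (T + s) (fun t => u (t - s)) := by
  refine ⟨h.continuous.comp (continuous_id.sub continuous_const), fun t ht => h.support _ ?_⟩
  rintro ⟨h1, h2⟩
  exact ht ⟨by linarith, by linarith⟩

lemma hasCompactSupport (h : IsContinuousControl T u) : HasCompactSupport u :=
  HasCompactSupport.of_support_subset_isCompact isCompact_Icc fun t ht => by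
    by_contra h'
    exact ht (h.support t h')

lemma exists_bound (h : IsContinuousControl T u) : ∃ B, ∀ t, ‖u t‖ ≤ B :=
  h.hasCompactSupport.exists_bound_of_continuous h.continuous

/-- Continuous controls are closed under limits with summable increments. -/
lemma of_tendsto {f : ℕ → ℝ → ℂ} (hf : ∀ n, IsContinuousControl T (f n)) {d : ℕ → ℝ}
    (hd : Summable d) (hfd : ∀ n t, ‖f (n + 1) t - f n t‖ ≤ d n) :
    ∃ w, IsContinuousControl T w ∧ ∀ t, Tendsto (fun n => f n t) atTop (𝓝 (w t)) := by
  have hs : ∀ t, Summable fun n => f (n + 1) t - f n t := fun t =>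
    Summable.of_norm_bounded hd fun n => hfd n t
  have hlim : ∀ t, Tendsto (fun n => f n t) atTop
      (𝓝 (f 0 t + ∑' n, (f (n + 1) t - f n t))) := fun t => by
    have := ((hs t).hasSum.tendsto_sum_nat).const_add (f 0 t)
    refine this.congr fun n => ?_
    rw [Finset.sum_range_sub (fun n => f n t)]
    ring
  refine ⟨_, ⟨(hf 0).continuous.add (continuous_tsum (fun n =>
    (hf (n + 1)).continuous.sub (hf n).continuous) hd hfd), fun t ht => ?_⟩, hlim⟩
  simp [(hf _).support t ht]

end IsContinuousControl

section Moment

variable {V : Type*} [NormedAddCommGroup V] [NormedSpace ℂ V]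
  (A : V →L[ℂ] V) (b : V)

/-- The moment `∫ u(t) e^{k²t} exp(-tA) b dt` of a control: with suitable constants, its value
determines whether `u` steers the `k`-th Fourier mode to rest. -/
noncomputable def moment (k : ℕ) (u : ℝ → ℂ) : V :=
  ∫ t, (u t * Complex.exp ((k : ℂ) ^ 2 * t)) • flow A t b

variable {A b}

lemma moment_const_mul (c : ℂ) (u : ℝ → ℂ) (k : ℕ) :
    moment A b k (fun t => c * u t) = c • moment A b k u := by
  unfold moment
  rw [← integral_smul]
  congr 1; ext t
  rw [mul_assoc, mul_smul]

variable [CompleteSpace V] {T : ℝ} {u v : ℝ → ℂ}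

lemma continuous_momentKernel (k : ℕ) :
    Continuous fun t : ℝ => Complex.exp ((k : ℂ) ^ 2 * t) • flow A t b := by
  have := continuous_flow A
  fun_prop

lemma IsContinuousControl.integrable (h : IsContinuousControl T u) (k : ℕ) :
    Integrable fun t => (u t * Complex.exp ((k : ℂ) ^ 2 * t)) • flow A t b := by
  refine Continuous.integrable_of_hasCompactSupport ?_ ?_
  · have := h.continuous
    have := continuous_flow A
    fun_prop
  · exact (h.hasCompactSupport.mul_right).smul_right

lemma moment_add (hu : IsContinuousControl T u) (hv : IsContinuousControl T v) (k : ℕ) :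
    moment A b k (fun t => u t + v t) = moment A b k u + moment A b k v := by
  unfold moment
  rw [← integral_add (hu.integrable k) (hv.integrable k)]
  congr 1; ext t
  rw [add_mul, add_smul]

lemma moment_sum {ι : Type*} (s : Finset ι) {f : ι → ℝ → ℂ}
    (h : ∀ i ∈ s, IsContinuousControl T (f i)) (k : ℕ) :
    moment A b k (fun t => ∑ i ∈ s, f i t) = ∑ i ∈ s, moment A b k (f i) := by
  unfold moment
  rw [← integral_finsetSum _ fun i hi => (h i hi).integrable k]
  congr 1; ext t
  rw [Finset.sum_mul, Finset.sum_smul]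

lemma moment_shift (hu : IsContinuousControl T u) (s : ℝ) (k : ℕ) :
    moment A b k (fun t => u (t - s)) =
      Complex.exp ((k : ℂ) ^ 2 * s) • flow A s (moment A b k u) := by
  unfold moment
  rw [← integral_add_right_eq_self _ s,
    ← ContinuousLinearMap.integral_comp_comm _ (hu.integrable k),
    ← integral_smul]
  congr 1; ext t
  dsimp only
  rw [add_sub_cancel_right, add_comm t s, flow_add, mul_apply_eq_comp, map_smul,
    smul_smul]
  congr 1
  push_cast
  rw [mul_add, Complex.exp_add]
  ring

/-- Moments pass to bounded pointwise limits of controls with supports in a common interval. -/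
lemma tendsto_moment {f : ℕ → ℝ → ℂ} (hf : ∀ n, IsContinuousControl T (f n)) {B : ℝ}
    (hB : ∀ n t, ‖f n t‖ ≤ B) (hlim : ∀ t, Tendsto (fun n => f n t) atTop (𝓝 (u t))) (k : ℕ) :
    Tendsto (fun n => moment A b k (f n)) atTop (𝓝 (moment A b k u)) := by
  refine tendsto_integral_of_dominated_convergence
    (fun t => (Icc 0 T).indicator (fun t => B * ‖Complex.exp ((k : ℂ) ^ 2 * t) • flow A t b‖) t)
    (fun n => ((hf n).integrable k).aestronglyMeasurable) ?_ ?_ ?_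
  · rw [integrable_indicator_iff measurableSet_Icc]
    exact (continuous_const.mul (continuous_momentKernel k).norm).integrableOn_Icc
  · refine fun n => Eventually.of_forall fun t => ?_
    by_cases ht : t ∈ Icc 0 T
    · rw [indicator_of_mem ht, mul_smul, norm_smul]
      exact mul_le_mul_of_nonneg_right (hB n t) (norm_nonneg _)
    · rw [indicator_of_notMem ht, (hf n).support t ht]
      simp
  · exact Eventually.of_forall fun t => ((hlim t).mul_const _).smul_const _

/-- The elementary delay operator `u ↦ u - c u(· - a)`. -/
def delayOp (c : ℂ) (a : ℝ) (u : ℝ → ℂ) : ℝ → ℂ := fun t => u t - c * u (t - a)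

lemma IsContinuousControl.delayOp (h : IsContinuousControl T u) (c : ℂ) {a : ℝ} (ha : 0 ≤ a) :
    IsContinuousControl (T + a) (delayOp c a u) := by
  have := (h.mono (by linarith : T ≤ T + a)).add ((h.shift ha).const_mul (-c))
  refine ⟨?_, fun t ht => ?_⟩
  · convert this.continuous using 2
    simp [CoupledHeat.delayOp, sub_eq_add_neg]
  · rw [← this.support t ht]
    simp [CoupledHeat.delayOp, sub_eq_add_neg]

lemma moment_delayOp (h : IsContinuousControl T u) (c : ℂ) {a : ℝ} (ha : 0 ≤ a) (l : ℕ) :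
    moment A b l (delayOp c a u) =
      (1 - (c * Complex.exp ((l : ℂ) ^ 2 * a)) • flow A a : V →L[ℂ] V) (moment A b l u) := by
  have h1 : delayOp c a u = fun t => u t + (-c) * u (t - a) := by
    ext t; simp [delayOp, sub_eq_add_neg]
  rw [h1, moment_add (h.mono (by linarith : T ≤ T + a)) ((h.shift ha).const_mul (-c)),
    moment_const_mul, moment_shift h]
  simp [sub_eq_add_neg, mul_smul]

lemma norm_delayOp_le {B : ℝ} (hB : ∀ t, ‖u t‖ ≤ B) (c : ℂ) (a t : ℝ) :
    ‖delayOp c a u t‖ ≤ (1 + ‖c‖) * B := by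
  calc ‖delayOp c a u t‖ ≤ ‖u t‖ + ‖c * u (t - a)‖ := norm_sub_le _ _
    _ ≤ B + ‖c‖ * B := by rw [norm_mul]; gcongr <;> exact hB _
    _ = _ := by ring

lemma norm_delayOp_sub_le {B : ℝ} (hB : ∀ t, ‖u t‖ ≤ B) (c : ℂ) (a t : ℝ) :
    ‖delayOp c a u t - u t‖ ≤ ‖c‖ * B := by
  unfold delayOp
  rw [sub_sub_cancel_left, norm_neg, norm_mul]
  gcongr
  exact hB _

end Moment

/-! ### Controls acting on a single mode -/

/-- The coefficient `q` for which `u ↦ u - q u(· - a)`, with `a = delay c k`, annihilates the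
integral of `u` against `e^{(k² - μ)t}`. -/
noncomputable def killCoeff (c : ℝ) (μ : ℂ) (k : ℕ) : ℂ :=
  Complex.exp ((μ - (k : ℂ) ^ 2) * delay c k)

/-- The operator annihilating the moments of index `k`: one delay operator for each eigenvalue. -/
noncomputable def killOp (c : ℝ) (μ₁ μ₂ : ℂ) (k : ℕ) (u : ℝ → ℂ) : ℝ → ℂ :=
  delayOp (killCoeff c μ₁ k) (delay c k) (delayOp (killCoeff c μ₂ k) (delay c k) u)

/-- Composition of the operators annihilating the moments of index `1, …, n`, except `j`. -/
noncomputable def killSeq (c : ℝ) (μ₁ μ₂ : ℂ) (j : ℕ) (u : ℝ → ℂ) : ℕ → ℝ → ℂ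
  | 0 => u
  | n + 1 => if n + 1 = j then killSeq c μ₁ μ₂ j u n
      else killOp c μ₁ μ₂ (n + 1) (killSeq c μ₁ μ₂ j u n)

/-- The coefficients are summable: since `k² * delay c k = c √k`, they are `O(e^{-c√k})`. -/
lemma norm_killCoeff_le {c R : ℝ} (hc : 0 < c) {μ : ℂ} (hμ : ‖μ‖ ≤ R) {k : ℕ} (hk : 1 ≤ k) :
    ‖killCoeff c μ k‖ ≤ Real.exp (R * c) * (24 / c ^ 4) * (1 / (k : ℝ) ^ 2) := by
  have hk1 : (1 : ℝ) ≤ k := by exact_mod_cast hk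
  have hs : 0 < √(k : ℝ) := Real.sqrt_pos.2 (by linarith)
  have h3 : (c * √k) ^ 4 = c ^ 4 * (k : ℝ) ^ 2 := by
    rw [mul_pow, show (√(k : ℝ)) ^ 4 = (√(k : ℝ) ^ 2) ^ 2 by ring, Real.sq_sqrt (by linarith)]
  have hre : ((μ - (k : ℂ) ^ 2) * delay c k).re ≤ R * c + -(c * √k) := by
    rw [← sq_mul_delay c hk, Complex.re_mul_ofReal]
    have h1 : ((k : ℂ) ^ 2).re = (k : ℝ) ^ 2 := by
      rw [← Complex.ofReal_natCast, ← Complex.ofReal_pow, Complex.ofReal_re]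
    rw [Complex.sub_re, h1]
    have h2 : μ.re ≤ R := (Complex.re_le_norm μ).trans hμ
    have h4 := delay_nonneg hc.le k
    have h5 := delay_le hc.le k
    have hR : 0 ≤ R := (norm_nonneg _).trans hμ
    nlinarith [mul_le_mul_of_nonneg_right h2 h4, mul_le_mul_of_nonneg_left h5 hR]
  calc ‖killCoeff c μ k‖ ≤ Real.exp (R * c + -(c * √k)) := by
        rw [killCoeff, Complex.norm_exp]; exact Real.exp_le_exp.2 hre
    _ ≤ Real.exp (R * c) * (24 / (c * √k) ^ 4) := by
        rw [Real.exp_add]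
        exact mul_le_mul_of_nonneg_left (exp_neg_le_div_pow_four (by positivity))
          (Real.exp_pos _).le
    _ = _ := by rw [h3]; field_simp

lemma norm_killOp_le {c η B : ℝ} {μ₁ μ₂ : ℂ} {k : ℕ} {u : ℝ → ℂ}
    (h1 : ‖killCoeff c μ₁ k‖ ≤ η) (h2 : ‖killCoeff c μ₂ k‖ ≤ η) (hB : ∀ t, ‖u t‖ ≤ B) (t : ℝ) :
    ‖killOp c μ₁ μ₂ k u t‖ ≤ (1 + η) ^ 2 * B := by
  have hB0 : 0 ≤ B := (norm_nonneg _).trans (hB 0)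
  have hη : 0 ≤ η := (norm_nonneg _).trans h1
  refine (norm_delayOp_le (norm_delayOp_le hB _ _) _ _ t).trans ?_
  calc (1 + ‖killCoeff c μ₁ k‖) * ((1 + ‖killCoeff c μ₂ k‖) * B) ≤ (1 + η) * ((1 + η) * B) := by
        gcongr
    _ = _ := by ring

lemma norm_killOp_sub_le {c η B : ℝ} {μ₁ μ₂ : ℂ} {k : ℕ} {u : ℝ → ℂ}
    (h1 : ‖killCoeff c μ₁ k‖ ≤ η) (h2 : ‖killCoeff c μ₂ k‖ ≤ η) (hB : ∀ t, ‖u t‖ ≤ B) (t : ℝ) :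
    ‖killOp c μ₁ μ₂ k u t - u t‖ ≤ (1 + η) ^ 2 * B - B := by
  have hB0 : 0 ≤ B := (norm_nonneg _).trans (hB 0)
  have hη : 0 ≤ η := (norm_nonneg _).trans h1
  set w := delayOp (killCoeff c μ₂ k) (delay c k) u with hw
  have e1 := norm_delayOp_sub_le (norm_delayOp_le hB (killCoeff c μ₂ k) (delay c k))
    (killCoeff c μ₁ k) (delay c k) t
  have e2 := norm_delayOp_sub_le hB (killCoeff c μ₂ k) (delay c k) t
  calc ‖killOp c μ₁ μ₂ k u t - u t‖ = ‖(killOp c μ₁ μ₂ k u t - w t) + (w t - u t)‖ := by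
        rw [sub_add_sub_cancel]
    _ ≤ ‖killCoeff c μ₁ k‖ * ((1 + ‖killCoeff c μ₂ k‖) * B) + ‖killCoeff c μ₂ k‖ * B :=
        (norm_add_le _ _).trans (add_le_add e1 e2)
    _ ≤ η * ((1 + η) * B) + η * B := by gcongr
    _ = _ := by ring

section Kill

variable {V : Type*} [NormedAddCommGroup V] [NormedSpace ℂ V] [CompleteSpace V]
  {A : V →L[ℂ] V} {b : V} {T : ℝ} {u : ℝ → ℂ} {c : ℝ} {μ₁ μ₂ : ℂ}

lemma moment_killOp (h : IsContinuousControl T u) (hc : 0 ≤ c) (k l : ℕ) :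
    moment A b l (killOp c μ₁ μ₂ k u) =
      killFactor A μ₁ μ₂ ((l : ℝ) ^ 2 - (k : ℝ) ^ 2) (delay c k) (moment A b l u) := by
  have hd := delay_nonneg hc k
  rw [killOp, moment_delayOp (h.delayOp _ hd) _ hd, moment_delayOp h _ hd, killFactor,
    mul_apply_eq_comp]
  have e : ∀ μ : ℂ, killCoeff c μ k * Complex.exp ((l : ℂ) ^ 2 * delay c k) =
      Complex.exp ((((l : ℝ) ^ 2 - (k : ℝ) ^ 2 : ℝ) + μ) * delay c k) := fun μ => by
    rw [killCoeff, ← Complex.exp_add]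
    push_cast
    ring_nf
  rw [e, e]

lemma killFactor_zero (hA : (A - μ₁ • 1) * (A - μ₂ • 1) = 0) (a : ℝ) :
    killFactor A μ₁ μ₂ 0 a = 0 := by
  have e : ∀ μ : ℂ, 1 - Complex.exp ((((0 : ℝ) : ℂ) + μ) * a) • flow A a =
      (-Complex.exp (a * μ)) • (flow A a - Complex.exp (-(a * μ)) • 1) := fun μ => by
    rw [smul_sub, smul_smul, neg_mul, ← Complex.exp_add]
    simp [mul_comm, sub_eq_add_neg, add_comm]
  rw [killFactor, e, e, smul_mul_smul_comm, flow_cayley hA, smul_zero]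

/-- The operator through which `killSeq` acts on the moments of index `l`. -/
noncomputable def killProd (A : V →L[ℂ] V) (c : ℝ) (μ₁ μ₂ : ℂ) (j l : ℕ) : ℕ → V →L[ℂ] V
  | 0 => 1
  | n + 1 => if n + 1 = j then killProd A c μ₁ μ₂ j l n
      else killFactor A μ₁ μ₂ ((l : ℝ) ^ 2 - ((n + 1 : ℕ) : ℝ) ^ 2) (delay c (n + 1)) *
        killProd A c μ₁ μ₂ j l n

lemma IsContinuousControl.killSeq (h : IsContinuousControl T u) (hc : 0 ≤ c) (j n : ℕ) :
    IsContinuousControl (T + 2 * ∑ m ∈ Finset.range n, delay c (m + 1))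
      (killSeq c μ₁ μ₂ j u n) := by
  induction n with
  | zero => simpa [CoupledHeat.killSeq] using h
  | succ n ih =>
    have hd := delay_nonneg hc (n + 1)
    rw [Finset.sum_range_succ, CoupledHeat.killSeq]
    split_ifs
    · exact ih.mono (by linarith)
    · exact ((ih.delayOp _ hd).delayOp _ hd).mono (by linarith)

lemma moment_killSeq (h : IsContinuousControl T u) (hc : 0 ≤ c) (j l n : ℕ) :
    moment A b l (killSeq c μ₁ μ₂ j u n) = killProd A c μ₁ μ₂ j l n (moment A b l u) := by
  induction n with
  | zero => simp [killSeq, killProd]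
  | succ n ih =>
    rw [killSeq, killProd]
    split_ifs
    · exact ih
    · rw [moment_killOp (h.killSeq hc j n) hc, ih, mul_apply_eq_comp]

/-- The annihilating operator of index `l` is one of the factors once `n ≥ l`. -/
lemma killProd_eq_zero (hA : (A - μ₁ • 1) * (A - μ₂ • 1) = 0) {j l n : ℕ} (hl : 1 ≤ l)
    (hlj : l ≠ j) (hn : l ≤ n) : killProd A c μ₁ μ₂ j l n = 0 := by
  induction n, hn using Nat.le_induction with
  | base =>
    obtain ⟨m, rfl⟩ : ∃ m, l = m + 1 := ⟨l - 1, by omega⟩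
    rw [killProd, if_neg hlj, sub_self, killFactor_zero hA, zero_mul]
  | succ n hn ih =>
    rw [killProd]
    split_ifs
    · exact ih
    · rw [ih, mul_zero]

/-- The infinite product of the annihilating operators converges, uniformly on bounded sets of
controls. -/
lemma exists_killSeq_limit (hc : 0 < c) (hA : (A - μ₁ • 1) * (A - μ₂ • 1) = 0) :
    ∃ T' P : ℝ, 0 < T' ∧ 0 ≤ P ∧ ∀ u : ℝ → ℂ, IsContinuousControl 1 u → ∀ B, (∀ t, ‖u t‖ ≤ B) →
      ∀ j : ℕ, ∃ w, IsContinuousControl T' w ∧ (∀ t, ‖w t‖ ≤ P * B) ∧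
        (∀ l, 1 ≤ l → l ≠ j → moment A b l w = 0) ∧
        Tendsto (fun n => killProd A c μ₁ μ₂ j j n (moment A b j u)) atTop
          (𝓝 (moment A b j w)) := by
  set R := ‖μ₁‖ + ‖μ₂‖
  set K := Real.exp (R * c) * (24 / c ^ 4)
  have hK : 0 ≤ K := by positivity
  set η : ℕ → ℝ := fun n => K * (1 / ((n + 1 : ℕ) : ℝ) ^ 2) with hη
  have hη0 : ∀ n, 0 ≤ η n := fun n => by positivity
  have hηs : Summable η :=
    ((summable_nat_add_iff 1).2 (Real.summable_one_div_nat_pow.2 (by norm_num :  1 < 2))).mul_left K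
  have hds : Summable fun n => delay c (n + 1) := (summable_nat_add_iff 1).2 (summable_delay c)
  set Pn : ℕ → ℝ := fun n => ∏ m ∈ Finset.range n, (1 + η m) ^ 2 with hPn
  set P := Real.exp (2 * ∑' m, η m)
  have hPP : ∀ n, Pn n ≤ P := fun n => by
    calc Pn n ≤ ∏ m ∈ Finset.range n, Real.exp (2 * η m) := by
          refine Finset.prod_le_prod (fun m _ => by positivity) fun m _ => ?_
          rw [mul_comm, Real.exp_mul, Real.rpow_ofNat]
          have := Real.add_one_le_exp (η m)
          have := hη0 m
          gcongr
          linarith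
      _ = Real.exp (2 * ∑ m ∈ Finset.range n, η m) := by
          rw [← Real.exp_sum, Finset.mul_sum]
      _ ≤ P := by
          refine Real.exp_le_exp.2 ?_
          have := hηs.sum_le_tsum (Finset.range n) (fun m _ => hη0 m)
          linarith
  have hP1 : ∀ n, Pn n ≤ Pn (n + 1) := fun n => by
    rw [hPn]; simp only
    rw [Finset.prod_range_succ]
    refine le_mul_of_one_le_right (Finset.prod_nonneg fun m _ => by positivity) ?_
    nlinarith [hη0 n]
  refine ⟨1 + 2 * ∑' n, delay c (n + 1), P, ?_, (Real.exp_pos _).le, fun u hu B hB j => ?_⟩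
  · have : 0 ≤ ∑' n, delay c (n + 1) := tsum_nonneg fun n => delay_nonneg hc.le _
    linarith
  have hB0 : 0 ≤ B := (norm_nonneg _).trans (hB 0)
  have hT : ∀ n, IsContinuousControl (1 + 2 * ∑' n, delay c (n + 1)) (killSeq c μ₁ μ₂ j u n) := by
    intro n
    refine (hu.killSeq hc.le j n).mono ?_
    have := hds.sum_le_tsum (Finset.range n) (fun m _ => delay_nonneg hc.le (m + 1))
    linarith
  have hc1 : ∀ n, ‖killCoeff c μ₁ (n + 1)‖ ≤ η n := fun n =>
    norm_killCoeff_le hc (by simp [R]) (by omega)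
  have hc2 : ∀ n, ‖killCoeff c μ₂ (n + 1)‖ ≤ η n := fun n =>
    norm_killCoeff_le hc (by simp [R]) (by omega)
  have hbd : ∀ n t, ‖killSeq c μ₁ μ₂ j u n t‖ ≤ Pn n * B := by
    intro n
    induction n with
    | zero => simpa [killSeq, hPn] using hB
    | succ n ih =>
      intro t
      rw [killSeq]
      split_ifs
      · exact (ih t).trans (mul_le_mul_of_nonneg_right (hP1 n) hB0)
      · refine (norm_killOp_le (hc1 n) (hc2 n) ih t).trans (le_of_eq ?_)
        simp only [hPn]
        rw [Finset.prod_range_succ]; ring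
  have hdiff : ∀ n t, ‖killSeq c μ₁ μ₂ j u (n + 1) t - killSeq c μ₁ μ₂ j u n t‖ ≤
      Pn (n + 1) * B - Pn n * B := by
    intro n t
    rw [killSeq]
    split_ifs
    · rw [sub_self, norm_zero, sub_nonneg]
      exact mul_le_mul_of_nonneg_right (hP1 n) hB0
    · refine (norm_killOp_sub_le (hc1 n) (hc2 n) (hbd n) t).trans (le_of_eq ?_)
      simp only [hPn]
      rw [Finset.prod_range_succ]; ring
  have hsum : Summable fun n => Pn (n + 1) * B - Pn n * B := by
    refine summable_of_sum_range_le (c := P * B)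
      (fun n => sub_nonneg.2 (mul_le_mul_of_nonneg_right (hP1 n) hB0)) fun n => ?_
    rw [Finset.sum_range_sub (fun n => Pn n * B)]
    have := mul_le_mul_of_nonneg_right (hPP n) hB0
    have : 0 ≤ Pn 0 * B := by simpa [hPn] using hB0
    linarith
  obtain ⟨w, hw, hlim⟩ := IsContinuousControl.of_tendsto hT hsum hdiff
  have hbd' : ∀ n t, ‖killSeq c μ₁ μ₂ j u n t‖ ≤ P * B := fun n t =>
    (hbd n t).trans (mul_le_mul_of_nonneg_right (hPP n) hB0)
  have hmom := fun l => tendsto_moment (A := A) (b := b) hT hbd' hlim l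
  refine ⟨w, hw, fun t => ?_, fun l hl hlj => ?_, ?_⟩
  · exact le_of_tendsto (hlim t).norm (Eventually.of_forall fun n => hbd' n t)
  · refine tendsto_nhds_unique (hmom l) (tendsto_const_nhds.congr' ?_)
    filter_upwards [eventually_ge_atTop l] with n hn
    rw [moment_killSeq hu hc.le, killProd_eq_zero hA hl hlj hn, zero_apply]
  · refine (hmom j).congr fun n => ?_
    rw [moment_killSeq hu hc.le]

end Kill

/-- The partial products `killProd A c μ₁ μ₂ j j n` are bounded below, uniformly in `n`. -/
lemma norm_le_killProd {V : Type*} [NormedAddCommGroup V] [NormedSpace ℂ V]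
    {A : V →L[ℂ] V} {c : ℝ} {μ₁ μ₂ : ℂ} {C : ℝ} (hC : 0 ≤ C)
    (hinv : ∀ j k : ℕ, 1 ≤ j → 1 ≤ k → j ≠ k → ∃ w : V →L[ℂ] V,
      w * killFactor A μ₁ μ₂ ((j : ℝ) ^ 2 - (k : ℝ) ^ 2) (delay c k) = 1 ∧
      ‖w‖ ≤ Real.exp (C * killWeight j k)) {j : ℕ} (hj : 1 ≤ j) (n : ℕ) (v : V) :
    ‖v‖ ≤ Real.exp (C * ∑ m ∈ Finset.range n, killWeight j (m + 1)) *
      ‖killProd A c μ₁ μ₂ j j n v‖ := by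
  induction n with
  | zero => simp [killProd]
  | succ n ih =>
    have hβ := killWeight_pos (k := n + 1) hj
    rw [Finset.sum_range_succ, mul_add, Real.exp_add, killProd]
    split_ifs with h
    · refine ih.trans (mul_le_mul_of_nonneg_right ?_ (norm_nonneg _))
      exact le_mul_of_one_le_right (Real.exp_pos _).le (Real.one_le_exp (by positivity))
    · obtain ⟨w, hw, hwn⟩ := hinv j (n + 1) hj (by omega) (Ne.symm h)
      set x := killProd A c μ₁ μ₂ j j n v
      set F := killFactor A μ₁ μ₂ ((j : ℝ) ^ 2 - ((n + 1 : ℕ) : ℝ) ^ 2) (delay c (n + 1))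
      have hx : x = w (F x) := by
        rw [← mul_apply_eq_comp, hw, one_apply_eq_self]
      have hx' : ‖x‖ ≤ Real.exp (C * killWeight j (n + 1)) * ‖F x‖ := by
        calc ‖x‖ = ‖w (F x)‖ := by rw [← hx]
          _ ≤ ‖w‖ * ‖F x‖ := w.le_opNorm _
          _ ≤ _ := mul_le_mul_of_nonneg_right hwn (norm_nonneg _)
      rw [mul_apply_eq_comp, mul_assoc]
      exact ih.trans (mul_le_mul_of_nonneg_left hx' (Real.exp_pos _).le)

section Biorthogonal

variable {V : Type*} [NormedAddCommGroup V] [NormedSpace ℂ V] [FiniteDimensional ℂ V]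
  {A : V →L[ℂ] V} {b : V} {c : ℝ} {μ₁ μ₂ : ℂ}

/-- In finite dimensions, a pointwise limit of linear maps that are uniformly bounded below is
bijective. The preimages `v` of `y` under the limit are described without naming it. -/
lemma exists_preimage_of_tendsto {X : ℕ → V →L[ℂ] V} {K : ℝ}
    (hX : ∀ n v, ‖v‖ ≤ K * ‖X n v‖) (hlim : ∀ v, ∃ y, Tendsto (fun n => X n v) atTop (𝓝 y))
    (y : V) :
    ∃ v, Tendsto (fun n => X n v) atTop (𝓝 y) ∧ ‖v‖ ≤ K * ‖y‖ := by
  choose f hf using hlim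
  have hK : ∀ v, ‖v‖ ≤ K * ‖f v‖ := fun v =>
    ge_of_tendsto ((hf v).norm.const_mul K) (Eventually.of_forall fun n => hX n v)
  let F : V →ₗ[ℂ] V := linearMapOfTendsto f (fun n => (X n : V →ₗ[ℂ] V)) (tendsto_pi_nhds.2 hf)
  have hF : ∀ v, F v = f v := fun v => rfl
  have hinj : Function.Injective F := by
    rw [injective_iff_map_eq_zero]
    intro v hv
    have := hK v
    rw [← hF, hv, norm_zero, mul_zero] at this
    exact norm_le_zero_iff.1 this
  obtain ⟨v, rfl⟩ := (LinearMap.injective_iff_surjective.1 hinj) y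
  exact ⟨v, hf v, hK v⟩

lemma sum_killWeight_le (j n : ℕ) :
    ∑ m ∈ Finset.range n, killWeight j (m + 1) ≤
      2 * (j : ℝ) ^ 2 + ∑' m : ℕ, 1 / ((m + 1 : ℕ) : ℝ) ^ 2 := by
  have hs : Summable fun m : ℕ => 1 / ((m + 1 : ℕ) : ℝ) ^ 2 :=
    (summable_nat_add_iff 1).2 (Real.summable_one_div_nat_pow.2 (by norm_num : 1 < 2))
  have h1 : ∀ m, killWeight j (m + 1) ≤
      (if m ∈ Finset.range (2 * j) then (j : ℝ) else 0) + 1 / ((m + 1 : ℕ) : ℝ) ^ 2 := by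
    intro m
    have : 0 ≤ 1 / ((m + 1 : ℕ) : ℝ) ^ 2 := by positivity
    unfold killWeight
    simp only [Finset.mem_range]
    split_ifs with h h' h'
    · linarith
    · omega
    · omega
    · simp
  refine (Finset.sum_le_sum fun m _ => h1 m).trans ?_
  rw [Finset.sum_add_distrib]
  refine add_le_add ?_ (hs.sum_le_tsum _ fun m _ => by positivity)
  rw [← Finset.sum_filter]
  refine (Finset.sum_le_sum_of_subset_of_nonneg (t := Finset.range (2 * j)) ?_ ?_).trans ?_
  · intro m hm; exact (Finset.mem_filter.1 hm).2
  · intros; positivity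
  · simp; ring_nf; rfl

/-- A control realizing a prescribed moment `∫ w(t) exp(-tA) b dt`, from the cyclicity of `b`: a
functional `f` that vanishes on all these moments satisfies `f (exp(-tA) b) = 0` for all `t` in
`(0, 1)`; this relation and its derivative at `t = 1/2` force `f = 0`. -/
lemma exists_baseControl (hb : ∀ f : V →ₗ[ℂ] ℂ, f b = 0 → f (A b) = 0 → f = 0) :
    ∃ K : ℝ, 0 ≤ K ∧ ∀ v : V, ∃ w, IsContinuousControl 1 w ∧ moment A b 0 w = v ∧
      ∀ t, ‖w t‖ ≤ K * ‖v‖ := by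
  let S : Submodule ℂ V :=
    { carrier := {v | ∃ w, IsContinuousControl 1 w ∧ moment A b 0 w = v}
      add_mem' := by
        rintro _ _ ⟨w, hw, rfl⟩ ⟨w', hw', rfl⟩
        exact ⟨_, hw.add hw', moment_add hw hw' 0⟩
      zero_mem' := ⟨_, IsContinuousControl.zero 1, by simp [moment]⟩
      smul_mem' := by
        rintro a _ ⟨w, hw, rfl⟩
        exact ⟨_, hw.const_mul a, moment_const_mul a w 0⟩ }
  have hS : S = ⊤ := by
    by_contra hne
    obtain ⟨f, hf0, hf⟩ := Submodule.exists_le_ker_of_lt_top S (lt_top_iff_ne_top.2 hne)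
    let f' : V →L[ℂ] ℂ := f.toContinuousLinearMap
    set g : ℝ → ℂ := fun t => f' (flow A t b) with hg
    have hgc : Continuous g := by
      have := continuous_flow A
      fun_prop
    -- The weight `q` turns the conjugate of `g` into a continuous control supported in `[0, 1]`.
    set q : ℝ → ℝ := fun t => max 0 (t * (1 - t)) with hq
    have hqc : Continuous q := by fun_prop
    have hq0 : ∀ t, t ∉ Icc (0 : ℝ) 1 → q t = 0 := by
      intro t ht
      rw [mem_Icc, not_and_or, not_le, not_le] at ht
      refine max_eq_left ?_
      rcases ht with h | h <;> nlinarith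
    have hw : IsContinuousControl 1 (fun t => (q t : ℂ) * star (g t)) :=
      ⟨(Complex.continuous_ofReal.comp hqc).mul hgc.star, fun t ht => by simp [hq0 t ht]⟩
    have hint : ∫ t, q t * ‖g t‖ ^ 2 = 0 := by
      have h1 : f' (moment A b 0 fun t => (q t : ℂ) * star (g t)) = 0 := hf ⟨_, hw, rfl⟩
      rw [moment, ← f'.integral_comp_comm (hw.integrable 0)] at h1
      have h2 : ∀ t, f' (((q t : ℂ) * star (g t) * Complex.exp (((0 : ℕ) : ℂ) ^ 2 * t)) •
          flow A t b) =
          ((q t * ‖g t‖ ^ 2 : ℝ) : ℂ) := by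
        intro t
        rw [map_smul]
        change _ * g t = _
        simp only [Nat.cast_zero, ne_eq, OfNat.ofNat_ne_zero, not_false_eq_true, zero_pow, zero_mul,
          Complex.exp_zero, mul_one]
        rw [mul_assoc, Complex.star_def, Complex.conj_mul']
        push_cast; rfl
      simp only [h2] at h1
      rw [integral_complex_ofReal] at h1
      exact_mod_cast h1
    have hcont : Continuous fun t => q t * ‖g t‖ ^ 2 := by fun_prop
    have hnn : 0 ≤ fun t => q t * ‖g t‖ ^ 2 := fun t => mul_nonneg (le_max_left _ _) (by positivity)
    have hcs : HasCompactSupport fun t => q t * ‖g t‖ ^ 2 :=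
      HasCompactSupport.of_support_subset_isCompact (isCompact_Icc (a := 0) (b := 1)) fun t ht => by
        by_contra h'
        exact ht (by simp [hq0 t h'])
    have hz : (fun t => q t * ‖g t‖ ^ 2) = 0 := by
      have := (integral_eq_zero_iff_of_nonneg hnn
        (hcont.integrable_of_hasCompactSupport hcs)).1 hint
      exact hcont.ae_eq_iff_eq volume continuous_const |>.1 this
    have hgz : ∀ t ∈ Ioo (0 : ℝ) 1, g t = 0 := by
      intro t ht
      have h1 : q t * ‖g t‖ ^ 2 = 0 := congrFun hz t
      have h2 : 0 < q t := lt_max_of_lt_right (mul_pos ht.1 (by linarith [ht.2]))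
      rcases mul_eq_zero.1 h1 with h | h
      · exact absurd h h2.ne'
      · simpa using h
    have hhalf : (1 / 2 : ℝ) ∈ Ioo (0 : ℝ) 1 := by norm_num
    have hder : HasDerivAt g (f' (-(flow A (1 / 2) * A) b)) (1 / 2) := by
      have h1 : HasDerivAt (fun t => flow A t b) ((-(flow A (1 / 2) * A)) b) (1 / 2) :=
        ((ContinuousLinearMap.apply ℂ V b).restrictScalars ℝ).hasFDerivAt.comp_hasDerivAt _
          (hasDerivAt_flow' A (1 / 2))
      exact (f'.restrictScalars ℝ).hasFDerivAt.comp_hasDerivAt _ h1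
    have hder0 : HasDerivAt g 0 (1 / 2) :=
      (hasDerivAt_const (1 / 2 : ℝ) (0 : ℂ)).congr_of_eventuallyEq
        (Filter.eventuallyEq_of_mem (Ioo_mem_nhds hhalf.1 hhalf.2) hgz)
    have e1 : f' (flow A (1 / 2) (A b)) = 0 := by
      have := hder.unique hder0
      simpa using this
    have e0 : f' (flow A (1 / 2) b) = 0 := hgz _ hhalf
    have hfz := hb (f ∘ₗ (flow A (1 / 2)).toLinearMap) e0 e1
    apply hf0
    ext v
    have h1 := LinearMap.congr_fun hfz (flow A (-(1 / 2)) v)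
    have h2 : flow A (1 / 2) (flow A (-(1 / 2)) v) = v := by
      rw [← mul_apply_eq_comp, flow_mul_neg, one_apply_eq_self]
    change f (flow A (1 / 2) (flow A (-(1 / 2)) v)) = 0 at h1
    rw [h2] at h1
    simpa using h1
  let e := Module.finBasis ℂ V
  have hmem : ∀ i, ∃ w, IsContinuousControl 1 w ∧ moment A b 0 w = e i := fun i => by
    have : e i ∈ S := hS ▸ Submodule.mem_top
    exact this
  choose w hw hwe using hmem
  choose B hB using fun i => (hw i).exists_bound
  have hB0 : ∀ i, 0 ≤ B i := fun i => (norm_nonneg _).trans (hB i 0)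
  let L := fun i => (e.coord i).toContinuousLinearMap
  refine ⟨∑ i, ‖L i‖ * B i, Finset.sum_nonneg fun i _ => mul_nonneg (norm_nonneg _) (hB0 i),
    fun v => ⟨fun t => ∑ i, L i v * w i t,
    IsContinuousControl.sum _ fun i _ => (hw i).const_mul _, ?_, fun t => ?_⟩⟩
  · rw [moment_sum _ fun i _ => (hw i).const_mul _]
    simp only [moment_const_mul, hwe]
    exact e.sum_repr v
  · rw [Finset.sum_mul]
    refine norm_sum_le_of_le _ fun i _ => ?_
    rw [norm_mul]
    calc ‖L i v‖ * ‖w i t‖ ≤ (‖L i‖ * ‖v‖) * B i :=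
          mul_le_mul ((L i).le_opNorm v) (hB i t) (norm_nonneg _) (by positivity)
      _ = _ := by ring

variable [Nontrivial V]

/-- Biorthogonal controls: each moment can be prescribed while all the others vanish, with supports
in a common interval and a cost which is at most exponential in `j²`. -/
lemma exists_biorthogonal (hc : 0 < c) (hA : (A - μ₁ • 1) * (A - μ₂ • 1) = 0)
    (hres : ∀ j k : ℕ, 1 ≤ j → 1 ≤ k → j ≠ k → ∀ ν ∈ ({μ₁, μ₂} : Set ℂ), ∀ ν' ∈ ({μ₁, μ₂} : Set ℂ),
      Complex.exp ((((j : ℝ) ^ 2 - (k : ℝ) ^ 2 : ℝ) + ν) * delay c k - delay c k * ν') ≠ 1)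
    (hb : ∀ f : V →ₗ[ℂ] ℂ, f b = 0 → f (A b) = 0 → f = 0) :
    ∃ T D K : ℝ, 0 < T ∧ 0 ≤ D ∧ 0 ≤ K ∧ ∀ j : ℕ, 1 ≤ j → ∀ v : V, ∃ u, IsContinuousControl T u ∧
      moment A b j u = v ∧ (∀ l, 1 ≤ l → l ≠ j → moment A b l u = 0) ∧
      ∀ t, ‖u t‖ ≤ K * Real.exp (D * (j : ℝ) ^ 2) * ‖v‖ := by
  -- A base control with moment `v₀` of index `j` is fed into the annihilating operators; `v₀` is
  -- the preimage of `v` under the factor by which these act on the moments of index `j`.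
  obtain ⟨C, hC, hinv⟩ := exists_killFactor_inverse_bound hA hc hres
  obtain ⟨K, hK, hbase⟩ := exists_baseControl hb
  obtain ⟨T, P, hT, hP, hkill⟩ := exists_killSeq_limit (b := b) hc hA
  set Z := ∑' m : ℕ, 1 / ((m + 1 : ℕ) : ℝ) ^ 2
  refine ⟨T, 2 * C, P * K * Real.exp (C * Z), hT, by positivity, by positivity, fun j hj v => ?_⟩
  have hbase' : ∀ v : V, ∃ w, IsContinuousControl 1 w ∧ moment A b j w = v ∧
      ∀ t, ‖w t‖ ≤ K * ‖v‖ := by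
    intro v
    obtain ⟨w, hw, hwv, hwb⟩ := hbase v
    refine ⟨fun t => Complex.exp (-((j : ℂ) ^ 2 * t)) * w t, ⟨?_, fun t ht => ?_⟩, ?_, fun t => ?_⟩
    · have := hw.continuous
      fun_prop
    · simp [hw.support t ht]
    · rw [← hwv]
      unfold moment
      congr 1; ext t
      rw [mul_right_comm, ← Complex.exp_add]
      simp
    · by_cases ht : t ∈ Icc (0 : ℝ) 1
      · rw [norm_mul, Complex.norm_exp]
        have : (-((j : ℂ) ^ 2 * t)).re ≤ 0 := by
          rw [← Complex.ofReal_natCast, ← Complex.ofReal_pow, ← Complex.ofReal_mul,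
            ← Complex.ofReal_neg, Complex.ofReal_re]
          have := mul_nonneg (sq_nonneg (j : ℝ)) ht.1
          linarith
        calc _ ≤ 1 * ‖w t‖ :=
            mul_le_mul_of_nonneg_right (Real.exp_le_one_iff.2 this) (norm_nonneg _)
          _ ≤ _ := by rw [one_mul]; exact hwb t
      · dsimp only
        rw [hw.support t ht, mul_zero, norm_zero]
        positivity
  have hX : ∀ n (v : V), ‖v‖ ≤ Real.exp (C * (2 * (j : ℝ) ^ 2 + Z)) *
      ‖killProd A c μ₁ μ₂ j j n v‖ := fun n v =>
    (norm_le_killProd hC hinv hj n v).trans (mul_le_mul_of_nonneg_right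
      (Real.exp_le_exp.2 (mul_le_mul_of_nonneg_left (sum_killWeight_le j n) hC)) (norm_nonneg _))
  have hlim : ∀ v : V, ∃ y, Tendsto (fun n => killProd A c μ₁ μ₂ j j n v) atTop (𝓝 y) := by
    intro v
    obtain ⟨w, hw, rfl, hwb⟩ := hbase' v
    obtain ⟨u, -, -, -, h⟩ := hkill w hw _ hwb j
    exact ⟨_, h⟩
  obtain ⟨v₀, hv₀, hv₀n⟩ := exists_preimage_of_tendsto hX hlim v
  obtain ⟨w, hw, hwv, hwb⟩ := hbase' v₀
  obtain ⟨u, hu, hub, hul, huj⟩ := hkill w hw _ hwb j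
  rw [hwv] at huj
  refine ⟨u, hu, tendsto_nhds_unique huj hv₀, hul, fun t => (hub t).trans ?_⟩
  calc P * (K * ‖v₀‖) ≤ P * (K * (Real.exp (C * (2 * (j : ℝ) ^ 2 + Z)) * ‖v‖)) := by gcongr
    _ = _ := by
      rw [mul_add, Real.exp_add, show C * (2 * (j : ℝ) ^ 2) = 2 * C * (j : ℝ) ^ 2 by ring]
      ring

end Biorthogonal

/-! ### Controls of small energy -/

section Averaging

open Polynomial

/-- The polynomial `(1/N) ∑_{n<N} g⁻ⁿ Xⁿ`, equal to `1` at `g`, with coefficients of modulus at most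
`1/N` if `|g| ≥ 1`. -/
noncomputable def averagePoly (N : ℕ) (g : ℂ) : ℂ[X] :=
  ∑ n ∈ Finset.range N, monomial n ((g⁻¹) ^ n / N)

lemma coeff_averagePoly (N : ℕ) (g : ℂ) (n : ℕ) :
    (averagePoly N g).coeff n = if n < N then (g⁻¹) ^ n / N else 0 := by
  simp [averagePoly, coeff_monomial]

lemma eval_averagePoly {N : ℕ} (hN : N ≠ 0) {g : ℂ} (hg : g ≠ 0) :
    (averagePoly N g).eval g = 1 := by
  have h : ∀ n ∈ Finset.range N, (monomial n ((g⁻¹) ^ n / N)).eval g = 1 / (N : ℂ) := by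
    intro n _
    rw [eval_monomial, inv_pow]
    field_simp
  rw [averagePoly, eval_finsetSum, Finset.sum_congr rfl h]
  simp [hN]

lemma norm_coeff_averagePoly_le (N : ℕ) {g : ℂ} (hg : 1 ≤ ‖g‖) (n : ℕ) :
    ‖(averagePoly N g).coeff n‖ ≤ if n < N then 1 / (N : ℝ) else 0 := by
  rw [coeff_averagePoly]
  split_ifs
  · rw [norm_div, norm_pow, norm_inv, Complex.norm_natCast]
    gcongr
    exact pow_le_one₀ (by positivity) (inv_le_one_of_one_le₀ hg)
  · simp

lemma norm_coeff_averagePoly_le' (N : ℕ) {g : ℂ} (hg : 1 ≤ ‖g‖) (n : ℕ) :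
    ‖(averagePoly N g).coeff n‖ ≤ 1 / (N : ℝ) := by
  refine (norm_coeff_averagePoly_le N hg n).trans ?_
  split_ifs
  · exact le_rfl
  · positivity

/-- If `G` satisfies a quadratic equation whose roots have modulus at least `1`, then `1` is a
combination of powers of `G` with uniformly small coefficients: writing `Pᵢ` for the average
normalized at the `i`-th root, `1 - (1 - P₁)(1 - P₂)` takes the value `1` at `G`. -/
lemma exists_small_coeff {𝔸 : Type*} [Ring 𝔸] [Algebra ℂ 𝔸] {G : 𝔸} {g₁ g₂ : ℂ}
    (hG : (G - algebraMap ℂ 𝔸 g₁) * (G - algebraMap ℂ 𝔸 g₂) = 0) (h1 : 1 ≤ ‖g₁‖) (h2 : 1 ≤ ‖g₂‖)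
    {N : ℕ} (hN : N ≠ 0) :
    ∃ p : ℕ → ℂ, (∀ n, ‖p n‖ ≤ 3 / N) ∧ ∑ n ∈ Finset.range (2 * N), p n • G ^ n = 1 := by
  have hg1 : g₁ ≠ 0 := by rintro rfl; simp at h1; linarith
  have hg2 : g₂ ≠ 0 := by rintro rfl; simp at h2; linarith
  set P₁ := averagePoly N g₁
  set P₂ := averagePoly N g₂
  set P := P₁ + P₂ - P₁ * P₂ with hP
  have hNpos : (0 : ℝ) < N := by exact_mod_cast Nat.pos_of_ne_zero hN
  have hmul : ∀ n, ‖(P₁ * P₂).coeff n‖ ≤ 1 / (N : ℝ) := by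
    intro n
    rw [coeff_mul, Finset.Nat.sum_antidiagonal_eq_sum_range_succ
      (fun i j => P₁.coeff i * P₂.coeff j) n]
    calc ‖∑ k ∈ Finset.range n.succ, P₁.coeff k * P₂.coeff (n - k)‖
        ≤ ∑ k ∈ Finset.range n.succ, (if k < N then 1 / (N : ℝ) else 0) * (1 / (N : ℝ)) := by
          refine norm_sum_le_of_le _ fun k _ => ?_
          rw [norm_mul]
          exact mul_le_mul (norm_coeff_averagePoly_le N h1 k) (norm_coeff_averagePoly_le' N h2 _)
            (norm_nonneg _) (by split_ifs <;> positivity)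
      _ = (∑ k ∈ Finset.range n.succ with k < N, 1 / (N : ℝ)) * (1 / (N : ℝ)) := by
          rw [← Finset.sum_mul, Finset.sum_filter]
      _ ≤ (∑ k ∈ Finset.range N, 1 / (N : ℝ)) * (1 / (N : ℝ)) := by
          refine mul_le_mul_of_nonneg_right ?_ (by positivity)
          refine Finset.sum_le_sum_of_subset_of_nonneg (fun k hk => ?_) fun _ _ _ => by positivity
          exact Finset.mem_range.2 (Finset.mem_filter.1 hk).2
      _ = 1 / (N : ℝ) := by simp [hN]
  have hdeg : ∀ g, (averagePoly N g).natDegree ≤ N - 1 := by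
    intro g
    rw [natDegree_le_iff_coeff_eq_zero]
    intro n hn
    rw [coeff_averagePoly, if_neg (by omega)]
  have hdegP : P.natDegree < 2 * N := by
    have h3 : P.natDegree ≤ (N - 1) + (N - 1) :=
      (natDegree_sub_le _ _).trans (max_le
        ((natDegree_add_le _ _).trans
          (max_le ((hdeg _).trans (by omega)) ((hdeg _).trans (by omega))))
        (natDegree_mul_le.trans (add_le_add (hdeg _) (hdeg _))))
    omega
  refine ⟨P.coeff, fun n => ?_, ?_⟩
  · rw [hP, coeff_sub, coeff_add]
    calc _ ≤ (‖P₁.coeff n‖ + ‖P₂.coeff n‖) + ‖(P₁ * P₂).coeff n‖ :=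
          (norm_sub_le _ _).trans (add_le_add_left (norm_add_le _ _) _)
      _ ≤ (1 / N + 1 / N) + 1 / N := add_le_add (add_le_add (norm_coeff_averagePoly_le' N h1 n)
          (norm_coeff_averagePoly_le' N h2 n)) (hmul n)
      _ = 3 / N := by ring
  · rw [← aeval_eq_sum_range' hdegP G]
    have hdvd : (X - C g₁) * (X - C g₂) ∣ 1 - P := by
      have : 1 - P = (1 - P₁) * (1 - P₂) := by rw [hP]; ring
      rw [this]
      refine mul_dvd_mul ?_ ?_
      · rw [dvd_iff_isRoot]; simp [P₁, eval_averagePoly hN hg1]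
      · rw [dvd_iff_isRoot]; simp [P₂, eval_averagePoly hN hg2]
    obtain ⟨Q, hQ⟩ := hdvd
    have := congrArg (aeval G) hQ
    simp only [map_sub, map_mul, map_one, aeval_X, aeval_C] at this
    rw [hG, zero_mul, sub_eq_zero] at this
    exact this.symm

end Averaging

namespace IsContinuousControl

variable {T : ℝ} {u : ℝ → ℂ}

lemma integrable_norm_sq (h : IsContinuousControl T u) : Integrable fun t => ‖u t‖ ^ 2 := by
  refine Continuous.integrable_of_hasCompactSupport (h.continuous.norm.pow 2) ?_
  exact HasCompactSupport.of_support_subset_isCompact (isCompact_Icc (a := 0) (b := T))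
    fun t ht => by
      by_contra h'
      exact ht (by simp [h.support t h'])

lemma energy_le (h : IsContinuousControl T u) (hT : 0 ≤ T) {B : ℝ} (hB : ∀ t, ‖u t‖ ≤ B) :
    ∫ t, ‖u t‖ ^ 2 ≤ T * B ^ 2 := by
  have h1 : ∫ t, ‖u t‖ ^ 2 = ∫ t in Icc 0 T, ‖u t‖ ^ 2 :=
    (setIntegral_eq_integral_of_forall_compl_eq_zero fun t ht => by simp [h.support t ht]).symm
  rw [h1]
  calc ∫ t in Icc 0 T, ‖u t‖ ^ 2 ≤ ∫ t in Icc 0 T, B ^ 2 := by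
        refine setIntegral_mono h.integrable_norm_sq.integrableOn
          (continuous_const.integrableOn_Icc) fun t => ?_
        exact pow_le_pow_left₀ (norm_nonneg _) (hB t) 2
    _ = _ := by simp [hT]

lemma energy_sum_le {J : ℕ} {f : ℕ → ℝ → ℂ} (hf : ∀ j < J, IsContinuousControl T (f j)) {ε : ℝ}
    (hε : ∀ j < J, ∫ t, ‖f j t‖ ^ 2 ≤ ε) :
    ∫ t, ‖∑ j ∈ Finset.range J, f j t‖ ^ 2 ≤ J * (J * ε) := by
  have hi : ∀ j ∈ Finset.range J, Integrable fun t => ‖f j t‖ ^ 2 := fun j hj =>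
    (hf j (Finset.mem_range.1 hj)).integrable_norm_sq
  calc ∫ t, ‖∑ j ∈ Finset.range J, f j t‖ ^ 2
      ≤ ∫ t, (J : ℝ) * ∑ j ∈ Finset.range J, ‖f j t‖ ^ 2 := by
        refine integral_mono
          (IsContinuousControl.sum _ fun j hj => hf j (Finset.mem_range.1 hj)).integrable_norm_sq
          ((integrable_finsetSum _ hi).const_mul _) fun t => ?_
        calc ‖∑ j ∈ Finset.range J, f j t‖ ^ 2 ≤ (∑ j ∈ Finset.range J, ‖f j t‖) ^ 2 :=
              pow_le_pow_left₀ (norm_nonneg _) (norm_sum_le _ _) 2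
          _ ≤ _ := by simpa using
              sq_sum_le_card_mul_sum_sq (s := Finset.range J) (f := fun j => ‖f j t‖)
    _ = J * ∑ j ∈ Finset.range J, ∫ t, ‖f j t‖ ^ 2 := by
        rw [integral_const_mul, integral_finsetSum _ hi]
    _ ≤ J * ∑ j ∈ Finset.range J, ε := by
        gcongr with j hj
        exact hε j (Finset.mem_range.1 hj)
    _ = _ := by simp

end IsContinuousControl

section Control

variable {V : Type*} [NormedAddCommGroup V] [NormedSpace ℂ V] [CompleteSpace V]
  {A : V →L[ℂ] V} {b : V} {c : ℝ} {μ₁ μ₂ : ℂ}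

/-- A control acting on the `j`-th mode only may be replaced by one with the same moments and
arbitrarily small energy, by averaging over many disjoint time windows: the `j`-th mode does not
grow exponentially because `Re μᵢ ≤ 1 ≤ j²`. -/
lemma exists_small_energy_singleMode (hA : (A - μ₁ • 1) * (A - μ₂ • 1) = 0) {j : ℕ} (hj : 1 ≤ j)
    (h1 : μ₁.re ≤ 1) (h2 : μ₂.re ≤ 1) {T : ℝ} (hT : 0 < T)
    {u : ℝ → ℂ} (hu : IsContinuousControl T u)
    (hul : ∀ l, 1 ≤ l → l ≠ j → moment A b l u = 0) {ε : ℝ} (hε : 0 < ε) :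
    ∃ T' w, 0 < T' ∧ IsContinuousControl T' w ∧ moment A b j w = moment A b j u ∧
      (∀ l, 1 ≤ l → l ≠ j → moment A b l w = 0) ∧ ∫ t, ‖w t‖ ^ 2 ≤ ε := by
  -- Windows of length `τ > T` make the translates of `u` have disjoint supports.
  set τ := T + 1
  have hτ : 0 < τ := by positivity
  set E := ∫ t, ‖u t‖ ^ 2
  have hE : 0 ≤ E := integral_nonneg fun t => by positivity
  obtain ⟨N, hN⟩ := exists_nat_ge (18 * E / ε + 1)
  have hNpos : (0 : ℝ) < N := lt_of_lt_of_le (by positivity) hN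
  have hN0 : N ≠ 0 := by rintro rfl; simp at hNpos
  have hj2 : (1 : ℝ) ≤ (j : ℝ) ^ 2 := one_le_pow₀ (by exact_mod_cast hj)
  set z : ℂ := (j : ℂ) ^ 2 * τ
  set G : V →L[ℂ] V := Complex.exp z • flow A τ with hG
  set g : ℂ → ℂ := fun μ => Complex.exp z * Complex.exp (-(τ * μ))
  have hg : ∀ μ : ℂ, μ.re ≤ 1 → 1 ≤ ‖g μ‖ := by
    intro μ hμ
    change 1 ≤ ‖Complex.exp z * Complex.exp (-(τ * μ))‖
    rw [← Complex.exp_add, Complex.norm_exp]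
    refine Real.one_le_exp ?_
    have : (z + -(τ * μ)).re = ((j : ℝ) ^ 2 - μ.re) * τ := by
      have h1 : z = (((j : ℝ) ^ 2 * τ : ℝ) : ℂ) := by push_cast; rfl
      rw [h1, Complex.add_re, Complex.neg_re, Complex.re_ofReal_mul, Complex.ofReal_re]
      ring
    rw [this]
    exact mul_nonneg (by linarith) hτ.le
  have hGC : (G - algebraMap ℂ _ (g μ₁)) * (G - algebraMap ℂ _ (g μ₂)) = 0 := by
    have e : ∀ μ, G - algebraMap ℂ (V →L[ℂ] V) (g μ) =
        Complex.exp z • (flow A τ - Complex.exp (-(τ * μ)) • 1) := fun μ => by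
      rw [Algebra.algebraMap_eq_smul_one, smul_sub, smul_smul]
    rw [e, e, smul_mul_smul_comm, flow_cayley hA, smul_zero]
  obtain ⟨p, hp, hpG⟩ := exists_small_coeff hGC (hg _ h1) (hg _ h2) hN0
  set f : ℕ → ℝ → ℂ := fun n t => p n * u (t - n * τ) with hf
  have hfc : ∀ n ∈ Finset.range (2 * N), IsContinuousControl (T + (2 * N : ℕ) * τ) (f n) := by
    intro n hn
    refine ((hu.shift (by positivity : 0 ≤ n * τ)).const_mul (p n)).mono ?_
    have : (n : ℝ) ≤ (2 * N : ℕ) := by exact_mod_cast (Finset.mem_range.1 hn).le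
    gcongr
  have hmom : ∀ l n, moment A b l (f n) =
      p n • (Complex.exp ((l : ℂ) ^ 2 * (n * τ : ℝ)) • flow A (n * τ) (moment A b l u)) := by
    intro l n
    rw [hf]; dsimp only
    rw [moment_const_mul, moment_shift hu]
  refine ⟨T + (2 * N : ℕ) * τ, fun t => ∑ n ∈ Finset.range (2 * N), f n t, by positivity,
    IsContinuousControl.sum _ hfc, ?_, fun l hl hlj => ?_, ?_⟩
  · rw [moment_sum _ hfc]
    have h3 : ∀ n, moment A b j (f n) = (p n • G ^ n) (moment A b j u) := by
      intro n
      rw [hmom, hG, smul_pow, ← flow_nat_mul, ← Complex.exp_nat_mul]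
      have : (j : ℂ) ^ 2 * (n * τ : ℝ) = n * z := by push_cast; simp only [z]; ring
      rw [this]
      rfl
    simp only [h3]
    rw [← sum_apply, hpG, one_apply_eq_self]
  · rw [moment_sum _ hfc]
    refine Finset.sum_eq_zero fun n _ => ?_
    rw [hmom, hul l hl hlj, map_zero, smul_zero, smul_zero]
  · have hpt : ∀ t, ‖∑ n ∈ Finset.range (2 * N), f n t‖ ^ 2 ≤
        ∑ n ∈ Finset.range (2 * N), ‖f n t‖ ^ 2 := by
      intro t
      by_cases h : ∃ m ∈ Finset.range (2 * N), f m t ≠ 0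
      · obtain ⟨m, hm, hmt⟩ := h
        have hmt' : t - m * τ ∈ Icc 0 T := by
          by_contra h'
          exact hmt (by simp [hf, hu.support _ h'])
        have hother : ∀ n ∈ Finset.range (2 * N), n ≠ m → f n t = 0 := by
          intro n _ hnm
          by_contra h'
          have hnt' : t - n * τ ∈ Icc 0 T := by
            by_contra h''
            exact h' (by simp [hf, hu.support _ h''])
          have h4 : |((n : ℝ) - m) * τ| ≤ T := by
            rw [abs_le]
            constructor <;> nlinarith [hmt'.1, hmt'.2, hnt'.1, hnt'.2]
          have h5 : (1 : ℝ) ≤ |(n : ℝ) - m| := by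
            have : (1 : ℤ) ≤ |(n : ℤ) - m| := Int.one_le_abs (by omega)
            exact_mod_cast this
          rw [abs_mul, abs_of_pos hτ] at h4
          have : τ ≤ T := le_trans (by nlinarith) h4
          simp only [τ] at this
          linarith
        rw [Finset.sum_eq_single_of_mem m hm hother]
        exact Finset.single_le_sum (f := fun n => ‖f n t‖ ^ 2) (fun n _ => by positivity) hm
      · push Not at h
        rw [Finset.sum_eq_zero h]
        simp only [norm_zero, ne_eq, OfNat.ofNat_ne_zero, not_false_eq_true, zero_pow]
        exact Finset.sum_nonneg fun n _ => by positivity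
    have hfe : ∀ n, ∫ t, ‖f n t‖ ^ 2 ≤ 9 / (N : ℝ) ^ 2 * E := by
      intro n
      have : ∫ t, ‖f n t‖ ^ 2 = ‖p n‖ ^ 2 * E := by
        simp only [hf, norm_mul, mul_pow]
        rw [integral_const_mul, integral_sub_right_eq_self (fun t => ‖u t‖ ^ 2)]
      rw [this]
      refine mul_le_mul_of_nonneg_right ?_ hE
      calc ‖p n‖ ^ 2 ≤ (3 / N) ^ 2 := pow_le_pow_left₀ (norm_nonneg _) (hp n) 2
        _ = _ := by rw [div_pow]; norm_num
    have hint : ∀ n ∈ Finset.range (2 * N), Integrable fun t => ‖f n t‖ ^ 2 := fun n hn =>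
      (hfc n hn).integrable_norm_sq
    calc ∫ t, ‖∑ n ∈ Finset.range (2 * N), f n t‖ ^ 2
        ≤ ∫ t, ∑ n ∈ Finset.range (2 * N), ‖f n t‖ ^ 2 :=
          integral_mono (IsContinuousControl.sum _ hfc).integrable_norm_sq
            (integrable_finsetSum _ hint) hpt
      _ = ∑ n ∈ Finset.range (2 * N), ∫ t, ‖f n t‖ ^ 2 := integral_finsetSum _ hint
      _ ≤ ∑ n ∈ Finset.range (2 * N), 9 / (N : ℝ) ^ 2 * E := Finset.sum_le_sum fun n _ => hfe n
      _ = 18 * E / N := by simp; field_simp; ring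
      _ ≤ ε := by
          rw [div_le_iff₀ hNpos]
          have : 18 * E / ε ≤ N := by linarith
          rw [div_le_iff₀ hε] at this
          linarith

end Control

section SmallEnergy

variable {V : Type*} [NormedAddCommGroup V] [NormedSpace ℂ V] [FiniteDimensional ℂ V] [Nontrivial V]
  {A : V →L[ℂ] V} {b : V} {c : ℝ} {μ₁ μ₂ : ℂ}

/-- High modes are controlled at small cost after a long waiting time, during which they decay
faster than the cost of the biorthogonal controls grows. -/
lemma exists_small_energy_highModes {T D K : ℝ} (hT : 0 < T) (hD : 0 ≤ D) (hK : 0 ≤ K)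
    (hbi : ∀ j : ℕ, 1 ≤ j → ∀ v : V, ∃ u, IsContinuousControl T u ∧
      moment A b j u = v ∧ (∀ l, 1 ≤ l → l ≠ j → moment A b l u = 0) ∧
      ∀ t, ‖u t‖ ≤ K * Real.exp (D * (j : ℝ) ^ 2) * ‖v‖)
    {J : ℕ} (hJ1 : 1 ≤ J) (hJ : 2 * ‖A‖ ≤ (J : ℝ) ^ 2) {v : ℕ → V} {M : ℝ}
    (hv : ∀ j, 1 ≤ j → ‖v j‖ ≤ M) {ε : ℝ} (hε : 0 < ε) :
    ∃ T' w, 0 < T' ∧ IsContinuousControl T' w ∧ (∀ l, J ≤ l → moment A b l w = v l) ∧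
      (∀ l, 1 ≤ l → l < J → moment A b l w = 0) ∧ ∫ t, ‖w t‖ ^ 2 ≤ ε := by
  have hM : 0 ≤ M := (norm_nonneg _).trans (hv 1 le_rfl)
  set S := ∑' n : ℕ, Real.exp (-(n : ℝ))
  have hS : Summable fun n : ℕ => Real.exp (-(n : ℝ)) := Real.summable_exp_neg_nat
  -- The parameter `s` is chosen so that the uniform bound `Q e^{-(s-1)}` has energy at most `ε`.
  set Q := K * M * S
  obtain ⟨s, hs1, hsε⟩ : ∃ s : ℝ, 1 ≤ s ∧ T * (Q * Real.exp (-(s - 1))) ^ 2 ≤ ε := by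
    have h1 : Tendsto (fun s : ℝ => Real.exp (-(s - 1))) atTop (𝓝 0) :=
      Real.tendsto_exp_neg_atTop_nhds_zero.comp (tendsto_atTop_add_const_right _ _ tendsto_id)
    have h2 : Tendsto (fun s : ℝ => T * (Q * Real.exp (-(s - 1))) ^ 2) atTop (𝓝 0) := by
      simpa using ((h1.const_mul Q).pow 2).const_mul T
    obtain ⟨s, hs, hs'⟩ := ((h2.eventually (gt_mem_nhds hε)).and (eventually_ge_atTop 1)).exists
    exact ⟨s, hs', hs.le⟩
  set t₀ := 2 * (D + s)
  have ht₀ : 0 ≤ t₀ := by positivity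
  set y : ℕ → V := fun j => Complex.exp (-((j : ℂ) ^ 2 * t₀)) • flow A (-t₀) (v j) with hy
  have hyn : ∀ j, J ≤ j → ‖y j‖ ≤ Real.exp (-((D + s) * (j : ℝ) ^ 2)) * M := by
    intro j hj
    have h1 : ‖flow A (-t₀) (v j)‖ ≤ Real.exp (t₀ * ‖A‖) * M := by
      refine ((flow A (-t₀)).le_opNorm _).trans ?_
      refine mul_le_mul ?_ (hv j (hJ1.trans hj)) (norm_nonneg _) (Real.exp_pos _).le
      simpa [abs_of_nonneg ht₀] using norm_flow_le A (-t₀)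
    have h2 : ‖Complex.exp (-((j : ℂ) ^ 2 * t₀))‖ = Real.exp (-((j : ℝ) ^ 2 * t₀)) := by
      rw [Complex.norm_exp]
      congr 1
      rw [← Complex.ofReal_natCast, ← Complex.ofReal_pow, ← Complex.ofReal_mul,
        ← Complex.ofReal_neg, Complex.ofReal_re]
    have h3 : 2 * ‖A‖ ≤ (j : ℝ) ^ 2 := hJ.trans (by gcongr)
    rw [hy]; dsimp only
    rw [norm_smul, h2]
    calc _ ≤ Real.exp (-((j : ℝ) ^ 2 * t₀)) * (Real.exp (t₀ * ‖A‖) * M) := by gcongr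
      _ = Real.exp (-((j : ℝ) ^ 2 * t₀) + t₀ * ‖A‖) * M := by rw [Real.exp_add]; ring
      _ ≤ _ := by
        gcongr
        simp only [t₀] at ht₀ ⊢
        nlinarith [mul_le_mul_of_nonneg_left h3 ht₀]
  choose! u hu huj hul hun using hbi
  set f : ℕ → ℝ → ℂ := fun n => u (J + n) (y (J + n)) with hf
  set d : ℕ → ℝ := fun n => K * M * Real.exp (-(s - 1)) * Real.exp (-(n : ℝ))
  have hd : Summable d := hS.mul_left _
  have hfc : ∀ n, IsContinuousControl T (f n) := fun n => hu _ (by omega) _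
  have hfd : ∀ n t, ‖f n t‖ ≤ d n := by
    intro n t
    refine (hun (J + n) (by omega) _ t).trans ?_
    set j := J + n with hj
    have hjn : (n : ℝ) + 1 ≤ j := by
      rw [hj]; push_cast
      have : (1 : ℝ) ≤ J := by exact_mod_cast hJ1
      linarith
    have hn0 : (0 : ℝ) ≤ n := Nat.cast_nonneg n
    calc K * Real.exp (D * (j : ℝ) ^ 2) * ‖y j‖
        ≤ K * Real.exp (D * (j : ℝ) ^ 2) * (Real.exp (-((D + s) * (j : ℝ) ^ 2)) * M) := by
          gcongr
          exact hyn j (by omega)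
      _ = K * M * Real.exp (-(s * (j : ℝ) ^ 2)) := by
          have : Real.exp (-(s * (j : ℝ) ^ 2)) =
              Real.exp (D * (j : ℝ) ^ 2) * Real.exp (-((D + s) * (j : ℝ) ^ 2)) := by
            rw [← Real.exp_add]; ring_nf
          rw [this]; ring
      _ ≤ K * M * Real.exp (-(s - 1) + -(n : ℝ)) := by
          gcongr
          have h5 : (n : ℝ) + 1 ≤ (j : ℝ) ^ 2 := by nlinarith
          nlinarith [mul_le_mul_of_nonneg_left h5 (by linarith : 0 ≤ s)]
      _ = d n := by rw [Real.exp_add]; simp only [d]; ring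
  have hFc : ∀ n, IsContinuousControl T (fun t => ∑ m ∈ Finset.range n, f m t) := fun n =>
    IsContinuousControl.sum _ fun m _ => hfc m
  obtain ⟨w, hw, hlim⟩ := IsContinuousControl.of_tendsto hFc hd (fun n t => by
    rw [Finset.sum_range_succ, add_sub_cancel_left]; exact hfd n t)
  have hQ : ∑' n, d n = Q * Real.exp (-(s - 1)) := by
    simp only [d]
    rw [tsum_mul_left]
    simp only [Q]; ring
  have hFB : ∀ n t, ‖∑ m ∈ Finset.range n, f m t‖ ≤ Q * Real.exp (-(s - 1)) := by
    intro n t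
    rw [← hQ]
    refine (norm_sum_le_of_le _ fun m _ => hfd m t).trans (hd.sum_le_tsum _ fun m _ => ?_)
    exact (norm_nonneg _).trans (hfd m 0)
  have hwB : ∀ t, ‖w t‖ ≤ Q * Real.exp (-(s - 1)) := fun t =>
    le_of_tendsto (hlim t).norm (Eventually.of_forall fun n => hFB n t)
  have hmom := fun l => tendsto_moment (A := A) (b := b) hFc hFB hlim l
  have hwl : ∀ l, 1 ≤ l → l < J → moment A b l w = 0 := by
    intro l hl hlJ
    refine tendsto_nhds_unique (hmom l) (tendsto_const_nhds.congr fun n => ?_)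
    rw [moment_sum _ fun m _ => hfc m]
    exact (Finset.sum_eq_zero fun m _ => hul _ (by omega) _ l hl (by omega)).symm
  have hwJ : ∀ l, J ≤ l → moment A b l w = y l := by
    intro l hl
    refine tendsto_nhds_unique (hmom l) (tendsto_const_nhds.congr' ?_)
    filter_upwards [eventually_gt_atTop (l - J)] with n hn
    rw [moment_sum _ fun m _ => hfc m,
      Finset.sum_eq_single_of_mem (l - J) (Finset.mem_range.2 hn) fun m _ hm => ?_]
    · rw [hf]; dsimp only
      rw [Nat.add_sub_cancel' hl]
      exact (huj l (by omega) _).symm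
    · exact hul _ (by omega) _ l (by omega) (by omega)
  refine ⟨T + t₀, fun t => w (t - t₀), by positivity, hw.shift ht₀, fun l hl => ?_,
    fun l hl hlJ => ?_, ?_⟩
  · rw [moment_shift hw, hwJ l hl, hy]
    dsimp only
    rw [map_smul, smul_smul, ← Complex.exp_add, add_neg_cancel, Complex.exp_zero, one_smul,
      ← mul_apply_eq_comp, flow_mul_neg, one_apply_eq_self]
  · rw [moment_shift hw, hwl l hl hlJ, map_zero, smul_zero]
  · rw [integral_sub_right_eq_self (fun t => ‖w t‖ ^ 2)]
    exact (hw.energy_le hT.le hwB).trans hsε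

/-- All moments can be prescribed simultaneously, with arbitrarily small energy: the high modes are
treated together, after a waiting time, and the finitely many low modes one by one. -/
lemma exists_small_energy_control (hc : 0 < c) (hA : (A - μ₁ • 1) * (A - μ₂ • 1) = 0)
    (hres : ∀ j k : ℕ, 1 ≤ j → 1 ≤ k → j ≠ k → ∀ ν ∈ ({μ₁, μ₂} : Set ℂ), ∀ ν' ∈ ({μ₁, μ₂} : Set ℂ),
      Complex.exp ((((j : ℝ) ^ 2 - (k : ℝ) ^ 2 : ℝ) + ν) * delay c k - delay c k * ν') ≠ 1)
    (hb : ∀ f : V →ₗ[ℂ] ℂ, f b = 0 → f (A b) = 0 → f = 0)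
    (h1 : μ₁.re ≤ 1) (h2 : μ₂.re ≤ 1) {v : ℕ → V} {M : ℝ} (hv : ∀ j, 1 ≤ j → ‖v j‖ ≤ M)
    {ε : ℝ} (hε : 0 < ε) :
    ∃ T w, 0 < T ∧ IsContinuousControl T w ∧ (∀ l, 1 ≤ l → moment A b l w = v l) ∧
      ∫ t, ‖w t‖ ^ 2 ≤ ε := by
  obtain ⟨T, D, K, hT, hD, hK, hbi⟩ := exists_biorthogonal hc hA hres hb
  obtain ⟨J, hJ⟩ := exists_nat_ge (2 * ‖A‖ + 1)
  have hJ1' : (1 : ℝ) ≤ J := by linarith [norm_nonneg A]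
  have hJ1 : 1 ≤ J := by exact_mod_cast hJ1'
  have hJ2 : 2 * ‖A‖ ≤ (J : ℝ) ^ 2 := by nlinarith
  set δ := ε / (J * J)
  have hδ : 0 < δ := by positivity
  -- The index `0` of the family stands for all modes from `J` on, each `j ≥ 1` for the `j`-th mode.
  have hfam : ∀ j, ∃ T' w, 0 < T' ∧ IsContinuousControl T' w ∧ ∫ t, ‖w t‖ ^ 2 ≤ δ ∧
      ∀ l, 1 ≤ l → moment A b l w =
        if (j = 0 ∧ J ≤ l) ∨ (j ≠ 0 ∧ l = j) then v l else 0 := by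
    intro j
    rcases Nat.eq_zero_or_pos j with rfl | hj
    · obtain ⟨T', w, hT', hw, hwJ, hwl, hwe⟩ :=
        exists_small_energy_highModes hT hD hK hbi hJ1 hJ2 hv hδ
      refine ⟨T', w, hT', hw, hwe, fun l hl => ?_⟩
      by_cases h : J ≤ l
      · simp [h, hwJ l h]
      · simp [h, hwl l hl (not_le.1 h)]
    · obtain ⟨u, hu, huj, hul, -⟩ := hbi j hj (v j)
      obtain ⟨T', w, hT', hw, hwj, hwl, hwe⟩ :=
        exists_small_energy_singleMode hA hj h1 h2 hT hu hul hδ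
      refine ⟨T', w, hT', hw, hwe, fun l hl => ?_⟩
      by_cases h : l = j
      · subst h
        simp [hwj, huj, hj.ne']
      · simp [h, hj.ne', hwl l hl h]
  choose T' w hT' hw hwe hwl using hfam
  set S := ∑ j ∈ Finset.range J, T' j
  have hwS : ∀ j < J, IsContinuousControl S (w j) := fun j hj =>
    (hw j).mono (Finset.single_le_sum (fun i _ => (hT' i).le) (Finset.mem_range.2 hj))
  have hwS' : ∀ j ∈ Finset.range J, IsContinuousControl S (w j) := fun j hj =>
    hwS j (Finset.mem_range.1 hj)
  refine ⟨S, fun t => ∑ j ∈ Finset.range J, w j t,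
    Finset.sum_pos (fun i _ => hT' i) ⟨0, Finset.mem_range.2 hJ1⟩,
    IsContinuousControl.sum _ hwS', fun l hl => ?_, ?_⟩
  · rw [moment_sum _ hwS']
    simp only [hwl _ l hl]
    by_cases h : J ≤ l
    · rw [Finset.sum_eq_single_of_mem 0 (Finset.mem_range.2 hJ1) fun j hj hj0 => ?_]
      · simp [h]
      · have := Finset.mem_range.1 hj
        rw [if_neg]; omega
    · rw [Finset.sum_eq_single_of_mem l (Finset.mem_range.2 (by omega)) fun j hj hjl => ?_]
      · rw [if_pos]; omega
      · rw [if_neg]; omega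
  · refine (IsContinuousControl.energy_sum_le hwS fun j _ => hwe j).trans (le_of_eq ?_)
    simp only [δ]
    field_simp

end SmallEnergy

/-! ### Sine series on `(0, π)` -/

/-- The integral of `f` against `sin (k x)` over `(0, π)`, without a normalizing factor. -/
noncomputable def sineCoeff (f : ℝ → ℂ) (k : ℕ) : ℂ :=
  ∫ x in (0 : ℝ)..Real.pi, f x * (Real.sin (k * x) : ℂ)

lemma sineCoeff_zero (f : ℝ → ℂ) : sineCoeff f 0 = 0 := by simp [sineCoeff]

lemma sineCoeff_eq_setIntegral (f : ℝ → ℂ) (k : ℕ) :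
    sineCoeff f k = ∫ x in Ioo 0 Real.pi, f x * (Real.sin (k * x) : ℂ) := by
  rw [sineCoeff, intervalIntegral.integral_of_le Real.pi_pos.le, integral_Ioc_eq_integral_Ioo]

lemma integral_cos_int_mul {m : ℤ} (hm : m ≠ 0) :
    ∫ x in (0 : ℝ)..Real.pi, Real.cos (m * x) = 0 := by
  have hm' : (m : ℝ) ≠ 0 := by exact_mod_cast hm
  rw [intervalIntegral.integral_comp_mul_left (fun x => Real.cos x) hm', integral_cos]
  simp [Real.sin_int_mul_pi]

lemma integral_sin_mul_sin {j k : ℕ} (hj : 1 ≤ j) :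
    ∫ x in (0 : ℝ)..Real.pi, Real.sin (j * x) * Real.sin (k * x) =
      if j = k then Real.pi / 2 else 0 := by
  have h : ∀ x : ℝ, Real.sin (j * x) * Real.sin (k * x) =
      (1 / 2) * (Real.cos (((j - k : ℤ) : ℝ) * x) - Real.cos (((j + k : ℤ) : ℝ) * x)) := by
    intro x
    push_cast
    rw [sub_mul, add_mul, Real.cos_sub, Real.cos_add]
    ring
  simp only [h]
  rw [intervalIntegral.integral_const_mul, intervalIntegral.integral_sub
    (Continuous.intervalIntegrable (by fun_prop) _ _)
    (Continuous.intervalIntegrable (by fun_prop) _ _),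
    integral_cos_int_mul (by omega : (j + k : ℤ) ≠ 0)]
  split_ifs with hjk
  · subst hjk; simp; ring
  · rw [integral_cos_int_mul (by omega)]; simp

/-- The normalized sine functions belong to `L²(0, π)`. -/
lemma memLp_sine (k : ℕ) :
    MemLp (fun x : ℝ => ((√(2 / Real.pi) * Real.sin ((k + 1 : ℕ) * x) : ℝ) : ℂ)) 2
    (volume.restrict (Ioo 0 Real.pi)) := by
  refine MemLp.of_bound (Continuous.aestronglyMeasurable (by fun_prop)) √(2 / Real.pi)
    (Eventually.of_forall fun x => ?_)
  rw [Complex.norm_real, Real.norm_eq_abs, abs_mul, abs_of_nonneg (Real.sqrt_nonneg _)]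
  exact mul_le_of_le_one_right (Real.sqrt_nonneg _) (Real.abs_sin_le_one _)

lemma orthonormal_sine : Orthonormal ℂ fun k => (memLp_sine k).toLp := by
  rw [orthonormal_iff_ite]
  intro j k
  rw [L2.inner_def]
  have h : ∀ᵐ x ∂(volume.restrict (Ioo 0 Real.pi)),
      inner ℂ ((memLp_sine j).toLp _ x) ((memLp_sine k).toLp _ x) =
        ((2 / Real.pi * (Real.sin ((j + 1 : ℕ) * x) * Real.sin ((k + 1 : ℕ) * x)) : ℝ) : ℂ) := by
    filter_upwards [(memLp_sine j).coeFn_toLp, (memLp_sine k).coeFn_toLp] with x hx hx'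
    have h2 : √(2 / Real.pi) * √(2 / Real.pi) = 2 / Real.pi := Real.mul_self_sqrt (by positivity)
    rw [hx, hx', RCLike.inner_apply, Complex.conj_ofReal, ← Complex.ofReal_mul]
    congr 1
    linear_combination (Real.sin ((j + 1 : ℕ) * x) * Real.sin ((k + 1 : ℕ) * x)) * h2
  rw [integral_congr_ae h, integral_complex_ofReal, integral_const_mul,
    ← integral_Ioc_eq_integral_Ioo,
    ← intervalIntegral.integral_of_le Real.pi_pos.le, integral_sin_mul_sin (by omega)]
  have := Real.pi_pos
  by_cases hjk : j = k
  · simp [hjk]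
  · simp [hjk]

lemma bessel_sine {f : ℝ → ℂ} (hf : MemLp f 2 (volume.restrict (Ioo 0 Real.pi))) (n : ℕ) :
    ∑ k ∈ Finset.range n, ‖sineCoeff f k‖ ^ 2 ≤ Real.pi / 2 * ‖hf.toLp f‖ ^ 2 := by
  have h1 : ∀ k, inner ℂ ((memLp_sine k).toLp) (hf.toLp f) =
      ((√(2 / Real.pi) : ℝ) : ℂ) * sineCoeff f (k + 1) := by
    intro k
    rw [L2.inner_def, sineCoeff_eq_setIntegral, ← integral_const_mul]
    refine integral_congr_ae ?_
    filter_upwards [(memLp_sine k).coeFn_toLp, hf.coeFn_toLp] with x hx hx'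
    rw [hx, hx', RCLike.inner_apply, Complex.conj_ofReal]
    push_cast; ring
  have h2 : ∀ k, ‖sineCoeff f (k + 1)‖ ^ 2 =
      Real.pi / 2 * ‖inner ℂ ((memLp_sine k).toLp) (hf.toLp f)‖ ^ 2 := by
    intro k
    rw [h1, norm_mul, mul_pow, Complex.norm_real, Real.norm_eq_abs, sq_abs,
      Real.sq_sqrt (by positivity)]
    have := Real.pi_pos
    field_simp
  have h3 := (orthonormal_sine).sum_inner_products_le (hf.toLp f) (s := Finset.range n)
  calc ∑ k ∈ Finset.range n, ‖sineCoeff f k‖ ^ 2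
      ≤ ∑ k ∈ Finset.range (n + 1), ‖sineCoeff f k‖ ^ 2 :=
        Finset.sum_le_sum_of_subset_of_nonneg (Finset.range_mono (by omega))
          fun _ _ _ => by positivity
    _ = ∑ k ∈ Finset.range n, ‖sineCoeff f (k + 1)‖ ^ 2 := by
        rw [Finset.sum_range_succ', sineCoeff_zero]; simp
    _ = Real.pi / 2 * ∑ k ∈ Finset.range n, ‖inner ℂ ((memLp_sine k).toLp) (hf.toLp f)‖ ^ 2 := by
        rw [Finset.mul_sum]; exact Finset.sum_congr rfl fun k _ => h2 k
    _ ≤ _ := by have := Real.pi_pos; gcongr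

lemma summable_sineCoeff_sq {f : ℝ → ℂ} (hf : MemLp f 2 (volume.restrict (Ioo 0 Real.pi))) :
    Summable fun k => ‖sineCoeff f k‖ ^ 2 :=
  summable_of_sum_range_le (fun _ => by positivity) (bessel_sine hf)

lemma bessel_sine_of_bound {f : ℝ → ℂ} (hf : Continuous f) {B : ℝ}
    (hfB : ∀ x ∈ Icc 0 Real.pi, ‖f x‖ ≤ B) (n : ℕ) :
    ∑ k ∈ Finset.range n, ‖sineCoeff f k‖ ^ 2 ≤ Real.pi / 2 * (Real.pi * B ^ 2) := by
  have hae : ∀ᵐ x ∂(volume.restrict (Ioo 0 Real.pi)), ‖f x‖ ≤ B :=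
    (ae_restrict_iff' measurableSet_Ioo).2 (Eventually.of_forall fun x hx =>
      hfB x (Ioo_subset_Icc_self hx))
  have hm : MemLp f 2 (volume.restrict (Ioo 0 Real.pi)) :=
    MemLp.of_bound hf.aestronglyMeasurable B hae
  refine (bessel_sine hm n).trans ?_
  have hπ := Real.pi_pos
  have h1 : ‖hm.toLp f‖ ^ 2 = ∫ x in Ioo 0 Real.pi, ‖f x‖ ^ 2 := by
    have h2 : inner ℂ (hm.toLp f) (hm.toLp f) = ((‖hm.toLp f‖ ^ 2 : ℝ) : ℂ) := by
      rw [inner_self_eq_norm_sq_to_K]; push_cast; rfl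
    rw [L2.inner_def] at h2
    have h3 : ∫ x in Ioo 0 Real.pi, inner ℂ (hm.toLp f x) (hm.toLp f x) =
        ∫ x in Ioo 0 Real.pi, ((‖f x‖ ^ 2 : ℝ) : ℂ) := by
      refine integral_congr_ae ?_
      filter_upwards [hm.coeFn_toLp] with x hx
      rw [hx, inner_self_eq_norm_sq_to_K]; push_cast; rfl
    rw [h3, integral_complex_ofReal] at h2
    exact_mod_cast h2.symm
  rw [h1]
  gcongr
  calc ∫ x in Ioo 0 Real.pi, ‖f x‖ ^ 2 ≤ ∫ x in Ioo 0 Real.pi, B ^ 2 := by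
        refine setIntegral_mono_on ?_ (by simp) measurableSet_Ioo fun x hx => ?_
        · exact ((hf.norm.pow 2).integrableOn_Icc (a := 0) (b := Real.pi)).mono_set
              Ioo_subset_Icc_self
        · exact pow_le_pow_left₀ (norm_nonneg _) (hfB x (Ioo_subset_Icc_self hx)) 2
    _ = _ := by simp [hπ.le]

section Smooth

variable {f f₁ f₂ : ℝ → ℂ}

lemma hasDerivAt_sin_mul (k : ℕ) (x : ℝ) :
    HasDerivAt (fun x : ℝ => (Real.sin (k * x) : ℂ)) ((k : ℂ) * (Real.cos (k * x) : ℂ)) x := by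
  have h : HasDerivAt (fun x : ℝ => Real.sin (k * x)) (Real.cos (k * x) * k) x :=
    ((Real.hasDerivAt_sin _).comp x ((hasDerivAt_id x).const_mul (k : ℝ))).congr_deriv (by simp)
  refine h.ofReal_comp.congr_deriv ?_
  push_cast; ring

lemma hasDerivAt_cos_mul (k : ℕ) (x : ℝ) :
    HasDerivAt (fun x : ℝ => (Real.cos (k * x) : ℂ)) (-((k : ℂ) * (Real.sin (k * x) : ℂ))) x := by
  have h : HasDerivAt (fun x : ℝ => Real.cos (k * x)) (-Real.sin (k * x) * k) x :=
    ((Real.hasDerivAt_cos _).comp x ((hasDerivAt_id x).const_mul (k : ℝ))).congr_deriv (by simp)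
  refine h.ofReal_comp.congr_deriv ?_
  push_cast; ring

/-- Integrating by parts twice: the sine coefficients of a second derivative. -/
lemma sineCoeff_deriv_deriv (h1 : ∀ x, HasDerivAt f (f₁ x) x) (h2 : ∀ x, HasDerivAt f₁ (f₂ x) x)
    (hc : Continuous f₂) (h0 : f 0 = 0) (hπ : f Real.pi = 0) (k : ℕ) :
    sineCoeff f₂ k = -((k : ℂ) ^ 2 * sineCoeff f k) := by
  have hf : Continuous f := continuous_iff_continuousAt.2 fun x => (h1 x).continuousAt
  have hf₁ : Continuous f₁ := continuous_iff_continuousAt.2 fun x => (h2 x).continuousAt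
  have e1 := intervalIntegral.integral_deriv_mul_eq_sub (a := 0) (b := Real.pi)
    (u := f₁) (v := fun x => (Real.sin (k * x) : ℂ))
    (fun x _ => h2 x) (fun x _ => hasDerivAt_sin_mul k x)
    (hc.intervalIntegrable _ _) (Continuous.intervalIntegrable (by fun_prop) _ _)
  have e2 := intervalIntegral.integral_deriv_mul_eq_sub (a := 0) (b := Real.pi)
    (u := f) (v := fun x => (Real.cos (k * x) : ℂ))
    (fun x _ => h1 x) (fun x _ => hasDerivAt_cos_mul k x)
    (hf₁.intervalIntegrable _ _) (Continuous.intervalIntegrable (by fun_prop) _ _)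
  rw [intervalIntegral.integral_add (Continuous.intervalIntegrable (by fun_prop) _ _)
    (Continuous.intervalIntegrable (by fun_prop) _ _)] at e1 e2
  simp only [h0, hπ, Real.sin_nat_mul_pi, mul_zero, Real.sin_zero, Complex.ofReal_zero, zero_mul,
    sub_self] at e1 e2
  have e3 : ∫ x in (0 : ℝ)..Real.pi, f₁ x * ((k : ℂ) * (Real.cos (k * x) : ℂ)) =
      k * ∫ x in (0 : ℝ)..Real.pi, f₁ x * (Real.cos (k * x) : ℂ) := by
    rw [← intervalIntegral.integral_const_mul]; congr 1; ext x; ring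
  have e4 : ∫ x in (0 : ℝ)..Real.pi, f x * -((k : ℂ) * (Real.sin (k * x) : ℂ)) =
      -(k * sineCoeff f k) := by
    rw [sineCoeff, ← intervalIntegral.integral_const_mul, ← intervalIntegral.integral_neg]
    congr 1; ext x; ring
  rw [e3] at e1
  rw [e4] at e2
  rw [sineCoeff]
  linear_combination e1 - k * e2

lemma norm_mul_sineCoeff_le (h1 : ∀ x, HasDerivAt f (f₁ x) x) (h2 : ∀ x, HasDerivAt f₁ (f₂ x) x)
    (hc : Continuous f₂) (h0 : f 0 = 0) (hπ : f Real.pi = 0) (k : ℕ) :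
    k * ‖sineCoeff f k‖ ≤ 1 / (k : ℝ) ^ 2 + ‖sineCoeff f₂ k‖ ^ 2 := by
  rcases Nat.eq_zero_or_pos k with rfl | hk
  · simp [sineCoeff_zero]
  have hk' : (0 : ℝ) < k := by exact_mod_cast hk
  have h := congrArg norm (sineCoeff_deriv_deriv h1 h2 hc h0 hπ k)
  rw [norm_neg, norm_mul, norm_pow, Complex.norm_natCast] at h
  have h3 : k * ‖sineCoeff f k‖ = 1 / k * ‖sineCoeff f₂ k‖ := by rw [h]; field_simp
  rw [h3, ← one_div_pow]
  nlinarith [sq_nonneg (1 / (k : ℝ) - ‖sineCoeff f₂ k‖), sq_nonneg (1 / (k : ℝ)),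
    sq_nonneg ‖sineCoeff f₂ k‖]

lemma sum_mul_sineCoeff_le (h1 : ∀ x, HasDerivAt f (f₁ x) x) (h2 : ∀ x, HasDerivAt f₁ (f₂ x) x)
    (hc : Continuous f₂) (h0 : f 0 = 0) (hπ : f Real.pi = 0) {B : ℝ}
    (hfB : ∀ x ∈ Icc 0 Real.pi, ‖f₂ x‖ ≤ B) (n : ℕ) :
    ∑ k ∈ Finset.range n, k * ‖sineCoeff f k‖ ≤
      (∑' k : ℕ, 1 / (k : ℝ) ^ 2) + Real.pi / 2 * (Real.pi * B ^ 2) := by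
  refine (Finset.sum_le_sum fun k _ => norm_mul_sineCoeff_le h1 h2 hc h0 hπ k).trans ?_
  rw [Finset.sum_add_distrib]
  exact add_le_add ((Real.summable_one_div_nat_pow.2 (by norm_num : 1 < 2)).sum_le_tsum _
    fun _ _ => by positivity) (bessel_sine_of_bound hc hfB n)

lemma summable_mul_sineCoeff (h1 : ∀ x, HasDerivAt f (f₁ x) x) (h2 : ∀ x, HasDerivAt f₁ (f₂ x) x)
    (hc : Continuous f₂) (h0 : f 0 = 0) (hπ : f Real.pi = 0) :
    Summable fun k : ℕ => k * ‖sineCoeff f k‖ := by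
  obtain ⟨B, hB⟩ := isCompact_Icc.exists_bound_of_continuousOn (s := Icc 0 Real.pi) hc.continuousOn
  exact summable_of_sum_range_le (fun _ => by positivity)
    (sum_mul_sineCoeff_le h1 h2 hc h0 hπ hB)

lemma summable_norm_sineCoeff (h1 : ∀ x, HasDerivAt f (f₁ x) x) (h2 : ∀ x, HasDerivAt f₁ (f₂ x) x)
    (hc : Continuous f₂) (h0 : f 0 = 0) (hπ : f Real.pi = 0) :
    Summable fun k : ℕ => ‖sineCoeff f k‖ := by
  refine Summable.of_nonneg_of_le (fun _ => norm_nonneg _) (fun k => ?_)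
    (summable_mul_sineCoeff h1 h2 hc h0 hπ)
  rcases Nat.eq_zero_or_pos k with rfl | hk
  · simp [sineCoeff_zero]
  · exact le_mul_of_one_le_left (norm_nonneg _) (by exact_mod_cast hk)

/-- The sine series of a `C²` function vanishing at both ends converges to it: this is the
Fourier series of its odd `2π`-periodic extension. The point `π` is left out because the extension
is written on `[-π, π)`. -/
lemma hasSum_sineSeries (h1 : ∀ x, HasDerivAt f (f₁ x) x) (h2 : ∀ x, HasDerivAt f₁ (f₂ x) x)
    (hc : Continuous f₂) (h0 : f 0 = 0) (hπ : f Real.pi = 0) {x : ℝ} (hx : x ∈ Ico 0 Real.pi) :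
    HasSum (fun k : ℕ => 2 / Real.pi * sineCoeff f k * (Real.sin (k * x) : ℂ)) (f x) := by
  have hπ0 := Real.pi_pos
  have hf : Continuous f := continuous_iff_continuousAt.2 fun x => (h1 x).continuousAt
  have : Fact (0 < 2 * Real.pi) := ⟨by positivity⟩
  set g : ℝ → ℂ := fun x => if 0 ≤ x then f x else -f (-x) with hg
  have hgc : Continuous g :=
    Continuous.if_le hf (hf.comp continuous_neg).neg continuous_const continuous_id
      fun x hx => by simp [← hx, h0]
  let F : C(AddCircle (2 * Real.pi), ℂ) :=
    ⟨AddCircle.liftIco (2 * Real.pi) (-Real.pi) g, AddCircle.liftIco_continuous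
      (by simp [hg, hπ0, hπ0.le, hπ, two_mul]) hgc.continuousOn⟩
  have hF : ∀ x ∈ Ico (-Real.pi) Real.pi, F x = g x := fun x hx =>
    AddCircle.liftIco_coe_apply (f := g) (a := -Real.pi) (p := 2 * Real.pi)
      (by rw [show -Real.pi + 2 * Real.pi = Real.pi by ring]; exact hx)
  have hcoef : ∀ n : ℤ, fourierCoeff F n = -(Complex.I / Real.pi) *
      ∫ x in (0 : ℝ)..Real.pi, f x * (Real.sin (n * x) : ℂ) := by
    intro n
    have e0 : fourierCoeff F n = (1 / (2 * Real.pi)) • ∫ x in (-Real.pi)..Real.pi,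
        Complex.exp (-(n * x * Complex.I)) * g x := by
      change fourierCoeff (AddCircle.liftIco (2 * Real.pi) (-Real.pi) g) n = _
      rw [fourierCoeff_liftIco_eq, fourierCoeffOn_eq_integral]
      rw [show -Real.pi + 2 * Real.pi = Real.pi by ring,
        show Real.pi - -Real.pi = 2 * Real.pi by ring]
      congr 2
      ext x
      rw [fourier_coe_apply, smul_eq_mul]
      congr 2
      have : (Real.pi : ℂ) ≠ 0 := by exact_mod_cast hπ0.ne'
      push_cast
      field_simp
    have hsplit := intervalIntegral.integral_add_adjacent_intervals (μ := volume)
      (f := fun x : ℝ => Complex.exp (-(n * x * Complex.I)) * g x)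
      (a := -Real.pi) (b := 0) (c := Real.pi)
      (Continuous.intervalIntegrable (by fun_prop) _ _)
      (Continuous.intervalIntegrable (by fun_prop) _ _)
    have e1 : ∫ x in (-Real.pi)..0, Complex.exp (-(n * x * Complex.I)) * g x =
        ∫ x in (0 : ℝ)..Real.pi, -(Complex.exp (n * x * Complex.I) * f x) := by
      have := intervalIntegral.integral_comp_neg (a := 0) (b := Real.pi)
        (fun x : ℝ => Complex.exp (-(n * x * Complex.I)) * g x)
      rw [neg_zero] at this
      rw [← this]
      refine intervalIntegral.integral_congr_ae ?_
      refine Eventually.of_forall fun x hx => ?_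
      rw [uIoc_of_le hπ0.le] at hx
      have : ¬ (0 ≤ -x) := by linarith [hx.1]
      simp [hg, this]
    have e2 : ∫ x in (0 : ℝ)..Real.pi, Complex.exp (-(n * x * Complex.I)) * g x =
        ∫ x in (0 : ℝ)..Real.pi, Complex.exp (-(n * x * Complex.I)) * f x := by
      refine intervalIntegral.integral_congr fun x hx => ?_
      rw [uIcc_of_le hπ0.le] at hx
      simp [hg, hx.1]
    rw [e0, ← hsplit, e1, e2, ← intervalIntegral.integral_add
      (Continuous.intervalIntegrable (by fun_prop) _ _)
      (Continuous.intervalIntegrable (by fun_prop) _ _)]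
    have e3 : ∀ x : ℝ,
        -(Complex.exp (n * x * Complex.I) * f x) + Complex.exp (-(n * x * Complex.I)) * f x
        = (-(2 * Complex.I)) * (f x * (Real.sin (n * x) : ℂ)) := by
      intro x
      have hz : -((n : ℂ) * x) * Complex.I = -(n * x * Complex.I) := by ring
      push_cast
      rw [Complex.sin, hz]
      have := Complex.I_sq
      linear_combination
        (f x * (Complex.exp (-(n * x * Complex.I)) - Complex.exp (n * x * Complex.I))) * this
    simp only [e3]
    rw [intervalIntegral.integral_const_mul, Complex.real_smul]
    push_cast
    have : (Real.pi : ℂ) ≠ 0 := by exact_mod_cast hπ0.ne'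
    field_simp
  have hcoefN : ∀ k : ℕ, fourierCoeff F k = -(Complex.I / Real.pi) * sineCoeff f k := fun k => by
    rw [hcoef]; simp [sineCoeff]
  have hcoefN' : ∀ k : ℕ, fourierCoeff F (-k) = (Complex.I / Real.pi) * sineCoeff f k := fun k => by
    rw [hcoef]
    simp only [Int.cast_neg, Int.cast_natCast, neg_mul, Real.sin_neg, Complex.ofReal_neg, mul_neg,
      intervalIntegral.integral_neg, neg_neg]
    rfl
  have hs := (summable_norm_sineCoeff h1 h2 hc h0 hπ).of_norm
  have hsum : Summable (fourierCoeff F) := by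
    refine Summable.of_nat_of_neg ?_ ?_
    · simp only [hcoefN]; exact hs.mul_left _
    · simp only [hcoefN']; exact hs.mul_left _
  have hF2 :=
      (has_pointwise_sum_fourier_series_of_summable hsum (x : AddCircle (2 * Real.pi))).nat_add_neg
  rw [hF x ⟨by linarith [hx.1], hx.2⟩] at hF2
  have hz : fourierCoeff F 0 = 0 := by
    have := hcoefN 0
    rwa [sineCoeff_zero, mul_zero] at this
  rw [hz, zero_smul, add_zero] at hF2
  have hgx : g x = f x := by simp [hg, hx.1]
  rw [hgx] at hF2
  refine hF2.congr_fun ?_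
  intro k
  rw [hcoefN, hcoefN', fourier_coe_apply, fourier_coe_apply]
  have hπc : (Real.pi : ℂ) ≠ 0 := by exact_mod_cast hπ0.ne'
  have a1 : 2 * (Real.pi : ℂ) * Complex.I * ((k : ℤ) : ℂ) * x / ((2 * Real.pi : ℝ) : ℂ) =
      (k * x) * Complex.I := by
    push_cast; field_simp
  have a2 : 2 * (Real.pi : ℂ) * Complex.I * ((-(k : ℤ) : ℤ) : ℂ) * x / ((2 * Real.pi : ℝ) : ℂ) =
      -(k * x) * Complex.I := by
    push_cast; field_simp
  rw [a1, a2]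
  push_cast
  rw [Complex.sin, smul_eq_mul, smul_eq_mul]
  field_simp
  ring

/-- The differentiated sine series at the end point `0`. -/
lemma hasSum_sineSeries_deriv (h1 : ∀ x, HasDerivAt f (f₁ x) x) (h2 : ∀ x, HasDerivAt f₁ (f₂ x) x)
    (hc : Continuous f₂) (h0 : f 0 = 0) (hπ : f Real.pi = 0) :
    HasSum (fun k : ℕ => 2 / Real.pi * k * sineCoeff f k) (f₁ 0) := by
  have hs := summable_mul_sineCoeff h1 h2 hc h0 hπ
  set d : ℕ → ℝ := fun k => 2 / Real.pi * (k * ‖sineCoeff f k‖)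
  have hd : Summable d := hs.mul_left _
  have hder := hasDerivAt_tsum (𝕜 := ℝ) (F := ℂ) (u := d)
    (g := fun k x => 2 / Real.pi * sineCoeff f k * (Real.sin (k * x) : ℂ))
    (g' := fun k x => 2 / Real.pi * sineCoeff f k * ((k : ℂ) * (Real.cos (k * x) : ℂ))) (y₀ := 0) hd
    (fun k x => (hasDerivAt_sin_mul k x).const_mul _) (fun k x => ?_) (by simp) 0
  · have heq : ∀ x ∈ Ico 0 Real.pi, f x =
        ∑' k : ℕ, 2 / Real.pi * sineCoeff f k * (Real.sin (k * x) : ℂ) := fun x hx =>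
      (hasSum_sineSeries h1 h2 hc h0 hπ hx).tsum_eq.symm
    have hw : HasDerivWithinAt f (f₁ 0) (Ico 0 Real.pi) 0 := (h1 0).hasDerivWithinAt
    have hw' := (hder.hasDerivWithinAt (s := Ico 0 Real.pi)).congr heq
      (heq 0 ⟨le_rfl, Real.pi_pos⟩)
    have hu : UniqueDiffWithinAt ℝ (Ico 0 Real.pi) 0 :=
      uniqueDiffOn_Ico 0 Real.pi 0 ⟨le_rfl, Real.pi_pos⟩
    have := hu.eq_deriv _ hw hw'
    rw [this]
    have hsum : Summable fun k : ℕ => 2 / Real.pi * k * sineCoeff f k := by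
      refine Summable.of_norm_bounded hd fun k => le_of_eq ?_
      simp only [d, norm_mul, norm_div, Complex.norm_real, Complex.norm_natCast, Complex.norm_ofNat]
      rw [Real.norm_of_nonneg Real.pi_pos.le]; ring
    convert hsum.hasSum using 1
    refine tsum_congr fun k => ?_
    simp
    ring
  · simp only [d, norm_mul, norm_div, Complex.norm_real, Complex.norm_natCast, Complex.norm_ofNat]
    rw [Real.norm_of_nonneg Real.pi_pos.le]
    have : ‖Real.cos (k * x)‖ ≤ 1 := Real.abs_cos_le_one _
    have h2 : 0 ≤ 2 / Real.pi * ‖sineCoeff f k‖ * k := by have := Real.pi_pos; positivity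
    nlinarith

end Smooth

/-! ### The ordinary differential equations of the Fourier modes -/

section Mode

variable {V : Type*} [NormedAddCommGroup V] [NormedSpace ℂ V]

/-- The solution of `z' = -k² z + A z + κ u b`, `z(0) = z₀`, given by Duhamel's formula. -/
noncomputable def modeSol (A : V →L[ℂ] V) (b : V) (k : ℕ) (z₀ : V) (κ : ℂ)
    (u : ℝ → ℂ) (t : ℝ) : V :=
  Complex.exp (-((k : ℂ) ^ 2 * t)) • flow A (-t)
    (z₀ + κ • ∫ s in (0 : ℝ)..t, (u s * Complex.exp ((k : ℂ) ^ 2 * s)) • flow A s b)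

variable {A : V →L[ℂ] V} {b : V} {k : ℕ} {z₀ : V} {κ : ℂ} {u : ℝ → ℂ}

lemma modeSol_zero : modeSol A b k z₀ κ u 0 = z₀ := by
  simp [modeSol, flow_zero]

/-- A control solving the moment equation brings its mode to rest. -/
lemma modeSol_eq_zero {T : ℝ} (hu : IsContinuousControl T u)
    (h : z₀ + κ • moment A b k u = 0) {t : ℝ} (ht : T ≤ t) (ht0 : 0 ≤ t) :
    modeSol A b k z₀ κ u t = 0 := by
  have e : ∫ s in (0 : ℝ)..t, (u s * Complex.exp ((k : ℂ) ^ 2 * s)) • flow A s b =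
      moment A b k u := by
    rw [intervalIntegral.integral_of_le ht0, ← integral_Icc_eq_integral_Ioc, moment]
    refine setIntegral_eq_integral_of_forall_compl_eq_zero fun s hs => ?_
    rw [hu.support s fun h' => hs ⟨h'.1, h'.2.trans ht⟩, zero_mul, zero_smul]
  rw [modeSol, e, h, map_zero, smul_zero]

variable [CompleteSpace V]

lemma hasDerivAt_modeSol (hu : Continuous u) (t : ℝ) :
    HasDerivAt (modeSol A b k z₀ κ u)
      (A (modeSol A b k z₀ κ u t) - (k : ℂ) ^ 2 • modeSol A b k z₀ κ u t + (κ * u t) • b) t := by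
  have hfl := continuous_flow A
  have hcont : Continuous fun s : ℝ => (u s * Complex.exp ((k : ℂ) ^ 2 * s)) • flow A s b := by
    fun_prop
  have e1 : HasDerivAt (fun t : ℝ => z₀ + κ • ∫ s in (0 : ℝ)..t,
      (u s * Complex.exp ((k : ℂ) ^ 2 * s)) • flow A s b)
      (κ • ((u t * Complex.exp ((k : ℂ) ^ 2 * t)) • flow A t b)) t :=
    ((intervalIntegral.integral_hasDerivAt_right (hcont.intervalIntegrable _ _)
      hcont.stronglyMeasurable.stronglyMeasurableAtFilter hcont.continuousAt).const_smul
        κ).const_add _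
  have e2 : HasDerivAt (fun t : ℝ => flow A (-t)) (A * flow A (-t)) t := by
    exact ((hasDerivAt_flow A (-t)).scomp t (hasDerivAt_neg t)).congr_deriv (by simp)
  have e3 : HasDerivAt (fun t : ℝ => Complex.exp (-((k : ℂ) ^ 2 * t)))
      (Complex.exp (-((k : ℂ) ^ 2 * t)) * (-((k : ℂ) ^ 2))) t := by
    have h1 : HasDerivAt (fun t : ℝ => -((k : ℂ) ^ 2 * (t : ℂ))) (-((k : ℂ) ^ 2)) t :=
      ((Complex.ofRealCLM.hasDerivAt (x := t)).const_mul ((k : ℂ) ^ 2)).neg.congr_deriv (by simp)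
    exact h1.cexp
  let R := ContinuousLinearMap.restrictScalarsL ℂ V V ℝ ℝ
  have e4 : HasDerivAt (fun t : ℝ => flow A (-t) (z₀ + κ • ∫ s in (0 : ℝ)..t,
      (u s * Complex.exp ((k : ℂ) ^ 2 * s)) • flow A s b)) _ t :=
    HasDerivAt.clm_apply ((R.restrictScalars ℝ).hasFDerivAt.comp_hasDerivAt t e2) e1
  refine (e3.smul e4).congr_deriv ?_
  set W := z₀ + κ • ∫ s in (0 : ℝ)..t, (u s * Complex.exp ((k : ℂ) ^ 2 * s)) • flow A s b
  have e5 : flow A (-t) (flow A t b) = b := by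
    rw [← mul_apply_eq_comp, flow_neg_mul, one_apply_eq_self]
  change Complex.exp (-((k : ℂ) ^ 2 * t)) • (A (flow A (-t) W) +
    flow A (-t) (κ • ((u t * Complex.exp ((k : ℂ) ^ 2 * t)) • flow A t b))) + _ • flow A (-t) W = _
  have e6 : Complex.exp (-((k : ℂ) ^ 2 * t)) * Complex.exp ((k : ℂ) ^ 2 * t) = 1 := by
    rw [← Complex.exp_add]; simp
  change _ = A (Complex.exp (-((k : ℂ) ^ 2 * t)) • flow A (-t) W) -
    (k : ℂ) ^ 2 • (Complex.exp (-((k : ℂ) ^ 2 * t)) • flow A (-t) W) + _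
  rw [map_smul, map_smul, e5, map_smul, smul_add, smul_smul, smul_smul, smul_smul]
  have e7 : Complex.exp (-((k : ℂ) ^ 2 * t)) * κ * (u t * Complex.exp ((k : ℂ) ^ 2 * t)) =
      κ * u t := by
    linear_combination κ * u t * e6
  rw [e7]
  module

lemma continuous_modeSol (hu : Continuous u) : Continuous (modeSol A b k z₀ κ u) :=
  continuous_iff_continuousAt.2 fun t => (hasDerivAt_modeSol hu t).continuousAt

variable [Nontrivial V]

/-- The response of the `k`-th mode to a bounded control carries the factor `1 / k²`, which makes up
for the factor `k` in the coupling constant `κ` of the boundary control. -/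
lemma norm_modeSol_le {T B : ℝ} (hB : ∀ t, ‖u t‖ ≤ B) (hk : 1 ≤ k) {t : ℝ}
    (ht : t ∈ Icc 0 T) :
    ‖modeSol A b k z₀ κ u t‖ ≤
      Real.exp (T * ‖A‖) * (‖z₀‖ + ‖κ‖ * (B * Real.exp (T * ‖A‖) * ‖b‖ / (k : ℝ) ^ 2)) := by
  have hk' : (0 : ℝ) < (k : ℝ) ^ 2 := by
    have : (0 : ℝ) < k := by exact_mod_cast hk
    positivity
  have hfl := continuous_flow A
  have hB0 : 0 ≤ B := (norm_nonneg _).trans (hB 0)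
  have hexp : ∀ s : ℝ, ‖Complex.exp ((k : ℂ) ^ 2 * s)‖ = Real.exp ((k : ℝ) ^ 2 * s) := fun s => by
    rw [Complex.norm_exp, ← Complex.ofReal_natCast, ← Complex.ofReal_pow, ← Complex.ofReal_mul,
      Complex.ofReal_re]
  have hfT : ∀ s ∈ Icc (0 : ℝ) T, Real.exp (|s| * ‖A‖) ≤ Real.exp (T * ‖A‖) := fun s hs => by
    rw [abs_of_nonneg hs.1]
    exact Real.exp_le_exp.2 (mul_le_mul_of_nonneg_right hs.2 (norm_nonneg _))
  set Q := B * Real.exp (T * ‖A‖) * ‖b‖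
  have hQ : 0 ≤ Q := by positivity
  have hI : ‖∫ s in (0 : ℝ)..t, (u s * Complex.exp ((k : ℂ) ^ 2 * s)) • flow A s b‖ ≤
      Q / (k : ℝ) ^ 2 * Real.exp ((k : ℝ) ^ 2 * t) := by
    have h1 : ‖∫ s in (0 : ℝ)..t, (u s * Complex.exp ((k : ℂ) ^ 2 * s)) • flow A s b‖ ≤
        ∫ s in (0 : ℝ)..t, Q * Real.exp ((k : ℝ) ^ 2 * s) := by
      refine intervalIntegral.norm_integral_le_of_norm_le ht.1 ?_
        (Continuous.intervalIntegrable (by fun_prop) _ _)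
      refine Eventually.of_forall fun s hs => ?_
      have hsT : s ∈ Icc (0 : ℝ) T := ⟨hs.1.le, hs.2.trans ht.2⟩
      have h2 : ‖flow A s b‖ ≤ Real.exp (T * ‖A‖) * ‖b‖ :=
        ((flow A s).le_opNorm b).trans (mul_le_mul_of_nonneg_right
          ((norm_flow_le A s).trans (hfT s hsT)) (norm_nonneg _))
      rw [norm_smul, norm_mul, hexp]
      calc _ ≤ B * Real.exp ((k : ℝ) ^ 2 * s) * (Real.exp (T * ‖A‖) * ‖b‖) := by
            gcongr
            exact hB s
        _ = _ := by simp only [Q]; ring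
    refine h1.trans ?_
    rw [intervalIntegral.integral_const_mul,
      intervalIntegral.integral_comp_mul_left (fun s => Real.exp s) hk'.ne', integral_exp, mul_zero,
      Real.exp_zero, smul_eq_mul, div_mul_eq_mul_div, ← mul_div_assoc', inv_mul_eq_div]
    gcongr
    linarith
  have hfl' : ‖flow A (-t)‖ ≤ Real.exp (T * ‖A‖) := by
    refine (norm_flow_le A (-t)).trans ?_
    rw [abs_neg]
    exact hfT t ht
  have he : ‖Complex.exp (-((k : ℂ) ^ 2 * t))‖ = (Real.exp ((k : ℝ) ^ 2 * t))⁻¹ := by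
    rw [Complex.exp_neg, norm_inv, hexp]
  have h1le : 1 ≤ Real.exp ((k : ℝ) ^ 2 * t) := Real.one_le_exp (mul_nonneg hk'.le ht.1)
  rw [modeSol, norm_smul, he]
  calc _ ≤ (Real.exp ((k : ℝ) ^ 2 * t))⁻¹ * (Real.exp (T * ‖A‖) *
        (‖z₀‖ * Real.exp ((k : ℝ) ^ 2 * t) +
          ‖κ‖ * (Q / (k : ℝ) ^ 2 * Real.exp ((k : ℝ) ^ 2 * t)))) := by
        gcongr
        refine ((flow A (-t)).le_opNorm _).trans
          (mul_le_mul hfl' ?_ (norm_nonneg _) (Real.exp_pos _).le)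
        refine (norm_add_le _ _).trans (add_le_add ?_ ?_)
        · exact le_mul_of_one_le_right (norm_nonneg _) h1le
        · rw [norm_smul]
          gcongr
    _ = _ := by
        have := Real.exp_pos ((k : ℝ) ^ 2 * t)
        field_simp

end Mode

/-! ### Integration by parts on rectangles -/

section Rectangle

/-- The partial derivative with respect to the first variable. -/
noncomputable def partialT (F : ℝ × ℝ → ℂ) (p : ℝ × ℝ) : ℂ := fderiv ℝ F p (1, 0)

/-- The partial derivative with respect to the second variable. -/
noncomputable def partialX (F : ℝ × ℝ → ℂ) (p : ℝ × ℝ) : ℂ := fderiv ℝ F p (0, 1)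

variable {F : ℝ × ℝ → ℂ}

lemma hasDerivAt_partialT (hF : ContDiff ℝ 1 F) (t x : ℝ) :
    HasDerivAt (fun s => F (s, x)) (partialT F (t, x)) t := by
  have h1 : HasDerivAt (fun s : ℝ => (s, x)) (1, 0) t :=
    (hasDerivAt_id t).prodMk (hasDerivAt_const t x)
  exact ((hF.differentiable (by norm_num)) (t, x)).hasFDerivAt.comp_hasDerivAt t h1

lemma hasDerivAt_partialX (hF : ContDiff ℝ 1 F) (t x : ℝ) :
    HasDerivAt (fun z => F (t, z)) (partialX F (t, x)) x := by
  have h1 : HasDerivAt (fun z : ℝ => (t, z)) (0, 1) x :=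
    (hasDerivAt_const x t).prodMk (hasDerivAt_id x)
  exact ((hF.differentiable (by norm_num)) (t, x)).hasFDerivAt.comp_hasDerivAt x h1

lemma continuous_partialT (hF : ContDiff ℝ 1 F) : Continuous (partialT F) :=
  (hF.continuous_fderiv (by norm_num)).clm_apply continuous_const

lemma continuous_partialX (hF : ContDiff ℝ 1 F) : Continuous (partialX F) :=
  (hF.continuous_fderiv (by norm_num)).clm_apply continuous_const

lemma contDiff_partialX (hF : ContDiff ℝ 2 F) : ContDiff ℝ 1 (partialX F) :=
  (hF.fderiv_right (by norm_num)).clm_apply contDiff_const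

lemma integrableOn_rectangle (hF : Continuous F) (T : ℝ) :
    IntegrableOn F (Ioo 0 T ×ˢ Ioo 0 Real.pi) :=
  (hF.continuousOn.integrableOn_compact (isCompact_Icc.prod isCompact_Icc)).mono_set
    (prod_mono Ioo_subset_Icc_self Ioo_subset_Icc_self)

lemma integral_rectangle (hF : Continuous F) {T : ℝ} (hT : 0 ≤ T) :
    ∫ p in Ioo 0 T ×ˢ Ioo 0 Real.pi, F p =
      ∫ t in (0 : ℝ)..T, ∫ x in (0 : ℝ)..Real.pi, F (t, x) := by
  rw [Measure.volume_eq_prod, setIntegral_prod _ (integrableOn_rectangle hF T),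
    intervalIntegral.integral_of_le hT, integral_Ioc_eq_integral_Ioo]
  refine setIntegral_congr_fun measurableSet_Ioo fun t _ => ?_
  rw [intervalIntegral.integral_of_le Real.pi_pos.le, integral_Ioc_eq_integral_Ioo]

lemma integral_rectangle_swap (hF : Continuous F) {T : ℝ} (hT : 0 ≤ T) :
    ∫ p in Ioo 0 T ×ˢ Ioo 0 Real.pi, F p =
      ∫ x in (0 : ℝ)..Real.pi, ∫ t in (0 : ℝ)..T, F (t, x) := by
  have hi := integrableOn_rectangle hF T
  rw [Measure.volume_eq_prod, setIntegral_prod _ hi,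
    intervalIntegral.integral_of_le Real.pi_pos.le, integral_Ioc_eq_integral_Ioo]
  rw [IntegrableOn, Measure.volume_eq_prod, ← Measure.prod_restrict] at hi
  rw [integral_integral_swap (f := fun t x => F (t, x)) hi]
  refine setIntegral_congr_fun measurableSet_Ioo fun t _ => ?_
  rw [intervalIntegral.integral_of_le hT, integral_Ioc_eq_integral_Ioo]

lemma continuous_sineCoeff (hF : Continuous F) (k : ℕ) :
    Continuous fun t => sineCoeff (fun x => F (t, x)) k := by
  unfold sineCoeff
  exact intervalIntegral.continuous_parametric_intervalIntegral_of_continuous' (by fun_prop) _ _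

variable {m m' : ℝ → ℂ} {T : ℝ}

lemma integral_rectangle_mul_sin (hm : Continuous m) (hF : Continuous F) (hT : 0 ≤ T) (k : ℕ) :
    ∫ p in Ioo 0 T ×ˢ Ioo 0 Real.pi, m p.1 * (Real.sin (k * p.2) : ℂ) * F p =
      ∫ t in (0 : ℝ)..T, m t * sineCoeff (fun x => F (t, x)) k := by
  rw [integral_rectangle (by fun_prop) hT]
  refine intervalIntegral.integral_congr fun t _ => ?_
  rw [sineCoeff, ← intervalIntegral.integral_const_mul]
  refine intervalIntegral.integral_congr fun x _ => ?_
  dsimp only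
  ring

/-- The transposition identity tested against a single separated mode `m(t) sin (k x)`. -/
lemma integral_rectangle_heat (hm : ∀ t, HasDerivAt m (m' t) t) (hm' : Continuous m')
    (hF : ContDiff ℝ 2 F) (hT : 0 ≤ T) (h0 : ∀ t ∈ Icc 0 T, F (t, 0) = 0)
    (hπ : ∀ t ∈ Icc 0 T, F (t, Real.pi) = 0) (hfin : ∀ x ∈ Icc 0 Real.pi, F (T, x) = 0) (k : ℕ) :
    ∫ p in Ioo 0 T ×ˢ Ioo 0 Real.pi, m p.1 * (Real.sin (k * p.2) : ℂ) *
        (-partialT F p - partialX (partialX F) p) =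
      m 0 * sineCoeff (fun x => F (0, x)) k +
        ∫ t in (0 : ℝ)..T, (m' t + (k : ℂ) ^ 2 * m t) * sineCoeff (fun x => F (t, x)) k := by
  have hF1 : ContDiff ℝ 1 F := hF.of_le (by norm_num)
  have hFc := hF.continuous
  have hmc : Continuous m := continuous_iff_continuousAt.2 fun t => (hm t).continuousAt
  have hX := contDiff_partialX hF
  have cT := continuous_partialT hF1
  have cXX := continuous_partialX hX
  have hsc := continuous_sineCoeff hFc k
  have e1 : ∀ p : ℝ × ℝ,
      m p.1 * (Real.sin (k * p.2) : ℂ) * (-partialT F p - partialX (partialX F) p) =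
      -(m p.1 * (Real.sin (k * p.2) : ℂ) * partialT F p) -
        m p.1 * (Real.sin (k * p.2) : ℂ) * partialX (partialX F) p := fun p => by ring
  simp only [e1]
  rw [integral_sub (integrableOn_rectangle (by fun_prop) T)
    (integrableOn_rectangle (by fun_prop) T),
    integral_neg, integral_rectangle_mul_sin hmc cXX hT]
  have e2 : ∫ t in (0 : ℝ)..T, m t * sineCoeff (fun x => partialX (partialX F) (t, x)) k =
      -∫ t in (0 : ℝ)..T, (k : ℂ) ^ 2 * m t * sineCoeff (fun x => F (t, x)) k := by
    rw [← intervalIntegral.integral_neg]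
    refine intervalIntegral.integral_congr fun t ht => ?_
    rw [uIcc_of_le hT] at ht
    rw [sineCoeff_deriv_deriv (fun x => hasDerivAt_partialX hF1 t x)
      (fun x => hasDerivAt_partialX hX t x) (by fun_prop) (h0 t ht) (hπ t ht)]
    ring
  have e3 : ∫ p in Ioo 0 T ×ˢ Ioo 0 Real.pi, m p.1 * (Real.sin (k * p.2) : ℂ) * partialT F p =
      -(m 0 * sineCoeff (fun x => F (0, x)) k) -
        ∫ t in (0 : ℝ)..T, m' t * sineCoeff (fun x => F (t, x)) k := by
    rw [integral_rectangle_swap (by fun_prop) hT, ← integral_rectangle_mul_sin hm' hFc hT,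
      integral_rectangle_swap (by fun_prop) hT, sineCoeff, ← intervalIntegral.integral_const_mul,
      ← intervalIntegral.integral_neg, ← intervalIntegral.integral_sub]
    · refine intervalIntegral.integral_congr fun x hx => ?_
      rw [uIcc_of_le Real.pi_pos.le] at hx
      have := intervalIntegral.integral_mul_deriv_eq_deriv_mul (a := 0) (b := T) (u := m)
        (v := fun t => F (t, x)) (fun t _ => hm t) (fun t _ => hasDerivAt_partialT hF1 t x)
        (hm'.intervalIntegrable _ _) (Continuous.intervalIntegrable (by fun_prop) _ _)
      rw [hfin x hx] at this
      have a1 : ∀ t : ℝ, m t * (Real.sin (k * x) : ℂ) * partialT F (t, x) =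
          (Real.sin (k * x) : ℂ) * (m t * partialT F (t, x)) := fun t => by ring
      have a2 : ∀ t : ℝ, m' t * (Real.sin (k * x) : ℂ) * F (t, x) =
          (Real.sin (k * x) : ℂ) * (m' t * F (t, x)) := fun t => by ring
      simp only [a1, a2]
      rw [intervalIntegral.integral_const_mul, intervalIntegral.integral_const_mul, this]
      ring
    · exact Continuous.intervalIntegrable (by fun_prop) _ _
    · exact (intervalIntegral.continuous_parametric_intervalIntegral_of_continuous'
        (by fun_prop) _ _).intervalIntegrable _ _
  rw [e2, e3]
  have e4 : ∀ t : ℝ, (m' t + (k : ℂ) ^ 2 * m t) * sineCoeff (fun x => F (t, x)) k =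
      m' t * sineCoeff (fun x => F (t, x)) k +
        (k : ℂ) ^ 2 * m t * sineCoeff (fun x => F (t, x)) k :=
    fun t => by ring
  simp only [e4]
  rw [intervalIntegral.integral_add (Continuous.intervalIntegrable (by fun_prop) _ _)
    (Continuous.intervalIntegrable (by fun_prop) _ _)]
  ring

end Rectangle

/-! ### Solutions by transposition -/

/-- Superposition of modes: functions `q_k(t) sin (k x)` are orthogonal in `L²` of a rectangle, so
that their sum converges as soon as the squares of their amplitudes are summable. -/
lemma exists_superposition {T : ℝ} {q : ℕ → ℝ → ℂ} (hq : ∀ k, Continuous (q k)) {M : ℕ → ℝ}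
    (hM : ∀ k, ∀ t ∈ Icc 0 T, 1 ≤ k → ‖q k t‖ ≤ M k) (hM0 : ∀ k, 0 ≤ M k)
    (hMs : Summable fun k => M k ^ 2) :
    ∃ Y : ℝ × ℝ → ℂ, MemLp Y 2 (volume.restrict (Ioo 0 T ×ˢ Ioo 0 Real.pi)) ∧
      ∀ G : ℝ × ℝ → ℂ, MemLp G 2 (volume.restrict (Ioo 0 T ×ˢ Ioo 0 Real.pi)) →
        HasSum (fun k => ∫ p in Ioo 0 T ×ˢ Ioo 0 Real.pi,
            q k p.1 * (Real.sin (k * p.2) : ℂ) * G p)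
          (∫ p in Ioo 0 T ×ˢ Ioo 0 Real.pi, Y p * G p) := by
  set Q := Ioo 0 T ×ˢ Ioo 0 Real.pi
  have hQ : MeasurableSet Q := measurableSet_Ioo.prod measurableSet_Ioo
  have hfin : IsFiniteMeasure ((volume : Measure (ℝ × ℝ)).restrict Q) := by
    refine ⟨?_⟩
    rw [Measure.restrict_apply_univ, Measure.volume_eq_prod, Measure.prod_prod]
    exact ENNReal.mul_lt_top measure_Ioo_lt_top measure_Ioo_lt_top
  set F : ℕ → ℝ × ℝ → ℂ := fun k p => q k p.1 * (Real.sin (k * p.2) : ℂ) with hF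
  have hFc : ∀ k, Continuous (F k) := fun k => by
    have := hq k
    fun_prop
  have hFb : ∀ k, ∀ᵐ p ∂(volume.restrict Q), ‖F k p‖ ≤ M k := fun k => by
    refine (ae_restrict_iff' hQ).2 (Eventually.of_forall fun p hp => ?_)
    rcases Nat.eq_zero_or_pos k with rfl | hk
    · simpa [hF] using hM0 0
    rw [hF]
    dsimp only
    rw [norm_mul, Complex.norm_real]
    calc _ ≤ M k * 1 := mul_le_mul (hM k _ (Ioo_subset_Icc_self hp.1) hk) (Real.abs_sin_le_one _)
          (abs_nonneg _) (hM0 k)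
      _ = M k := mul_one _
  have hFm : ∀ k, MemLp (F k) 2 (volume.restrict Q) := fun k =>
    MemLp.of_bound (hFc k).aestronglyMeasurable (M k) (hFb k)
  set f : ℕ → Lp ℂ 2 ((volume : Measure (ℝ × ℝ)).restrict Q) := fun k => (hFm k).toLp (F k)
  have hfn : ∀ k, ‖f k‖ ≤ measureUnivNNReal ((volume : Measure (ℝ × ℝ)).restrict Q) ^
      (2 : ENNReal).toReal⁻¹ * M k := fun k => by
    refine Lp.norm_le_of_ae_bound (hM0 k) ?_
    filter_upwards [(hFm k).coeFn_toLp, hFb k] with p hp hp'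
    rwa [hp]
  have horth : ∀ j k, j ≠ k → inner ℂ (f j) (f k) = 0 := by
    intro j k hjk
    have e1 : inner ℂ (f j) (f k) = ∫ p in Q, (q k p.1 * star (q j p.1)) *
        ((Real.sin (j * p.2) * Real.sin (k * p.2) : ℝ) : ℂ) := by
      rw [L2.inner_def]
      refine integral_congr_ae ?_
      filter_upwards [(hFm j).coeFn_toLp, (hFm k).coeFn_toLp] with p hp hp'
      rw [hp, hp', RCLike.inner_apply, hF]
      simp only [map_mul, Complex.conj_ofReal, Complex.star_def, Complex.ofReal_mul]
      ring
    have e2 : ∫ x in Ioo 0 Real.pi, ((Real.sin (j * x) * Real.sin (k * x) : ℝ) : ℂ) = 0 := by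
      rw [integral_complex_ofReal, ← integral_Ioc_eq_integral_Ioo,
        ← intervalIntegral.integral_of_le Real.pi_pos.le]
      rcases Nat.eq_zero_or_pos j with rfl | hj
      · simp
      · rw [integral_sin_mul_sin hj, if_neg hjk, Complex.ofReal_zero]
    rw [e1, Measure.volume_eq_prod, ← Measure.prod_restrict]
    rw [integral_prod_mul (fun t => q k t * star (q j t))
      (fun x => ((Real.sin (j * x) * Real.sin (k * x) : ℝ) : ℂ)), e2, mul_zero]
  have hfam : OrthogonalFamily ℂ (fun k => ↥(Submodule.span ℂ {f k}))
      fun k => (Submodule.span ℂ {f k}).subtypeₗᵢ := by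
    refine OrthogonalFamily.of_pairwise fun j k hjk => ?_
    rw [Function.onFun, Submodule.isOrtho_span]
    rintro x rfl y rfl
    exact horth j k hjk
  have hsum : Summable f := by
    refine (hfam.summable_iff_norm_sq_summable
      (fun k => ⟨f k, Submodule.mem_span_singleton_self _⟩)).2 ?_
    refine Summable.of_nonneg_of_le (fun _ => by positivity) (fun k => ?_) (hMs.mul_left
      ((measureUnivNNReal ((volume : Measure (ℝ × ℝ)).restrict Q) ^
        (2 : ENNReal).toReal⁻¹ : ℝ) ^ 2))
    rw [← mul_pow]
    exact pow_le_pow_left₀ (norm_nonneg _) (by simpa using hfn k) 2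
  refine ⟨((∑' k, f k : Lp ℂ 2 ((volume : Measure (ℝ × ℝ)).restrict Q)) : ℝ × ℝ → ℂ), Lp.memLp _,
    fun G hG => ?_⟩
  have hG' : MemLp (fun p => star (G p)) 2 (volume.restrict Q) := hG.star
  have hin := hsum.hasSum.mapL (innerSL ℂ (hG'.toLp _))
  have hinner : ∀ (h : Lp ℂ 2 ((volume : Measure (ℝ × ℝ)).restrict Q)),
      innerSL ℂ (hG'.toLp _) h = ∫ p in Q, h p * G p := by
    intro h
    rw [innerSL_apply_apply, L2.inner_def]
    refine integral_congr_ae ?_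
    filter_upwards [hG'.coeFn_toLp] with p hp
    rw [hp, RCLike.inner_apply]
    simp
  rw [hinner] at hin
  refine hin.congr_fun fun k => ?_
  rw [hinner]
  refine integral_congr_ae ?_
  filter_upwards [(hFm k).coeFn_toLp] with p hp
  rw [hp]

/-- Parseval's identity for an integrable function and a `C²` function vanishing at both ends. -/
lemma hasSum_integral_sineCoeff {g f f₁ f₂ : ℝ → ℂ} (hg : IntegrableOn g (Ioo 0 Real.pi))
    (h1 : ∀ x, HasDerivAt f (f₁ x) x) (h2 : ∀ x, HasDerivAt f₁ (f₂ x) x)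
    (hc : Continuous f₂) (h0 : f 0 = 0) (hπ : f Real.pi = 0) :
    HasSum (fun k => 2 / Real.pi * sineCoeff g k * sineCoeff f k)
      (∫ x in Ioo 0 Real.pi, g x * f x) := by
  have hint : ∀ k : ℕ, IntegrableOn (fun x => 2 / Real.pi * sineCoeff f k *
      (g x * (Real.sin (k * x) : ℂ))) (Ioo 0 Real.pi) := fun k => by
    refine Integrable.const_mul ?_ _
    refine hg.mul_bdd (c := 1) (Continuous.aestronglyMeasurable (by fun_prop))
      (Eventually.of_forall fun x => ?_)
    rw [Complex.norm_real]
    exact Real.abs_sin_le_one _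
  have hle : ∀ k : ℕ, ∫ x in Ioo 0 Real.pi, ‖2 / Real.pi * sineCoeff f k *
      (g x * (Real.sin (k * x) : ℂ))‖ ≤
      ‖sineCoeff f k‖ * (2 / Real.pi * ∫ x in Ioo 0 Real.pi, ‖g x‖) := fun k => by
    rw [← integral_const_mul, ← integral_const_mul]
    refine integral_mono (hint k).norm ((hg.norm.const_mul _).const_mul _) fun x => ?_
    dsimp only
    rw [norm_mul, norm_mul, norm_mul, norm_div, Complex.norm_real, Complex.norm_ofNat,
      Complex.norm_real, Real.norm_of_nonneg Real.pi_pos.le]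
    have : ‖Real.sin (k * x)‖ ≤ 1 := Real.abs_sin_le_one _
    have h3 : 0 ≤ 2 / Real.pi * ‖sineCoeff f k‖ * ‖g x‖ := by have := Real.pi_pos; positivity
    nlinarith
  have hs := hasSum_integral_of_summable_integral_norm hint
    (Summable.of_nonneg_of_le (fun k => integral_nonneg fun x => norm_nonneg _) hle
      ((summable_norm_sineCoeff h1 h2 hc h0 hπ).mul_right _))
  have e1 : (fun k => 2 / Real.pi * sineCoeff g k * sineCoeff f k) = fun k : ℕ =>
      ∫ x in Ioo 0 Real.pi, 2 / Real.pi * sineCoeff f k * (g x * (Real.sin (k * x) : ℂ)) := by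
    funext k
    rw [integral_const_mul, sineCoeff_eq_setIntegral g]
    ring
  have e2 : ∫ x in Ioo 0 Real.pi, g x * f x = ∫ x in Ioo 0 Real.pi,
      ∑' k : ℕ, 2 / Real.pi * sineCoeff f k * (g x * (Real.sin (k * x) : ℂ)) := by
    refine setIntegral_congr_fun measurableSet_Ioo fun x hx => ?_
    have h3 := ((hasSum_sineSeries h1 h2 hc h0 hπ ⟨hx.1.le, hx.2⟩).mul_left (g x)).tsum_eq
    rw [← h3]
    refine tsum_congr fun k => ?_
    ring
  rw [e1, e2]
  exact hs

/-- The boundary term of the transposition identity is the limit of the contributions of the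
modes. -/
lemma tendsto_integral_sineCoeff_deriv {F : ℝ × ℝ → ℂ} {u : ℝ → ℂ} {T : ℝ} (hF : ContDiff ℝ 2 F)
    (hu : Continuous u) (hT : 0 ≤ T) (h0 : ∀ t ∈ Icc 0 T, F (t, 0) = 0)
    (hπ : ∀ t ∈ Icc 0 T, F (t, Real.pi) = 0) :
    Tendsto (fun n => ∑ k ∈ Finset.range n, 2 / Real.pi * (k : ℂ) *
        ∫ t in (0 : ℝ)..T, u t * sineCoeff (fun x => F (t, x)) k) atTop
      (𝓝 (∫ t in (0 : ℝ)..T, u t * partialX F (t, 0))) := by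
  have hF1 : ContDiff ℝ 1 F := hF.of_le (by norm_num)
  have hX := contDiff_partialX hF
  have cXX := continuous_partialX hX
  have hsc := continuous_sineCoeff hF.continuous
  obtain ⟨B, hB⟩ := (isCompact_Icc.prod isCompact_Icc).exists_bound_of_continuousOn
    (s := Icc 0 T ×ˢ Icc 0 Real.pi) cXX.continuousOn
  set K := 2 / Real.pi * ((∑' k : ℕ, 1 / (k : ℝ) ^ 2) + Real.pi / 2 * (Real.pi * B ^ 2))
  have hlim : Tendsto (fun n => ∫ t in (0 : ℝ)..T, u t * ∑ k ∈ Finset.range n,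
      2 / Real.pi * (k : ℂ) * sineCoeff (fun x => F (t, x)) k) atTop
      (𝓝 (∫ t in (0 : ℝ)..T, u t * partialX F (t, 0))) := by
    refine intervalIntegral.tendsto_integral_filter_of_dominated_convergence (fun t => ‖u t‖ * K)
      (Eventually.of_forall fun n => Continuous.aestronglyMeasurable (by fun_prop))
      (Eventually.of_forall fun n => Eventually.of_forall fun t ht => ?_)
      (Continuous.intervalIntegrable (by fun_prop) _ _) (Eventually.of_forall fun t ht => ?_)
    · rw [uIoc_of_le hT] at ht
      have ht' : t ∈ Icc 0 T := ⟨ht.1.le, ht.2⟩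
      rw [norm_mul]
      refine mul_le_mul_of_nonneg_left ?_ (norm_nonneg _)
      refine (norm_sum_le _ _).trans ?_
      have h3 := sum_mul_sineCoeff_le (fun x => hasDerivAt_partialX hF1 t x)
        (fun x => hasDerivAt_partialX hX t x) (by fun_prop) (h0 t ht') (hπ t ht')
        (fun x hx => hB (t, x) ⟨ht', hx⟩) n
      have h4 : ∀ k : ℕ, ‖2 / Real.pi * (k : ℂ) * sineCoeff (fun x => F (t, x)) k‖ =
          2 / Real.pi * (k * ‖sineCoeff (fun x => F (t, x)) k‖) := fun k => by
        simp only [norm_mul, norm_div, Complex.norm_real, Complex.norm_natCast, Complex.norm_ofNat]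
        rw [Real.norm_of_nonneg Real.pi_pos.le, mul_assoc]
      simp only [h4]
      rw [← Finset.mul_sum]
      exact mul_le_mul_of_nonneg_left h3 (by have := Real.pi_pos; positivity)
    · rw [uIoc_of_le hT] at ht
      have ht' : t ∈ Icc 0 T := ⟨ht.1.le, ht.2⟩
      exact ((hasSum_sineSeries_deriv (fun x => hasDerivAt_partialX hF1 t x)
        (fun x => hasDerivAt_partialX hX t x) (by fun_prop) (h0 t ht')
          (hπ t ht')).tendsto_sum_nat).const_mul _
  refine hlim.congr fun n => ?_
  simp only [Finset.mul_sum]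
  rw [intervalIntegral.integral_finsetSum
    fun k _ => Continuous.intervalIntegrable (by fun_prop) _ _]
  refine Finset.sum_congr rfl fun k _ => ?_
  rw [← intervalIntegral.integral_const_mul]
  congr 1; ext t; ring

/-- The matrix `A₀` acting on `ℂ²`, which carries the sup norm here. -/
noncomputable def opA (A₀ : Matrix (Fin 2) (Fin 2) ℝ) : (Fin 2 → ℂ) →L[ℂ] (Fin 2 → ℂ) :=
  (complexify A₀).mulVecLin.toContinuousLinearMap

section Test

variable {A₀ : Matrix (Fin 2) (Fin 2) ℝ} {T : ℝ} {φ : ℝ → ℝ → Fin 2 → ℂ}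

lemma contDiff_component (hφ : ContDiff ℝ 2 fun p : ℝ × ℝ => φ p.1 p.2) (i : Fin 2) :
    ContDiff ℝ 2 fun p : ℝ × ℝ => φ p.1 p.2 i := contDiff_pi.1 hφ i

lemma adjointSource_apply (hφ : ContDiff ℝ 2 fun p : ℝ × ℝ => φ p.1 p.2) (t x : ℝ) (i : Fin 2) :
    adjointSource A₀ φ t x i = -partialT (fun p => φ p.1 p.2 i) (t, x) -
      partialX (partialX fun p => φ p.1 p.2 i) (t, x) -
      ∑ j, complexify A₀ j i * φ t x j := by
  have hi := contDiff_component hφ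
  have hi1 : ∀ i, ContDiff ℝ 1 fun p : ℝ × ℝ => φ p.1 p.2 i := fun i => (hi i).of_le (by norm_num)
  have e1 : deriv (fun s => φ s x) t = fun i => partialT (fun p => φ p.1 p.2 i) (t, x) :=
    (hasDerivAt_pi.2 fun i => hasDerivAt_partialT (hi1 i) t x).deriv
  have e2 : deriv (fun z => φ t z) = fun z i => partialX (fun p => φ p.1 p.2 i) (t, z) := by
    ext1 z
    exact (hasDerivAt_pi.2 fun i => hasDerivAt_partialX (hi1 i) t z).deriv
  have e3 : iteratedDeriv 2 (fun z => φ t z) x =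
      fun i => partialX (partialX fun p => φ p.1 p.2 i) (t, x) := by
    rw [iteratedDeriv_succ, iteratedDeriv_one, e2]
    exact (hasDerivAt_pi.2 fun i => hasDerivAt_partialX (contDiff_partialX (hi i)) t x).deriv
  rw [adjointSource, e1, e3]
  rfl

lemma deriv_test (hφ : ContDiff ℝ 2 fun p : ℝ × ℝ => φ p.1 p.2) (t x : ℝ) :
    deriv (fun z => φ t z) x = fun i => partialX (fun p => φ p.1 p.2 i) (t, x) :=
  (hasDerivAt_pi.2 fun i =>
    hasDerivAt_partialX ((contDiff_component hφ i).of_le (by norm_num)) t x).deriv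

lemma continuous_adjointSource (hφ : ContDiff ℝ 2 fun p : ℝ × ℝ => φ p.1 p.2) (i : Fin 2) :
    Continuous fun p : ℝ × ℝ => adjointSource A₀ φ p.1 p.2 i := by
  have hi := contDiff_component hφ
  have hi1 : ∀ i, ContDiff ℝ 1 fun p : ℝ × ℝ => φ p.1 p.2 i := fun i => (hi i).of_le (by norm_num)
  simp only [adjointSource_apply hφ]
  have h1 := continuous_partialT (hi1 i)
  have h2 := continuous_partialX (contDiff_partialX (hi i))
  have h3 := fun i => (hi i).continuous
  simp only [Prod.mk.eta]
  fun_prop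

/-- The transposition identity holds for each Fourier mode. -/
lemma sum_integral_mode {u : ℝ → ℂ} (hu : Continuous u) (hT : 0 < T) (hφ : IsTest T φ)
    (b z₀ : Fin 2 → ℂ) (κ : ℂ) (k : ℕ) :
    ∑ i, ∫ p in Ioo 0 T ×ˢ Ioo 0 Real.pi, modeSol (opA A₀) b k z₀ κ u p.1 i *
        (Real.sin (k * p.2) : ℂ) * adjointSource A₀ φ p.1 p.2 i =
      ∑ i, z₀ i * sineCoeff (fun x => φ 0 x i) k +
        ∑ i, b i * (κ * ∫ t in (0 : ℝ)..T, u t * sineCoeff (fun x => φ t x i) k) := by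
  have hi := contDiff_component hφ.contDiff
  set m := modeSol (opA A₀) b k z₀ κ u with hm
  have hmc : Continuous m := continuous_modeSol hu
  have hmi : ∀ i, Continuous fun t => m t i := fun i => (continuous_apply i).comp hmc
  have hsc : ∀ i, Continuous fun t => sineCoeff (fun x => φ t x i) k := fun i =>
    continuous_sineCoeff (hi i).continuous k
  have hder : ∀ i t, HasDerivAt (fun t => m t i)
      (∑ j, complexify A₀ i j * m t j - (k : ℂ) ^ 2 * m t i + κ * u t * b i) t := fun i t => by
    exact hasDerivAt_pi.1
      (hasDerivAt_modeSol (A := opA A₀) (b := b) (k := k) (z₀ := z₀) (κ := κ) hu t) i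
  have e1 : ∀ i, ∫ p in Ioo 0 T ×ˢ Ioo 0 Real.pi, m p.1 i *
        (Real.sin (k * p.2) : ℂ) * adjointSource A₀ φ p.1 p.2 i =
      (z₀ i * sineCoeff (fun x => φ 0 x i) k +
        b i * (κ * ∫ t in (0 : ℝ)..T, u t * sineCoeff (fun x => φ t x i) k)) +
        (∑ j, complexify A₀ i j * ∫ t in (0 : ℝ)..T, m t j * sineCoeff (fun x => φ t x i) k) -
        ∑ j, complexify A₀ j i * ∫ t in (0 : ℝ)..T, m t i * sineCoeff (fun x => φ t x j) k := by
    intro i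
    have hheat := integral_rectangle_heat (F := fun p => φ p.1 p.2 i) (hder i)
      (by fun_prop) (hi i) hT.le (fun t ht => congrFun (hφ.left t ht) i)
      (fun t ht => congrFun (hφ.right t ht) i) (fun x hx => congrFun (hφ.final x hx) i) k
    have h1 : ∀ p : ℝ × ℝ, m p.1 i * (Real.sin (k * p.2) : ℂ) * adjointSource A₀ φ p.1 p.2 i =
        m p.1 i * (Real.sin (k * p.2) : ℂ) * (-partialT (fun p => φ p.1 p.2 i) p -
          partialX (partialX fun p => φ p.1 p.2 i) p) -
        ∑ j, complexify A₀ j i * (m p.1 i * (Real.sin (k * p.2) : ℂ) * φ p.1 p.2 j) := fun p => by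
      rw [adjointSource_apply hφ.contDiff, mul_sub, Finset.mul_sum]
      congr 1
      exact Finset.sum_congr rfl fun j _ => by ring
    have c1 := continuous_partialT ((hi i).of_le (by norm_num : (1 : WithTop ℕ∞) ≤ 2))
    have c2 := continuous_partialX (contDiff_partialX (hi i))
    have c3 := fun i => (hi i).continuous
    simp only [h1]
    rw [integral_sub (integrableOn_rectangle (by fun_prop) T)
      (integrableOn_rectangle (by fun_prop) T),
      hheat, integral_finsetSum _ fun j _ => integrableOn_rectangle (by fun_prop) T]
    simp only [integral_const_mul]
    congr 1
    · have h2 : ∀ t : ℝ, (∑ j, complexify A₀ i j * m t j - (k : ℂ) ^ 2 * m t i + κ * u t * b i +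
          (k : ℂ) ^ 2 * m t i) * sineCoeff (fun x => φ t x i) k =
          b i * (κ * (u t * sineCoeff (fun x => φ t x i) k)) +
          ∑ j, complexify A₀ i j * (m t j * sineCoeff (fun x => φ t x i) k) := fun t => by
        simp only [← mul_assoc]
        rw [← Finset.sum_mul]
        ring
      simp only [h2]
      rw [intervalIntegral.integral_add (Continuous.intervalIntegrable (by fun_prop) _ _)
        (Continuous.intervalIntegrable (by fun_prop) _ _),
        intervalIntegral.integral_finsetSum
          fun j _ => Continuous.intervalIntegrable (by fun_prop) _ _]
      simp only [intervalIntegral.integral_const_mul]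
      have : m 0 = z₀ := modeSol_zero
      rw [this]
      ring
    · refine Finset.sum_congr rfl fun j _ => ?_
      rw [← integral_rectangle_mul_sin (hmi i) (c3 j) hT.le]
  rw [Finset.sum_congr rfl fun i _ => e1 i, Finset.sum_sub_distrib, Finset.sum_add_distrib,
    Finset.sum_add_distrib]
  rw [Finset.sum_comm (f := fun i j => complexify A₀ j i *
    ∫ t in (0 : ℝ)..T, m t i * sineCoeff (fun x => φ t x j) k)]
  ring

end Test

section Steering

variable {A₀ : Matrix (Fin 2) (Fin 2) ℝ} {T₀ : ℝ} {y₀ : ℝ → Fin 2 → ℂ} {u : ℝ → ℂ}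

/-- The `k`-th sine coefficient of the initial state, normalized so that `∑ z_k sin (k x)` is the
sine series of `y₀`. -/
noncomputable def stateCoeff (y₀ : ℝ → Fin 2 → ℂ) (k : ℕ) : Fin 2 → ℂ :=
  fun i => 2 / Real.pi * sineCoeff (fun x => y₀ x i) k

lemma memLp_component (hy : IsState y₀) (i : Fin 2) :
    MemLp (fun x => y₀ x i) 2 (volume.restrict (Ioo 0 Real.pi)) :=
  memLp_pi_iff.1 hy i

lemma summable_stateCoeff_sq (hy : IsState y₀) : Summable fun k => ‖stateCoeff y₀ k‖ ^ 2 := by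
  have hs : Summable fun k => ∑ i, ‖stateCoeff y₀ k i‖ ^ 2 := by
    refine summable_sum fun i _ => ?_
    refine ((summable_sineCoeff_sq (memLp_component hy i)).mul_left (‖(2 / Real.pi : ℂ)‖ ^ 2)).congr
      fun k => ?_
    rw [stateCoeff, norm_mul, mul_pow]
  refine Summable.of_nonneg_of_le (fun _ => by positivity) (fun k => ?_) hs
  have h0 : 0 ≤ ∑ i, ‖stateCoeff y₀ k i‖ ^ 2 := Finset.sum_nonneg fun _ _ => by positivity
  rw [← Real.sq_sqrt h0]
  refine pow_le_pow_left₀ (norm_nonneg _) ?_ 2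
  refine (pi_norm_le_iff_of_nonneg (Real.sqrt_nonneg _)).2 fun i => Real.le_sqrt_of_sq_le ?_
  exact Finset.single_le_sum (f := fun i => ‖stateCoeff y₀ k i‖ ^ 2) (fun _ _ => by positivity)
    (Finset.mem_univ i)

/-- The amplitudes of the modes are square summable, uniformly in time. -/
lemma exists_modeSol_bound (A : (Fin 2 → ℂ) →L[ℂ] (Fin 2 → ℂ)) (b : Fin 2 → ℂ) (hy : IsState y₀)
    (hu : IsContinuousControl T₀ u) :
    ∃ M : ℕ → ℝ, (∀ k, 0 ≤ M k) ∧ (Summable fun k => M k ^ 2) ∧ ∀ k, 1 ≤ k → ∀ t ∈ Icc 0 T₀,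
      ‖modeSol A b k (stateCoeff y₀ k) (2 / Real.pi * k) u t‖ ≤ M k := by
  obtain ⟨B, hB⟩ := hu.exists_bound
  have hB0 : 0 ≤ B := (norm_nonneg _).trans (hB 0)
  set E := Real.exp (T₀ * ‖A‖)
  set C := 2 / Real.pi * (B * E * ‖b‖)
  have hC : 0 ≤ C := by have := Real.pi_pos; positivity
  refine ⟨fun k => E * (‖stateCoeff y₀ k‖ + C * (1 / (k : ℝ))), fun k => by positivity, ?_,
    fun k hk t ht => ?_⟩
  · have h1 : Summable fun k : ℕ => E ^ 2 * (2 * ‖stateCoeff y₀ k‖ ^ 2 +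
        2 * C ^ 2 * (1 / (k : ℝ) ^ 2)) :=
      (((summable_stateCoeff_sq hy).mul_left 2).add
        ((Real.summable_one_div_nat_pow.2 one_lt_two).mul_left (2 * C ^ 2))).mul_left _
    refine Summable.of_nonneg_of_le (fun _ => by positivity) (fun k => ?_) h1
    rw [mul_pow]
    refine mul_le_mul_of_nonneg_left ?_ (by positivity)
    rw [← one_div_pow]
    nlinarith [sq_nonneg (‖stateCoeff y₀ k‖ - C * (1 / (k : ℝ)))]
  · refine (norm_modeSol_le hB hk ht).trans (le_of_eq ?_)
    have hk' : (k : ℝ) ≠ 0 := by positivity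
    rw [norm_mul, norm_div, Complex.norm_real, Complex.norm_natCast, Complex.norm_ofNat,
      Real.norm_of_nonneg Real.pi_pos.le]
    simp only [C, E]
    field_simp

/-- A control that solves the moment problem steers the state to rest: the solution is the
superposition of the Fourier modes, all of which vanish from the time `T₀` on. -/
theorem steers_of_moments {B₀ : Fin 2 → ℝ} (hT₀ : 0 < T₀) (hy : IsState y₀)
    (hu : IsContinuousControl T₀ u)
    (hmom : ∀ k : ℕ, 1 ≤ k → stateCoeff y₀ k +
      (2 / Real.pi * k : ℂ) • moment (opA A₀) (fun i => (B₀ i : ℂ)) k u = 0) :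
    Steers A₀ B₀ y₀ u T₀ := by
  set b : Fin 2 → ℂ := fun i => (B₀ i : ℂ) with hb
  set m : ℕ → ℝ → Fin 2 → ℂ := fun k => modeSol (opA A₀) b k (stateCoeff y₀ k) (2 / Real.pi * k) u
    with hm
  have hmom' : ∀ k : ℕ, stateCoeff y₀ k + (2 / Real.pi * k : ℂ) • moment (opA A₀) b k u = 0 := by
    intro k
    rcases Nat.eq_zero_or_pos k with rfl | hk
    · ext i
      simp [stateCoeff, sineCoeff_zero]
    · exact hmom k hk
  have hmc : ∀ k i, Continuous fun t => m k t i := fun k i =>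
    (continuous_apply i).comp (continuous_modeSol hu.continuous)
  have hm0 : ∀ k t, T₀ ≤ t → m k t = 0 := fun k t ht =>
    modeSol_eq_zero hu (hmom' k) ht (hT₀.le.trans ht)
  obtain ⟨M, hM0, hMs, hM⟩ := exists_modeSol_bound (opA A₀) b hy hu
  have hsup := fun i => exists_superposition (fun k => hmc k i)
    (fun k t ht hk => (norm_le_pi_norm (m k t) i).trans (hM k hk t ht)) hM0 hMs
  choose Y hYm hYs using hsup
  set Q₀ := Ioo 0 T₀ ×ˢ Ioo 0 Real.pi
  have hQ₀ : MeasurableSet Q₀ := measurableSet_Ioo.prod measurableSet_Ioo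
  have hym : ∀ i, MemLp (Q₀.indicator (Y i)) 2 volume := fun i =>
    (memLp_indicator_iff_restrict hQ₀).2 (hYm i)
  obtain ⟨B, hB⟩ := hu.exists_bound
  refine ⟨fun T _ => MemLp.of_bound hu.continuous.aestronglyMeasurable B (Eventually.of_forall hB),
    (ae_restrict_iff' measurableSet_Ioi).2 (Eventually.of_forall fun t ht =>
      hu.support t fun h => (not_lt.2 h.2) ht),
    fun t x i => Q₀.indicator (Y i) (t, x), fun T hT => ⟨?_, fun φ hφ => ?_⟩,
    (ae_restrict_iff' (measurableSet_Ioi.prod measurableSet_Ioo)).2 (Eventually.of_forall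
      fun p hp => funext fun i => indicator_of_notMem (fun h => (not_lt.2 h.1.2.le) hp.1) _)⟩
  · exact memLp_pi_iff.2 fun i => (hym i).restrict _
  set Q := Ioo 0 T ×ˢ Ioo 0 Real.pi with hQdef
  have hQ : MeasurableSet Q := measurableSet_Ioo.prod measurableSet_Ioo
  set g : Fin 2 → ℝ × ℝ → ℂ := fun i p => adjointSource A₀ φ p.1 p.2 i
  have hgc : ∀ i, Continuous (g i) := fun i => continuous_adjointSource hφ.contDiff i
  have hφi := contDiff_component hφ.contDiff
  have hφ1 : ∀ i, ContDiff ℝ 1 fun p : ℝ × ℝ => φ p.1 p.2 i := fun i => (hφi i).of_le (by norm_num)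
  have hφX := fun i => contDiff_partialX (hφi i)
  have hfin : IsFiniteMeasure ((volume : Measure (ℝ × ℝ)).restrict Q) := by
    refine ⟨?_⟩
    rw [Measure.restrict_apply_univ, Measure.volume_eq_prod, Measure.prod_prod]
    exact ENNReal.mul_lt_top measure_Ioo_lt_top measure_Ioo_lt_top
  have hgm : ∀ i, MemLp (g i) 2 (volume.restrict Q) := fun i => by
    obtain ⟨D, hD⟩ := (isCompact_Icc.prod isCompact_Icc).exists_bound_of_continuousOn
      (s := Icc 0 T ×ˢ Icc 0 Real.pi) (hgc i).continuousOn
    exact MemLp.of_bound (hgc i).aestronglyMeasurable D ((ae_restrict_iff' hQ).2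
      (Eventually.of_forall fun p hp => hD p ⟨Ioo_subset_Icc_self hp.1, Ioo_subset_Icc_self hp.2⟩))
  -- The modes vanish from the time `T₀` on, so that integrals over the two rectangles agree.
  have hterm : ∀ i k, ∫ p in Q₀, m k p.1 i * (Real.sin (k * p.2) : ℂ) * Q.indicator (g i) p =
      ∫ p in Q, m k p.1 i * (Real.sin (k * p.2) : ℂ) * g i p := by
    intro i k
    have e1 : ∀ p, m k p.1 i * (Real.sin (k * p.2) : ℂ) * Q.indicator (g i) p =
        Q.indicator (fun p => m k p.1 i * (Real.sin (k * p.2) : ℂ) * g i p) p := fun p =>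
      (indicator_mul_right Q (fun p : ℝ × ℝ => m k p.1 i * (Real.sin (k * p.2) : ℂ)) (g i)).symm
    simp only [e1]
    rw [setIntegral_indicator hQ, inter_comm]
    refine (setIntegral_eq_of_subset_of_forall_sdiff_eq_zero hQ inter_subset_left
      fun p hp => ?_).symm
    have h1 : T₀ ≤ p.1 := by
      by_contra h
      exact hp.2 ⟨hp.1, ⟨⟨hp.1.1.1, not_le.1 h⟩, hp.1.2⟩⟩
    rw [hm0 k _ h1, Pi.zero_apply, zero_mul, zero_mul]
  have hlim : ∀ i, ∫ p in Q₀, Y i p * Q.indicator (g i) p =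
      ∫ p in Q, Q₀.indicator (Y i) p * g i p := by
    intro i
    have e1 : ∀ p, Y i p * Q.indicator (g i) p = Q.indicator (fun p => Y i p * g i p) p := fun p =>
      (indicator_mul_right Q (Y i) (g i)).symm
    have e2 : ∀ p, Q₀.indicator (Y i) p * g i p =
        Q₀.indicator (fun p => Y i p * g i p) p := fun p =>
      (indicator_mul_left Q₀ (Y i) (g i)).symm
    simp only [e1, e2]
    rw [setIntegral_indicator hQ, setIntegral_indicator hQ₀, inter_comm]
  have hsum : HasSum (fun k => ∑ i, ∫ p in Q, m k p.1 i * (Real.sin (k * p.2) : ℂ) * g i p)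
      (∫ p in Q, (fun i => Q₀.indicator (Y i) p) ⬝ᵥ adjointSource A₀ φ p.1 p.2) := by
    have e1 : ∫ p in Q, (fun i => Q₀.indicator (Y i) p) ⬝ᵥ adjointSource A₀ φ p.1 p.2 =
        ∑ i, ∫ p in Q, Q₀.indicator (Y i) p * g i p :=
      integral_finsetSum _ fun i _ => ((hym i).restrict Q).integrable_mul (hgm i)
    rw [e1]
    refine hasSum_sum fun i _ => ?_
    rw [← hlim]
    refine (hYs i (Q.indicator (g i)) ?_).congr_fun fun k => (hterm i k).symm
    exact ((memLp_indicator_iff_restrict hQ).2 (hgm i)).restrict _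
  have hz : (0 : ℝ) ∈ Icc 0 T := ⟨le_rfl, hT.le⟩
  have hstate : HasSum (fun k => ∑ i, stateCoeff y₀ k i * sineCoeff (fun x => φ 0 x i) k)
      (∫ x in Ioo 0 Real.pi, y₀ x ⬝ᵥ φ 0 x) := by
    have hc : ∀ i, Continuous fun x => φ 0 x i := fun i =>
      (hφi i).continuous.comp (Continuous.prodMk_right 0)
    have hyi : ∀ i, IntegrableOn (fun x => y₀ x i) (Ioo 0 Real.pi) := fun i =>
      (memLp_component hy i).integrable (by norm_num)
    have e1 : ∫ x in Ioo 0 Real.pi, y₀ x ⬝ᵥ φ 0 x =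
        ∑ i, ∫ x in Ioo 0 Real.pi, y₀ x i * φ 0 x i := by
      refine integral_finsetSum _ fun i _ => ?_
      obtain ⟨D, hD⟩ := isCompact_Icc.exists_bound_of_continuousOn (s := Icc 0 Real.pi)
        (hc i).continuousOn
      exact (hyi i).mul_bdd (c := D) (hc i).aestronglyMeasurable
        ((ae_restrict_iff' measurableSet_Ioo).2 (Eventually.of_forall fun x hx =>
          hD x (Ioo_subset_Icc_self hx)))
    rw [e1]
    refine hasSum_sum fun i _ => ?_
    have hcX := continuous_partialX (hφX i)
    exact hasSum_integral_sineCoeff (hyi i) (fun x => hasDerivAt_partialX (hφ1 i) 0 x)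
      (fun x => hasDerivAt_partialX (hφX i) 0 x) (by fun_prop) (congrFun (hφ.left 0 hz) i)
      (congrFun (hφ.right 0 hz) i)
  have hcontrol : Tendsto (fun n => ∑ k ∈ Finset.range n, ∑ i, b i * (2 / Real.pi * (k : ℂ) *
      ∫ t in (0 : ℝ)..T, u t * sineCoeff (fun x => φ t x i) k)) atTop
      (𝓝 (∫ t in Ioo 0 T, (b ⬝ᵥ deriv (fun x => φ t x) 0) * u t)) := by
    have e1 : ∫ t in Ioo 0 T, (b ⬝ᵥ deriv (fun x => φ t x) 0) * u t =
        ∑ i, b i * ∫ t in (0 : ℝ)..T, u t * partialX (fun p => φ p.1 p.2 i) (t, 0) := by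
      have e2 : ∀ t, (b ⬝ᵥ deriv (fun x => φ t x) 0) * u t =
          ∑ i, b i * (u t * partialX (fun p => φ p.1 p.2 i) (t, 0)) := fun t => by
        rw [deriv_test hφ.contDiff, dotProduct, Finset.sum_mul]
        exact Finset.sum_congr rfl fun i _ => by ring
      have hcX := fun i => (hφX i).continuous
      have huc := hu.continuous
      simp only [e2]
      rw [← integral_Ioc_eq_integral_Ioo, ← intervalIntegral.integral_of_le hT.le,
        intervalIntegral.integral_finsetSum
          fun i _ => Continuous.intervalIntegrable (by fun_prop) _ _]
      simp only [intervalIntegral.integral_const_mul]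
    rw [e1]
    refine (tendsto_finsetSum Finset.univ fun i _ => (tendsto_integral_sineCoeff_deriv (hφi i)
      hu.continuous hT.le (fun t ht => congrFun (hφ.left t ht) i)
      (fun t ht => congrFun (hφ.right t ht) i)).const_mul (b i)).congr fun n => ?_
    simp only [Finset.mul_sum]
    exact Finset.sum_comm
  refine tendsto_nhds_unique hsum.tendsto_sum_nat ((hstate.tendsto_sum_nat.add hcontrol).congr
    fun n => ?_)
  rw [← Finset.sum_add_distrib]
  exact Finset.sum_congr rfl fun k _ =>
    (sum_integral_mode hu.continuous hT hφ b (stateCoeff y₀ k) (2 / Real.pi * k) k).symm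

end Steering

/-! ### Adjoint eigenfunctions as test functions -/

section Dual

variable {A₀ : Matrix (Fin 2) (Fin 2) ℝ} {B₀ : Fin 2 → ℝ} {T : ℝ} {y₀ : ℝ → Fin 2 → ℂ} {u : ℝ → ℂ}

/-- A smooth function of time that equals `exp (l t)` up to the time `T + 1` and vanishes at the
time `T + 2`. -/
noncomputable def cutExp (l : ℂ) (T t : ℝ) : ℂ :=
  (Real.smoothTransition (T + 2 - t) : ℂ) * Complex.exp (l * t)

lemma contDiff_cutExp (l : ℂ) (T : ℝ) : ContDiff ℝ 2 (cutExp l T) := by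
  have h1 : ContDiff ℝ 2 fun t : ℝ => Real.smoothTransition (T + 2 - t) :=
    Real.smoothTransition.contDiff.comp (contDiff_const.sub contDiff_id)
  exact (Complex.ofRealCLM.contDiff.comp h1).mul
    (contDiff_const.mul Complex.ofRealCLM.contDiff).cexp

lemma cutExp_final (l : ℂ) (T : ℝ) : cutExp l T (T + 2) = 0 := by
  simp [cutExp]

lemma cutExp_zero (l : ℂ) (hT : 0 < T) : cutExp l T 0 = 1 := by
  rw [cutExp, Real.smoothTransition.one_of_one_le (by linarith)]
  simp

lemma deriv_cutExp (l : ℂ) {t : ℝ} (ht : t ≤ T) : deriv (cutExp l T) t = l * cutExp l T t := by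
  have h1 : ∀ s < T + 1, cutExp l T s = Complex.exp (l * s) := fun s hs => by
    rw [cutExp, Real.smoothTransition.one_of_one_le (by linarith), Complex.ofReal_one, one_mul]
  have h2 : cutExp l T =ᶠ[𝓝 t] fun s => Complex.exp (l * s) := by
    filter_upwards [Iio_mem_nhds (by linarith : t < T + 1)] with s hs using h1 s hs
  have h3 : HasDerivAt (fun s : ℝ => l * (s : ℂ)) l t :=
    ((Complex.ofRealCLM.hasDerivAt (x := t)).const_mul l).congr_deriv (by simp)
  rw [h2.deriv_eq, h3.cexp.deriv, h1 t (by linarith), mul_comm]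

lemma norm_cutExp_le (l : ℂ) (T t : ℝ) : ‖cutExp l T t‖ ≤ Real.exp (l.re * t) := by
  rw [cutExp, norm_mul, Complex.norm_real, Complex.norm_exp, Complex.re_mul_ofReal,
    Real.norm_of_nonneg (Real.smoothTransition.nonneg _)]
  exact mul_le_of_le_one_left (Real.exp_pos _).le (Real.smoothTransition.le_one _)

/-- If a control steers `y₀` to rest, the pairing of `y₀` with a solution `exp (l t) ψ(x)` of the
adjoint equation is determined by the control: test with this solution, cut off in time after the
solution of the heat system has come to rest. -/
lemma Steers.integral_state (hT : 0 < T) (hst : Steers A₀ B₀ y₀ u T) {ψ ψ₁ ψ₂ : ℝ → Fin 2 → ℂ}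
    {l : ℂ} (hψ : ContDiff ℝ 2 ψ) (h1 : ∀ x, HasDerivAt ψ (ψ₁ x) x)
    (h2 : ∀ x, HasDerivAt ψ₁ (ψ₂ x) x)
    (hode : ∀ x, l • ψ x + ψ₂ x + (complexify A₀)ᵀ *ᵥ ψ x = 0) (h0 : ψ 0 = 0)
    (hπ : ψ Real.pi = 0) :
    ∫ x in Ioo 0 Real.pi, y₀ x ⬝ᵥ ψ x =
      -(((fun i => (B₀ i : ℂ)) ⬝ᵥ ψ₁ 0) * ∫ t in Ioo 0 (T + 2), cutExp l T t * u t) := by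
  obtain ⟨-, -, y, hy, hy0⟩ := hst
  have hφ : IsTest (T + 2) fun t x => cutExp l T t • ψ x :=
    ⟨((contDiff_cutExp l T).comp contDiff_fst).smul (hψ.comp contDiff_snd),
      fun t _ => by rw [h0, smul_zero], fun t _ => by rw [hπ, smul_zero],
      fun x _ => by rw [cutExp_final, zero_smul]⟩
  have hscale : ∀ t x, HasDerivAt (fun z => cutExp l T t • ψ z) (cutExp l T t • ψ₁ x) x :=
    fun t x => (h1 x).const_smul (cutExp l T t)
  have hsource : ∀ t ≤ T, ∀ x, adjointSource A₀ (fun t x => cutExp l T t • ψ x) t x = 0 := by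
    intro t ht x
    have d1 : deriv (fun s => cutExp l T s • ψ x) t = (l * cutExp l T t) • ψ x := by
      rw [← deriv_cutExp l ht]
      exact ((((contDiff_cutExp l T).differentiable (by norm_num)) t).hasDerivAt.smul_const _).deriv
    have d2 : deriv (fun z => cutExp l T t • ψ z) = fun z => cutExp l T t • ψ₁ z :=
      funext fun z => (hscale t z).deriv
    have d3 : iteratedDeriv 2 (fun z => cutExp l T t • ψ z) x = cutExp l T t • ψ₂ x := by
      rw [iteratedDeriv_succ, iteratedDeriv_one, d2]
      have d4 : HasDerivAt (fun z => cutExp l T t • ψ₁ z) (cutExp l T t • ψ₂ x) x :=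
        (h2 x).const_smul (cutExp l T t)
      exact d4.deriv
    rw [adjointSource, d1, d3, Matrix.mulVec_smul]
    have := congrArg (fun v => -(cutExp l T t • v)) (hode x)
    simp only [smul_zero, neg_zero] at this
    rw [← this]
    module
  have hzero : ∫ p in Ioo 0 (T + 2) ×ˢ Ioo 0 Real.pi,
      y p.1 p.2 ⬝ᵥ adjointSource A₀ (fun t x => cutExp l T t • ψ x) p.1 p.2 = 0 := by
    refine integral_eq_zero_of_ae ?_
    have h3 := (ae_restrict_iff' (measurableSet_Ioi.prod measurableSet_Ioo)).1 hy0
    filter_upwards [ae_restrict_of_ae h3,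
      ae_restrict_mem (measurableSet_Ioo.prod measurableSet_Ioo)] with p hp hp'
    rcases le_or_gt p.1 T with h | h
    · rw [hsource _ h, dotProduct_zero, Pi.zero_apply]
    · rw [hp ⟨h, hp'.2⟩, zero_dotProduct, Pi.zero_apply]
  have htr := (hy (T + 2) (by linarith)).transposition _ hφ
  have d4 : ∀ t, deriv (fun x => cutExp l T t • ψ x) 0 = cutExp l T t • ψ₁ 0 := fun t =>
    (hscale t 0).deriv
  rw [hzero, cutExp_zero l hT] at htr
  simp only [one_smul, d4, dotProduct_smul, smul_eq_mul] at htr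
  rw [← integral_const_mul, eq_neg_iff_add_eq_zero, htr]
  congr 2
  ext t
  ring

/-- The pairing of `Steers.integral_state` for a sum of two adjoint eigenfunctions and an initial
state that is orthogonal to the second one. -/
lemma sum_normSq_eq_of_steers {w w' : Fin 2 → ℂ} {j k : ℕ} {l : ℂ} (hj : 1 ≤ j) (hjk : j ≠ k)
    (hw : (complexify A₀)ᵀ *ᵥ w = ((j : ℂ) ^ 2 - l) • w)
    (hw' : (complexify A₀)ᵀ *ᵥ w' = ((k : ℂ) ^ 2 - l) • w') (hT : 0 < T)
    (hst : Steers A₀ B₀ (fun x => (Real.sin (j * x) : ℂ) • star w) u T) :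
    ((Real.pi / 2 * ∑ i, ‖w i‖ ^ 2 : ℝ) : ℂ) =
      -(((fun i => (B₀ i : ℂ)) ⬝ᵥ ((j : ℂ) • w + (k : ℂ) • w')) *
        ∫ t in Ioo 0 (T + 2), cutExp l T t * u t) := by
  have hs : ∀ (n : ℕ) (v : Fin 2 → ℂ) (x : ℝ),
      HasDerivAt (fun x : ℝ => (Real.sin (n * x) : ℂ) • v)
        (((n : ℂ) * (Real.cos (n * x) : ℂ)) • v) x :=
    fun n v x => (hasDerivAt_sin_mul n x).smul_const v
  have hc : ∀ (n : ℕ) (v : Fin 2 → ℂ) (x : ℝ),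
      HasDerivAt (fun x : ℝ => ((n : ℂ) * (Real.cos (n * x) : ℂ)) • v)
        ((-(n : ℂ) ^ 2 * (Real.sin (n * x) : ℂ)) • v) x := fun n v x =>
    (((hasDerivAt_cos_mul n x).const_mul (n : ℂ)).smul_const v).congr_deriv (by congr 1; ring)
  have hcd : ∀ (n : ℕ) (v : Fin 2 → ℂ), ContDiff ℝ 2 fun x : ℝ => (Real.sin (n * x) : ℂ) • v :=
    fun n v => (Complex.ofRealCLM.contDiff.comp
      (Real.contDiff_sin.comp (contDiff_const.mul contDiff_id))).smul contDiff_const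
  have hmain := hst.integral_state hT (l := l) ((hcd j w).add (hcd k w'))
    (fun x => (hs j w x).add (hs k w' x)) (fun x => (hc j w x).add (hc k w' x))
    (fun x => by simp only [Matrix.mulVec_add, Matrix.mulVec_smul, hw, hw']; module)
    (by simp) (by simp)
  have e1 : ∀ x : ℝ, ((Real.sin (j * x) : ℂ) • star w) ⬝ᵥ
      ((Real.sin (j * x) : ℂ) • w + (Real.sin (k * x) : ℂ) • w') =
      ((Real.sin (j * x) * Real.sin (j * x) : ℝ) : ℂ) * (star w ⬝ᵥ w) +
      ((Real.sin (j * x) * Real.sin (k * x) : ℝ) : ℂ) * (star w ⬝ᵥ w') := fun x => by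
    simp only [smul_dotProduct, dotProduct_add, dotProduct_smul, smul_eq_mul, Complex.ofReal_mul]
    ring
  have e2 : star w ⬝ᵥ w = ((∑ i, ‖w i‖ ^ 2 : ℝ) : ℂ) := by
    simp only [dotProduct, Pi.star_apply, Complex.star_def, Complex.conj_mul', Complex.ofReal_sum,
      Complex.ofReal_pow]
  have e3 : ∫ x in Ioo 0 Real.pi, ((Real.sin (j * x) : ℂ) • star w) ⬝ᵥ
      ((Real.sin (j * x) : ℂ) • w + (Real.sin (k * x) : ℂ) • w') =
      ((Real.pi / 2 * ∑ i, ‖w i‖ ^ 2 : ℝ) : ℂ) := by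
    simp only [e1]
    rw [← integral_Ioc_eq_integral_Ioo, ← intervalIntegral.integral_of_le Real.pi_pos.le,
      intervalIntegral.integral_add (Continuous.intervalIntegrable (by fun_prop) _ _)
        (Continuous.intervalIntegrable (by fun_prop) _ _),
      intervalIntegral.integral_mul_const, intervalIntegral.integral_mul_const,
      intervalIntegral.integral_ofReal, intervalIntegral.integral_ofReal,
      integral_sin_mul_sin hj, integral_sin_mul_sin hj, if_pos rfl, if_neg hjk, e2]
    simp
  rw [← e3, hmain]
  simp

lemma isState_sin_smul (j : ℕ) (v : Fin 2 → ℂ) : IsState fun x => (Real.sin (j * x) : ℂ) • v := by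
  refine MemLp.of_bound (Continuous.aestronglyMeasurable (by fun_prop)) ‖v‖
    (Eventually.of_forall fun x => ?_)
  rw [norm_smul, Complex.norm_real]
  exact mul_le_of_le_one_left (norm_nonneg _) (Real.abs_sin_le_one _)

lemma eq_zero_of_sum_normSq {w : Fin 2 → ℂ} (h : Real.pi / 2 * ∑ i, ‖w i‖ ^ 2 ≤ 0) : w = 0 := by
  have h1 : ∑ i, ‖w i‖ ^ 2 ≤ 0 := by
    by_contra h2
    have := mul_pos (half_pos Real.pi_pos) (not_le.1 h2)
    linarith
  have h3 := (Finset.sum_eq_zero_iff_of_nonneg (fun i _ => by positivity)).1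
    (h1.antisymm (Finset.sum_nonneg fun i _ => by positivity))
  ext i
  simpa using h3 i (Finset.mem_univ i)

/-- Null controllability excludes adjoint eigenfunctions that the control does not see. -/
lemma NullControllable.eq_zero (h : NullControllable A₀ B₀) {w w' : Fin 2 → ℂ} {j k : ℕ} {l : ℂ}
    (hj : 1 ≤ j) (hjk : j ≠ k) (hw : (complexify A₀)ᵀ *ᵥ w = ((j : ℂ) ^ 2 - l) • w)
    (hw' : (complexify A₀)ᵀ *ᵥ w' = ((k : ℂ) ^ 2 - l) • w')
    (hb : (fun i => (B₀ i : ℂ)) ⬝ᵥ ((j : ℂ) • w + (k : ℂ) • w') = 0) : w = 0 := by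
  obtain ⟨T, hT, u, hst⟩ := h _ (isState_sin_smul j (star w))
  have := sum_normSq_eq_of_steers hj hjk hw hw' hT hst
  rw [hb, zero_mul, neg_zero, Complex.ofReal_eq_zero] at this
  exact eq_zero_of_sum_normSq this.le

/-- The spectral form of Kalman's condition. -/
lemma NullControllable.hautus (h : NullControllable A₀ B₀) {w : Fin 2 → ℂ} {μ : ℂ}
    (hw : (complexify A₀)ᵀ *ᵥ w = μ • w) (hb : (fun i => (B₀ i : ℂ)) ⬝ᵥ w = 0) : w = 0 :=
  h.eq_zero (w' := 0) (j := 1) (k := 2) (l := 1 - μ) le_rfl (by norm_num) (by rw [hw]; norm_num)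
    (by simp) (by simp [hb])

lemma exists_adjoint_eigenvector {μ : ℂ} (hμ : (complexify A₀).charpoly.IsRoot μ) :
    ∃ w : Fin 2 → ℂ, w ≠ 0 ∧ (complexify A₀)ᵀ *ᵥ w = μ • w := by
  rw [← Matrix.charpoly_transpose, ← Matrix.charpoly_toLin',
    ← Module.End.hasEigenvalue_iff_isRoot_charpoly] at hμ
  obtain ⟨w, hw⟩ := hμ.exists_hasEigenvector
  exact ⟨w, hw.2, by simpa using hw.apply_eq_smul⟩

/-- Two eigenvalues whose difference is a difference of squares give rise to a two-dimensional
eigenspace of the adjoint heat operator, on which the observation cannot be injective. -/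
lemma NullControllable.sub_ne (h : NullControllable A₀ B₀) {μ₁ μ₂ : ℂ}
    (h1 : (complexify A₀).charpoly.IsRoot μ₁) (h2 : (complexify A₀).charpoly.IsRoot μ₂) {j k : ℕ}
    (hj : 1 ≤ j) (hk : 1 ≤ k) (hjk : j ≠ k) : μ₁ - μ₂ ≠ (j : ℂ) ^ 2 - (k : ℂ) ^ 2 := by
  intro heq
  obtain ⟨w₁, hw₁, e₁⟩ := exists_adjoint_eigenvector h1
  obtain ⟨w₂, hw₂, e₂⟩ := exists_adjoint_eigenvector h2
  set b : Fin 2 → ℂ := fun i => (B₀ i : ℂ)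
  refine hw₂ (h.hautus e₂ ?_)
  have h3 := h.eq_zero (w := (k * (b ⬝ᵥ w₂)) • w₁) (w' := -(j * (b ⬝ᵥ w₁)) • w₂) (j := j) (k := k)
    (l := (j : ℂ) ^ 2 - μ₁) hj hjk
    (by rw [Matrix.mulVec_smul, e₁, smul_comm, sub_sub_cancel])
    (by
      rw [Matrix.mulVec_smul, e₂, smul_comm]
      congr 1
      linear_combination -heq)
    (by
      simp only [dotProduct_add, dotProduct_smul, smul_eq_mul]
      ring)
  have hk' : (k : ℂ) ≠ 0 := by
    have : k ≠ 0 := by omega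
    exact_mod_cast this
  exact (mul_eq_zero.1 ((smul_eq_zero.1 h3).resolve_right hw₁)).resolve_left hk'

/-- An eigenvalue with real part larger than `1` makes the first mode unstable, and the adjoint
solution decays; a control of small energy then has a small effect on this mode. -/
lemma NCVE.re_le_one (h : NCVE A₀ B₀) {μ : ℂ} (hμ : (complexify A₀).charpoly.IsRoot μ) :
    μ.re ≤ 1 := by
  by_contra! hre
  obtain ⟨w, hw0, hw⟩ := exists_adjoint_eigenvector hμ
  refine hw0 (eq_zero_of_sum_normSq ?_)
  set r := μ.re - 1
  have hr : 0 < r := sub_pos.2 hre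
  set β := ‖(fun i => (B₀ i : ℂ)) ⬝ᵥ w‖
  have key : ∀ ε : ℝ, 0 < ε → Real.pi / 2 * ∑ i, ‖w i‖ ^ 2 ≤ β * (1 / (2 * r) + 1) * ε := by
    intro ε hε
    obtain ⟨T, hT, u, hst, hu⟩ := h _ (isState_sin_smul 1 (star w)) ε hε
    have hT2 : 0 < T + 2 := by linarith
    have hid := sum_normSq_eq_of_steers (w' := 0) (k := 2) (l := 1 - μ) le_rfl (by norm_num)
      (by rw [hw]; norm_num) (by simp) hT hst
    have hu2 : IntegrableOn (fun t => ‖u t‖ ^ 2) (Ioo 0 (T + 2)) :=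
      (memLp_two_iff_integrable_sq_norm (hst.1 _ hT2).1).1 (hst.1 _ hT2)
    have henergy : ∫ t in Ioo 0 (T + 2), ‖u t‖ ^ 2 ≤ ε ^ 2 := by
      refine le_trans (le_of_eq ?_) hu
      refine (setIntegral_eq_of_subset_of_ae_sdiff_eq_zero measurableSet_Ioi.nullMeasurableSet
        Ioo_subset_Ioi_self ?_).symm
      filter_upwards [(ae_restrict_iff' measurableSet_Ioi).1 hst.2.1] with t ht ht'
      have : T < t := by
        by_contra h3
        exact ht'.2 ⟨ht'.1, by linarith⟩
      rw [ht this, norm_zero, zero_pow two_ne_zero]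
    -- The weight `ε` in Young's inequality makes both terms of order `ε`.
    have hexp : IntegrableOn (fun t => Real.exp (-(2 * r) * t)) (Ioi 0) :=
      integrableOn_exp_mul_Ioi (by linarith) 0
    have hexp' : ∫ t in Ioo 0 (T + 2), Real.exp (-(2 * r) * t) ≤ 1 / (2 * r) := by
      refine (setIntegral_mono_set hexp (Eventually.of_forall fun t => (Real.exp_pos _).le)
        Ioo_subset_Ioi_self.eventuallyLE).trans (le_of_eq ?_)
      rw [integral_exp_mul_Ioi (by linarith)]
      simp
    have hint : ‖∫ t in Ioo 0 (T + 2), cutExp (1 - μ) T t * u t‖ ≤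
        ∫ t in Ioo 0 (T + 2), (ε * Real.exp (-(2 * r) * t) + ε⁻¹ * ‖u t‖ ^ 2) := by
      refine norm_integral_le_of_norm_le (((hexp.mono_set Ioo_subset_Ioi_self).const_mul _).add
        (hu2.const_mul _)) (Eventually.of_forall fun t => ?_)
      rw [norm_mul]
      have h4 := norm_cutExp_le (1 - μ) T t
      have h5 : Real.exp (-(2 * r) * t) = Real.exp ((1 - μ).re * t) ^ 2 := by
        rw [← Real.exp_nat_mul]
        congr 1
        simp [r]
        ring
      rw [h5]
      refine (mul_le_mul_of_nonneg_right h4 (norm_nonneg _)).trans ?_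
      set e := Real.exp ((1 - μ).re * t)
      have h6 : ε * e ^ 2 + ε⁻¹ * ‖u t‖ ^ 2 - e * ‖u t‖ =
          ε⁻¹ * ((ε * e - ‖u t‖ / 2) ^ 2 + 3 / 4 * ‖u t‖ ^ 2) := by
        field_simp
        ring
      have h7 : 0 ≤ ε⁻¹ * ((ε * e - ‖u t‖ / 2) ^ 2 + 3 / 4 * ‖u t‖ ^ 2) := by positivity
      linarith
    rw [integral_add ((hexp.mono_set Ioo_subset_Ioi_self).const_mul _) (hu2.const_mul _),
      integral_const_mul, integral_const_mul] at hint
    have hnorm := congrArg norm hid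
    rw [Complex.norm_real, norm_neg, norm_mul (_ ⬝ᵥ _)] at hnorm
    have h8 : (fun i => (B₀ i : ℂ)) ⬝ᵥ (((1 : ℕ) : ℂ) • w + ((2 : ℕ) : ℂ) • (0 : Fin 2 → ℂ)) =
      (fun i => (B₀ i : ℂ)) ⬝ᵥ w := by simp
    rw [h8] at hnorm
    refine (Real.le_norm_self _).trans ((le_of_eq hnorm).trans ?_)
    rw [mul_assoc]
    refine mul_le_mul_of_nonneg_left (hint.trans ?_) (norm_nonneg _)
    have h9 : ε⁻¹ * ε ^ 2 = ε := by field_simp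
    have h10 := mul_le_mul_of_nonneg_left hexp' hε.le
    have h11 := mul_le_mul_of_nonneg_left henergy (inv_nonneg.2 hε.le)
    linarith
  refine le_of_forall_pos_le_add fun δ hδ => ?_
  set K := β * (1 / (2 * r) + 1)
  have hK : 0 ≤ K := by positivity
  refine (key (δ / (K + 1)) (by positivity)).trans ?_
  rw [zero_add, mul_div_assoc', div_le_iff₀ (by positivity)]
  nlinarith

end Dual

/-! ### The rank condition and the spectrum of the coupling matrix -/

section Kalman

variable {A₀ : Matrix (Fin 2) (Fin 2) ℝ} {B₀ : Fin 2 → ℝ} {μ₁ μ₂ : ℂ}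

lemma complexify_cayley (hμ : (complexify A₀).charpoly.roots = {μ₁, μ₂}) :
    (complexify A₀ - μ₁ • 1) * (complexify A₀ - μ₂ • 1) = 0 := by
  have h1 := (IsAlgClosed.splits (complexify A₀).charpoly).eq_prod_roots_of_monic
    (complexify A₀).charpoly_monic
  have h2 := Matrix.aeval_self_charpoly (complexify A₀)
  rw [h1, hμ] at h2
  simpa [Algebra.algebraMap_eq_smul_one] using h2

lemma opA_cayley (hμ : (complexify A₀).charpoly.roots = {μ₁, μ₂}) :
    (opA A₀ - μ₁ • 1) * (opA A₀ - μ₂ • 1) = 0 := by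
  ext1 v
  have h := congrArg (fun M => M *ᵥ v) (complexify_cayley hμ)
  simp only [← Matrix.mulVec_mulVec, Matrix.sub_mulVec, Matrix.smul_mulVec, Matrix.one_mulVec,
    Matrix.zero_mulVec] at h
  exact h

lemma complexify_mulVec_ofReal (A₀ : Matrix (Fin 2) (Fin 2) ℝ) (B₀ : Fin 2 → ℝ) :
    (complexify A₀ *ᵥ fun i => (B₀ i : ℂ)) = fun i => ((A₀ *ᵥ B₀) i : ℂ) := by
  ext i
  simp [complexify, Matrix.mulVec, dotProduct]

/-- The rank condition, as injectivity of the transposed Kalman matrix over `ℂ`. -/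
lemma eq_zero_of_rank (hrank : (Matrix.of ![B₀, A₀ *ᵥ B₀])ᵀ.rank = 2) {w : Fin 2 → ℂ}
    (h1 : (fun i => (B₀ i : ℂ)) ⬝ᵥ w = 0)
    (h2 : (complexify A₀ *ᵥ fun i => (B₀ i : ℂ)) ⬝ᵥ w = 0) : w = 0 := by
  have hsurj : Function.Surjective (Matrix.of ![B₀, A₀ *ᵥ B₀])ᵀ.mulVec := by
    change Function.Surjective (Matrix.of ![B₀, A₀ *ᵥ B₀])ᵀ.mulVecLin
    rw [← LinearMap.range_eq_top]
    exact Submodule.eq_top_of_finrank_eq (hrank.trans (Module.finrank_fin_fun ℝ).symm)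
  have hdet :=
    ((Matrix.isUnit_iff_isUnit_det _).1 (Matrix.mulVec_surjective_iff_isUnit.1 hsurj)).ne_zero
  rw [Matrix.det_transpose, Matrix.det_fin_two] at hdet
  simp only [Matrix.of_apply, Matrix.cons_val_zero, Matrix.cons_val_one] at hdet
  have hdet' : ((B₀ 0 : ℂ) * ((A₀ *ᵥ B₀) 1 : ℝ) - B₀ 1 * ((A₀ *ᵥ B₀) 0 : ℝ)) ≠ 0 := by
    exact_mod_cast hdet
  rw [complexify_mulVec_ofReal] at h2
  simp only [dotProduct, Fin.sum_univ_two] at h1 h2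
  ext i
  refine (mul_eq_zero.1 (?_ : ((B₀ 0 : ℂ) * ((A₀ *ᵥ B₀) 1 : ℝ) -
    B₀ 1 * ((A₀ *ᵥ B₀) 0 : ℝ)) * w i = 0)).resolve_left hdet'
  fin_cases i
  · change _ * w 0 = 0
    linear_combination ((A₀ *ᵥ B₀) 1 : ℂ) * h1 - (B₀ 1 : ℂ) * h2
  · change _ * w 1 = 0
    linear_combination (B₀ 0 : ℂ) * h2 - ((A₀ *ᵥ B₀) 0 : ℂ) * h1

lemma mulVec_dotProduct_transpose (M : Matrix (Fin 2) (Fin 2) ℂ) (v w : Fin 2 → ℂ) :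
    (M *ᵥ v) ⬝ᵥ w = v ⬝ᵥ (Mᵀ *ᵥ w) := by
  rw [Matrix.mulVec_transpose, dotProduct_comm, Matrix.dotProduct_mulVec, dotProduct_comm]

/-- Null controllability implies the rank condition: apply the spectral condition to the two
factors of the characteristic polynomial of the adjoint matrix, one after the other. -/
lemma NullControllable.eq_zero_of_dotProduct (h : NullControllable A₀ B₀)
    (hμ : (complexify A₀).charpoly.roots = {μ₁, μ₂}) {w : Fin 2 → ℂ}
    (h1 : (fun i => (B₀ i : ℂ)) ⬝ᵥ w = 0)
    (h2 : (complexify A₀ *ᵥ fun i => (B₀ i : ℂ)) ⬝ᵥ w = 0) : w = 0 := by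
  rw [mulVec_dotProduct_transpose] at h2
  refine h.hautus (μ := μ₁) (sub_eq_zero.1 ?_) h1
  refine h.hautus (μ := μ₂) (sub_eq_zero.1 ?_) ?_
  · have h3 := congrArg (fun M => Mᵀ *ᵥ w) (complexify_cayley hμ)
    simp only [Matrix.transpose_mul, Matrix.transpose_sub, Matrix.transpose_smul,
      Matrix.transpose_one, ← Matrix.mulVec_mulVec, Matrix.sub_mulVec, Matrix.smul_mulVec,
      Matrix.one_mulVec, Matrix.transpose_zero, Matrix.zero_mulVec] at h3
    exact h3
  · rw [dotProduct_sub, dotProduct_smul, h1, h2, smul_zero, sub_zero]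

/-- Small delays are not resonant: an exponential that equals `1` has a multiple of `2πi` as its
exponent, and only the multiple `0` has a small imaginary part. -/
lemma exists_nonresonant_delay
    (hres : ∀ j k : ℕ, 1 ≤ j → 1 ≤ k → j ≠ k → μ₁ - μ₂ ≠ (j : ℂ) ^ 2 - (k : ℂ) ^ 2) :
    ∃ c : ℝ, 0 < c ∧ ∀ j k : ℕ, 1 ≤ j → 1 ≤ k → j ≠ k → ∀ ν ∈ ({μ₁, μ₂} : Set ℂ),
      ∀ ν' ∈ ({μ₁, μ₂} : Set ℂ),
      Complex.exp ((((j : ℝ) ^ 2 - (k : ℝ) ^ 2 : ℝ) + ν) * delay c k - delay c k * ν') ≠ 1 := by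
  set I := |(μ₁ - μ₂).im|
  refine ⟨1 / (I + 1), by positivity, fun j k hj hk hjk ν hν ν' hν' hexp => ?_⟩
  set c := 1 / (I + 1)
  have hc : 0 < c := by positivity
  have hcI : c * I < 1 := by
    rw [one_div_mul_eq_div, div_lt_one (by positivity)]
    linarith
  have hd : 0 < delay c k :=
    lt_of_lt_of_le (by have : 0 < k := hk; positivity) (le_delay hc.le hk)
  have hdI : delay c k * |(ν - ν').im| < 1 := by
    have h1 : |(ν - ν').im| ≤ I := by
      rcases hν with rfl | rfl <;> rcases hν' with rfl | rfl
      · simp [I]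
      · exact le_rfl
      · simp only [I, Complex.sub_im, abs_sub_comm, le_refl]
      · simp [I]
    exact (mul_le_mul (delay_le hc.le k) h1 (abs_nonneg _) hc.le).trans_lt hcI
  obtain ⟨n, hn⟩ := Complex.exp_eq_one_iff.1 hexp
  have him := congrArg Complex.im hn
  have e1 : ((((j : ℝ) ^ 2 - (k : ℝ) ^ 2 : ℝ) + ν) * delay c k - delay c k * ν').im =
      delay c k * (ν - ν').im := by
    simp only [Complex.sub_im, Complex.mul_im, Complex.add_im, Complex.add_re, Complex.ofReal_re,
      Complex.ofReal_im]
    ring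
  have e2 : ((n : ℂ) * (2 * Real.pi * Complex.I)).im = n * (2 * Real.pi) := by
    simp
  rw [e1, e2] at him
  have hn0 : n = 0 := by
    by_contra hne
    have h2 : (1 : ℝ) ≤ |(n : ℝ)| := by exact_mod_cast Int.one_le_abs hne
    have h3 := congrArg abs him
    rw [abs_mul, abs_mul, abs_of_pos hd, abs_of_pos Real.two_pi_pos] at h3
    nlinarith [Real.pi_gt_three]
  rw [hn0, Int.cast_zero, zero_mul] at hn
  have h4 : ((j : ℂ) ^ 2 - (k : ℂ) ^ 2 + ν - ν') = 0 := by
    refine (mul_eq_zero.1 (?_ : (delay c k : ℂ) * _ = 0)).resolve_left (by exact_mod_cast hd.ne')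
    push_cast at hn
    linear_combination hn
  have hsq : (j : ℂ) ^ 2 - (k : ℂ) ^ 2 ≠ 0 := by
    intro h5
    have : (j : ℂ) ^ 2 = (k : ℂ) ^ 2 := sub_eq_zero.1 h5
    have h6 : j ^ 2 = k ^ 2 := by exact_mod_cast this
    exact hjk (Nat.pow_left_injective two_ne_zero h6)
  rcases hν with rfl | rfl <;> rcases hν' with rfl | rfl
  · exact hsq (by linear_combination h4)
  · exact hres k j hk hj hjk.symm (by linear_combination h4)
  · exact hres j k hj hk hjk (by linear_combination -h4)
  · exact hsq (by linear_combination h4)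

/-- Controls of arbitrarily small energy solve the moment problem of every initial state. -/
lemma ncve_of_re_le_one (hμ : (complexify A₀).charpoly.roots = {μ₁, μ₂})
    (hkal : ∀ w : Fin 2 → ℂ, (fun i => (B₀ i : ℂ)) ⬝ᵥ w = 0 →
      (complexify A₀ *ᵥ fun i => (B₀ i : ℂ)) ⬝ᵥ w = 0 → w = 0)
    (hres : ∀ j k : ℕ, 1 ≤ j → 1 ≤ k → j ≠ k → μ₁ - μ₂ ≠ (j : ℂ) ^ 2 - (k : ℂ) ^ 2)
    (h1 : μ₁.re ≤ 1) (h2 : μ₂.re ≤ 1) : NCVE A₀ B₀ := by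
  intro y₀ hy ε hε
  obtain ⟨c, hc, hexp⟩ := exists_nonresonant_delay hres
  set b : Fin 2 → ℂ := fun i => (B₀ i : ℂ)
  have hb : ∀ f : (Fin 2 → ℂ) →ₗ[ℂ] ℂ, f b = 0 → f (opA A₀ b) = 0 → f = 0 := by
    intro f hf1 hf2
    obtain ⟨w, rfl⟩ := (dotProductEquiv ℂ (Fin 2)).surjective f
    rw [dotProductEquiv_apply_apply, dotProduct_comm] at hf1 hf2
    rw [hkal w hf1 hf2, map_zero]
  set M := √(∑' k, ‖stateCoeff y₀ k‖ ^ 2)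
  have hM : ∀ k, ‖stateCoeff y₀ k‖ ≤ M := fun k => Real.le_sqrt_of_sq_le
    ((summable_stateCoeff_sq hy).le_tsum k fun _ _ => by positivity)
  -- The prescribed moments `-(π / 2k) z_k` are bounded because the coefficients `z_k` are.
  obtain ⟨T, u, hT, hu, hmom, henergy⟩ := exists_small_energy_control hc
    (opA_cayley hμ) hexp hb h1 h2
    (v := fun k => -((2 / Real.pi * k : ℂ)⁻¹ • stateCoeff y₀ k)) (M := Real.pi / 2 * M)
    (fun k hk => by
      have hk1 : (1 : ℝ) ≤ k := by exact_mod_cast hk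
      rw [norm_neg, norm_smul, norm_inv, norm_mul, norm_div, Complex.norm_real,
        Complex.norm_natCast,
        Complex.norm_ofNat, Real.norm_of_nonneg Real.pi_pos.le]
      refine mul_le_mul ?_ (hM k) (norm_nonneg _) (by have := Real.pi_pos; positivity)
      rw [mul_inv, inv_div]
      exact mul_le_of_le_one_right (by have := Real.pi_pos; positivity) (inv_le_one_of_one_le₀ hk1))
    (ε := ε ^ 2) (by positivity)
  refine ⟨T, hT, u, steers_of_moments hT hy hu fun k hk => ?_, le_trans ?_ henergy⟩
  · have hk' : (2 / Real.pi * k : ℂ) ≠ 0 := by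
      have h3 : (k : ℂ) ≠ 0 := by
        have : k ≠ 0 := by omega
        exact_mod_cast this
      have h4 : (Real.pi : ℂ) ≠ 0 := by exact_mod_cast Real.pi_ne_zero
      exact mul_ne_zero (div_ne_zero two_ne_zero h4) h3
    rw [hmom k hk, smul_neg, smul_inv_smul₀ hk', add_neg_cancel]
  · refine setIntegral_le_integral ?_ (Eventually.of_forall fun t => by positivity)
    have hu' := hu.continuous
    exact Continuous.integrable_of_hasCompactSupport (by fun_prop)
      (hu.hasCompactSupport.comp_left (g := fun z : ℂ => ‖z‖ ^ 2) (by simp))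

end Kalman

end CoupledHeat

theorem mainTheorem4 (A₀ : Matrix (Fin 2) (Fin 2) ℝ) (B₀ : Fin 2 → ℝ) (μ₁ μ₂ : ℂ)
    (hμ : (CoupledHeat.complexify A₀).charpoly.roots = {μ₁, μ₂})
    (h : CoupledHeat.NullControllable A₀ B₀ ∨
      ((Matrix.of ![B₀, A₀ *ᵥ B₀])ᵀ.rank = 2 ∧
        ∀ j k : ℕ, 1 ≤ j → 1 ≤ k → j ≠ k → μ₁ - μ₂ ≠ (j : ℂ) ^ 2 - (k : ℂ) ^ 2)) :
    CoupledHeat.NCVE A₀ B₀ ↔ μ₁.re ≤ 1 ∧ μ₂.re ≤ 1 := by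
  have hroot : ∀ μ ∈ ({μ₁, μ₂} : Multiset ℂ), (CoupledHeat.complexify A₀).charpoly.IsRoot μ :=
    fun μ hmem => (Polynomial.mem_roots'.1 (hμ ▸ hmem)).2
  have hr1 := hroot μ₁ (by simp)
  have hr2 := hroot μ₂ (by simp)
  refine ⟨fun hn => ⟨hn.re_le_one hr1, hn.re_le_one hr2⟩, fun hre => ?_⟩
  rcases h with h | ⟨hrank, hres⟩
  · exact CoupledHeat.ncve_of_re_le_one hμ (fun w => h.eq_zero_of_dotProduct hμ)
      (fun j k hj hk hjk => h.sub_ne hr1 hr2 hj hk hjk) hre.1 hre.2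
  · exact CoupledHeat.ncve_of_re_le_one hμ (fun w => CoupledHeat.eq_zero_of_rank hrank) hres
      hre.1 hre.2
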